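/- **Setting.** Let $G$ be a $d$-regular undirected graph ($d\ge 1$, parallel edges allowed, no loops) on $V=\{1,\dots,n\}$, and let $\lambda_1\le\dots\le\lambda_n$ be the eigenvalues of its normalized Laplacian $L_G=I-\frac1dA$. For disjoint $S,T\subseteq V$ let $\delta_G(S,T)$ be the number of edges between $S$ and $T$, and for disjoint $P,B$ with $P\ne\varnothing$ let $\phi_G(P\parallel B)=\delta_G(P,V\setminus(P\cup B))/(d|P|)$. **Algorithm 1.** Input: $G$, an integer $k$ with $1<k\le n$, reals $\varepsilon,\delta\in(0,1/80)$ and the values $C'(\delta),C''(\delta)$ of two functions. Put $\hat\delta=\delta/50$, $\hat\varepsilon=\min\{\varepsilon,\hat\delta\}$, $R=\sqrt{\hat\delta/6}$, $\delta'=\hat\delta/(2k)$, $m=2/\delta'$, $t_0=4\sqrt{\log m}/R$, $\alpha=\Pr\{N(0,1)\ge t_0\}$, $\omega=\hat\varepsilon/(e(t_0+1/t_0))$, $T=\lceil\frac2\alpha\ln\frac1{\hat\delta}\rceil$. 1. (*Spectral embedding.*) Compute orthonormal eigenvectors $x_1,\dots,x_k$ of $L_G$ for $\lambda_1,\dots,\lambda_k$;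 let $\bar u=(x_1(u),\dots,x_k(u))$, $\mu(u)=\|\bar u\|^2$, $\mu(S)=\sum_{u\in S}\mu(u)$, $\psi(u)=\bar u/\|\bar u\|$ ($\psi(u)=0$ if $\bar u=0$). 2. (*Orthogonal separators with two buffers.*) For $t=1,\dots,T$ draw an independent standard Gaussian vector $g\in\mathbb R^k$, let $g_u=\langle\psi(u),g\rangle$ and $X_t=\{u:g_u\ge t_0\}$, $Y_t=\{u:t_0-\omega<g_u<t_0\}$, $Z_t=\{u:t_0-2\omega<g_u<t_0-\omega\}$; replace all three by $\varnothing$ unless some $u\in X_t$ satisfies $\mu(\{v\in X_t:\|\psi(u)-\psi(v)\|>R\})\le\delta'\mu(V)$. Let $\widetilde P_t=X_t\setminus\bigcup_{i<t}(X_i\cup Y_i\cup Z_i)$, $\Sigma_t=\bigcup_{i\le t}\widetilde P_i$, $\widetilde B_t=(X_t\cup Y_t)\setminus(\Sigma_t\cup\bigcup_{i<t}\widetilde B_i)$. Finally let $R_P=V\setminus\bigcup_t(X_t\cup Y_t\cup Z_t)$ and $R_B=V\setminus(R_P\cup\bigcup_t(\widetilde P_t\cup\widetilde B_t))$. 3.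 (*Radial thresholding.*) For each $t$ and $r>0$ let $P=\{u\in\widetilde P_t:\mu(u)\ge r\}$, $B=\{u\in\widetilde B_t:\mu(u)\ge\frac r{1+\hat\varepsilon}\}\cup\{u\in\widetilde P_t:\frac r{1+\hat\varepsilon}\le\mu(u)<r\}$, $A'=\{u\in\widetilde P_t:\mu(u)\le\frac r{(1+\hat\varepsilon)^2}\}$, $A''=\{u\in\widetilde P_t:\frac r{(1+\hat\varepsilon)^2}<\mu(u)<\frac r{1+\hat\varepsilon}\}$. Choose $r$ minimizing $\phi_G(P\parallel B)$ subject to $P\neq\varnothing$, $|B|\le C'(\delta)\varepsilon|P|$, $|A''|\le10\varepsilon|P|$, and $\delta_G(A',P\cup B)$ and $\delta_G(P\cup B,(\Sigma_T\cup R_P)\setminus\widetilde P_t)$ both at most $\frac{C''(\delta)}\varepsilon\lambda_k\log k\cdot d|P|$. It suffices to try, for $r$, the means of two elements of the set formed by $0$ and the numbers $(1+\hat\varepsilon)^j\mu(u)$ ($u\in V$, $j=0,1,2$), and the algorithm tries these. 4. (*Selection.*) If such an $r$ exists and $\phi_G(P\parallel B)\le\frac{C''(\delta)}\varepsilon\lambda_k\log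 k$, output the quadruple $(P,B,A',A'')$ and put $\widetilde B_t\setminus B$ into $R_B'$; otherwise put $\widetilde P_t$ into $R_P'$ and $\widetilde B_t$ into $R_B'$. Initially $R_P'=R_P$ and $R_B'=R_B$. The running time is counted on a randomized real RAM: real arithmetic, comparisons, the functions $\sqrt{\cdot}$, $\log$, $\exp$, $x\mapsto\Pr\{N(0,1)\ge x\}$, a standard Gaussian sample, and elementary bookkeeping on indices and truth values cost one step each; rounding up $x>0$ costs $\lceil x\rceil+1$ steps; the exact solution of an $n\times n$ symmetric eigenvalue problem (by any correct solver) costs $n^3$ steps. **Theorem 4.1.** There are functions $C',C'':\mathbb R\to\mathbb R$ such that for every $\delta\in(0,1/80)$ there is a constant $c=c(\delta)$ such that for all $n$, $d\ge1$, $1<k\le n$, $\varepsilon\in(0,1/80)$ and every $d$-regular graph $G$ on $n$ vertices, Algorithm 1 always stops after at most $c\,n^{c}$ steps and, with probability at least $1/4$, it finds subsets $R_P',R_B'$ and $P_i,B_i,A_i',A_i''$ ($i\in[k']$) of $V$ with $k'\ge(1-2\delta)k$ such that 1. all sets $P_i,B_i,A_i',A_i'',R_P',R_B'$ are pairwise disjoint,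 their union is $V$, and all $P_i$ are nonempty; 2. $|B_i|\le C'(\delta)\,\varepsilon\,|P_i|$ for all $i\in[k']$; 3. $\phi_G(P_i\parallel B_i)\le\frac{C''(\delta)}{\varepsilon}\lambda_k\log k$ for all $i\in[k']$; 4. $|A_i''|\le10\varepsilon|P_i|$ for all $i\in[k']$; 5. $|R_B'|\le16\varepsilon n$; 6. $\sum_{j=1}^{k'}\delta_G(A_j',P_i\cup B_i)+\delta_G(R_P',P_i\cup B_i)\le\frac{2C''(\delta)}{\varepsilon}\lambda_k\log k\cdot d|P_i|$ for all $i\in[k']$. -/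

import Mathlib

namespace BufferedCheeger

/-! ### Graphs, Laplacian, buffered expansion -/

/-- A `d`-regular undirected graph on the vertices `0, …, n-1`, parallel edges being allowed:
`mult u v` is the number of edges between `u` and `v`. -/
structure RegularGraph (n d : ℕ) where
  mult : Fin n → Fin n → ℕ
  symm : ∀ u v, mult u v = mult v u
  loopless : ∀ u, mult u u = 0
  regular : ∀ u, ∑ v, mult u v = d

namespace RegularGraph

variable {n d : ℕ}

/-- The number of edges with one end in `S` and the other end in `T` (for disjoint `S`, `T`). -/
def cut (G : RegularGraph n d) (S T : Finset (Fin n)) : ℕ :=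
  ∑ u ∈ S, ∑ v ∈ T, G.mult u v

/-- The buffered expansion of a set `P` with buffer `B`. -/
noncomputable def expansion (G : RegularGraph n d) (P B : Finset (Fin n)) : ℝ :=
  (G.cut P (Finset.univ \ (P ∪ B)) : ℝ) / ((d : ℝ) * (P.card : ℝ))

/-- The normalized Laplacian `I - A / d`. -/
noncomputable def laplacian (G : RegularGraph n d) : Matrix (Fin n) (Fin n) ℝ :=
  1 - (d : ℝ)⁻¹ • Matrix.of fun u v => (G.mult u v : ℝ)

theorem laplacian_isHermitian (G : RegularGraph n d) : G.laplacian.IsHermitian := by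
  ext u v
  simp [laplacian, Matrix.one_apply, G.symm u v, eq_comm]

/-- `lam k` is the `k`-th smallest eigenvalue of the normalized Laplacian, `1 ≤ k ≤ n`
(Mathlib's `eigenvalues₀` lists the eigenvalues in decreasing order). -/
noncomputable def lam (G : RegularGraph n d) (k : ℕ) : ℝ :=
  if h : 1 ≤ k ∧ k ≤ n then
    G.laplacian_isHermitian.eigenvalues₀
      ⟨n - k, by rw [Fintype.card_fin]; exact Nat.sub_lt (h.1.trans h.2) h.1⟩
  else 0

end RegularGraph

/-! ### A randomized real RAM with a step count

A program manipulates real numbers through handles of an abstract type `R`, and only by the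
instructions below; so a program which is polymorphic in `R` cannot do any uncounted real
arithmetic. -/

inductive UnOp where
  | sqrt | log | exp | gaussTail

inductive BinOp where
  | add | sub | mul | div

/-- Programs returning a value of type `α`.
* `lit m`: load a natural number (a constant, or an integer of the input);
* `un`, `bin`: an elementary function, an arithmetic operation;
* `le x y`: compare two numbers;
* `gauss i j`: read the entry `(i, j)` of a table of independent standard Gaussian numbers;
* `ceil x`: the least natural number `≥ x` (found by counting, see `steps`);
* `eig n M`: eigenvalues and orthonormal eigenvectors of the symmetric `n × n` matrix `M`;
* `tick`: one step of bookkeeping on indices and truth values. -/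
inductive Prog (R : Type) (α : Type) : Type where
  | ret (a : α) : Prog R α
  | lit (m : ℕ) (next : R → Prog R α) : Prog R α
  | un (o : UnOp) (x : R) (next : R → Prog R α) : Prog R α
  | bin (o : BinOp) (x y : R) (next : R → Prog R α) : Prog R α
  | le (x y : R) (next : Bool → Prog R α) : Prog R α
  | gauss (i j : ℕ) (next : R → Prog R α) : Prog R α
  | ceil (x : R) (next : ℕ → Prog R α) : Prog R α
  | eig (n : ℕ) (M : Fin n → Fin n → R)
      (next : (Fin n → R) × (Fin n → Fin n → R) → Prog R α) : Prog R α
  | tick (next : Prog R α) : Prog R α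

namespace Prog

variable {R α β : Type}

/-- Sequential composition. -/
def bind : Prog R α → (α → Prog R β) → Prog R β
  | ret a, f => f a
  | lit m k, f => lit m fun z => (k z).bind f
  | un o x k, f => un o x fun z => (k z).bind f
  | bin o x y k, f => bin o x y fun z => (k z).bind f
  | le x y k, f => le x y fun z => (k z).bind f
  | gauss i j k, f => gauss i j fun z => (k z).bind f
  | ceil x k, f => ceil x fun z => (k z).bind f
  | eig n M k, f => eig n M fun z => (k z).bind f
  | tick p, f => tick (p.bind f)

instance : Monad (Prog R) where
  pure := ret
  bind := bind

/-- The value of a unary instruction; `gaussTail x` is the probability that a standard Gaussian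
variable is at least `x`. -/
noncomputable def UnOp.eval : UnOp → ℝ → ℝ
  | .sqrt, x => Real.sqrt x
  | .log, x => Real.log x
  | .exp, x => Real.exp x
  | .gaussTail, x => (ProbabilityTheory.gaussianReal 0 1).real (Set.Ici x)

/-- The value of a binary instruction (division by `0` returns `0`). -/
noncomputable def BinOp.eval : BinOp → ℝ → ℝ → ℝ
  | .add, x, y => x + y
  | .sub, x, y => x - y
  | .mul, x, y => x * y
  | .div, x, y => x / y

/-- A solver for the symmetric eigenvalue problem: it maps a matrix to a list of
eigenvalues and a list of eigenvectors. -/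
abbrev EigenSolver := (n : ℕ) → (Fin n → Fin n → ℝ) → (Fin n → ℝ) × (Fin n → Fin n → ℝ)

/-- The solver is correct: on a symmetric matrix, the eigenvalues come in increasing order and
the `i`-th vector is an eigenvector for the `i`-th eigenvalue, the vectors being orthonormal. -/
structure IsCorrectSolver (S : EigenSolver) : Prop where
  mono : ∀ n M, (∀ u v, M u v = M v u) → Monotone (S n M).1
  orthonormal : ∀ n M, (∀ u v, M u v = M v u) → ∀ i j,
    ∑ u, (S n M).2 i u * (S n M).2 j u = if i = j then 1 else 0
  eigen : ∀ n M, (∀ u v, M u v = M v u) → ∀ i u,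
    ∑ v, M u v * (S n M).2 i v = (S n M).1 i * (S n M).2 i u

/-- The value returned by a program, if eigenvalue problems are answered by `S` and `ω` is the
table of Gaussian numbers. -/
noncomputable def eval (S : EigenSolver) (ω : ℕ × ℕ → ℝ) : Prog ℝ α → α
  | ret a => a
  | lit m k => (k (m : ℝ)).eval S ω
  | un o x k => (k (UnOp.eval o x)).eval S ω
  | bin o x y k => (k (BinOp.eval o x y)).eval S ω
  | le x y k => (k (@decide (x ≤ y) (Classical.propDecidable _))).eval S ω
  | gauss i j k => (k (ω (i, j))).eval S ω
  | ceil x k => (k ⌈x⌉₊).eval S ω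
  | eig n M k => (k (S n M)).eval S ω
  | tick p => p.eval S ω

/-- The number of steps of a run: an instruction is one step, except that `ceil x` is charged
`⌈x⌉ + 1` steps and an `n × n` eigenvalue problem `n ^ 3` steps. -/
noncomputable def steps (S : EigenSolver) (ω : ℕ × ℕ → ℝ) : Prog ℝ α → ℕ
  | ret _ => 0
  | lit m k => (k (m : ℝ)).steps S ω + 1
  | un o x k => (k (UnOp.eval o x)).steps S ω + 1
  | bin o x y k => (k (BinOp.eval o x y)).steps S ω + 1
  | le x y k => (k (@decide (x ≤ y) (Classical.propDecidable _))).steps S ω + 1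
  | gauss i j k => (k (ω (i, j))).steps S ω + 1
  | ceil x k => (k ⌈x⌉₊).steps S ω + (⌈x⌉₊ + 1)
  | eig n M k => (k (S n M)).steps S ω + n ^ 3
  | tick p => p.steps S ω + 1

/-! Single instructions. -/

def num (m : ℕ) : Prog R R := lit m ret
def sqrt (x : R) : Prog R R := un .sqrt x ret
def log (x : R) : Prog R R := un .log x ret
def exp (x : R) : Prog R R := un .exp x ret
def gaussTail (x : R) : Prog R R := un .gaussTail x ret
def plus (x y : R) : Prog R R := bin .add x y ret
def minus (x y : R) : Prog R R := bin .sub x y ret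
def times (x y : R) : Prog R R := bin .mul x y ret
def quot (x y : R) : Prog R R := bin .div x y ret
def leq (x y : R) : Prog R Bool := le x y ret
def normal (i j : ℕ) : Prog R R := gauss i j ret
def natCeil (x : R) : Prog R ℕ := ceil x ret
def solve (n : ℕ) (M : Fin n → Fin n → R) : Prog R ((Fin n → R) × (Fin n → Fin n → R)) :=
  eig n M ret

/-! Loops; every iteration costs one step more than its body. -/

/-- Fill an array of length `n`. -/
def tab : (n : ℕ) → (Fin n → Prog R α) → Prog R (Fin n → α)
  | 0, _ => ret fun i => i.elim0
  | n + 1, f => do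
      let a ← tick (f 0)
      let rest ← tab n fun i => f i.succ
      return Fin.cons a rest

/-- Run `body 0, …, body (T - 1)` one after another on a state. -/
def loop (T : ℕ) (s : α) (body : ℕ → α → Prog R α) : Prog R α :=
  match T with
  | 0 => ret s
  | t + 1 => do
      let s' ← loop t s body
      tick (body t s')

/-- Run `body` for all entries of a list on a state. -/
def each (l : List β) (s : α) (body : β → α → Prog R α) : Prog R α :=
  match l with
  | [] => ret s
  | b :: l' => do
      let s' ← tick (body b s)
      each l' s' body

/-- The sum of `n` numbers. -/
def total : (n : ℕ) → (Fin n → Prog R R) → Prog R R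
  | 0, _ => num 0
  | n + 1, f => do
      let a ← tick (f 0)
      let rest ← total n fun i => f i.succ
      plus a rest

end Prog

open Prog

/-! ### The algorithm -/

section Algorithm

variable {R : Type}

/-- Sets of vertices in a program: arrays of truth values. -/
abbrev VSet (n : ℕ) := Fin n → Bool

/-- `|S|` -/
def size {n : ℕ} (S : VSet n) : Prog R R :=
  total n fun u => num (if S u then 1 else 0)

/-- The number of edges from `S` to `T`. -/
def cutSize {n : ℕ} (w : Fin n → Fin n → ℕ) (S T : VSet n) : Prog R R :=
  total n fun u => total n fun v => num (if S u && T v then w u v else 0)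

/-- Step 1: spectral embedding. Returns the vectors `ū` and the number `λ_k`. -/
def spectralEmbedding {n : ℕ} (w : Fin n → Fin n → ℕ) (d k : ℕ) (hk : 0 < k) (hkn : k ≤ n) :
    Prog R ((Fin n → Fin k → R) × R) := do
  let L ← tab n fun u => tab n fun v => do
    let i ← num (if u = v then 1 else 0)
    let a ← num (w u v)
    let b ← num d
    minus i (← quot a b)
  let (vals, vecs) ← solve n L
  let bar ← tab n fun u => tab k fun i => pure (vecs (i.castLE hkn) u)
  return (bar, vals ⟨k - 1, by omega⟩)

/-- Samples an orthogonal separator `X` with two buffers `Y`, `Z` for the unit vectors `psi u`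
with the measure `mu`, threshold `t` and buffer width `w`, radius `rad` and bound `cap` on the
measure of `X` outside a suitable ball of radius `rad`; `s` is the number of the sample.
(A vertex with `ū = 0` has `psi u = 0` and never gets into one of the sets.) -/
def separator {n k : ℕ} (psi : Fin n → Fin k → R) (mu : Fin n → R) (t w rad cap : R) (s : ℕ) :
    Prog R (VSet n × VSet n × VSet n) := do
  let g ← tab k fun i => normal s i
  let h ← tab n fun u => total k fun i => times (psi u i) (g i)
  let t1 ← minus t w
  let t2 ← minus t1 w
  let X ← tab n fun u => leq t (h u)
  let Y ← tab n fun u => do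
    let lo ← leq (h u) t1
    let hi ← leq t (h u)
    return !lo && !hi
  let Z ← tab n fun u => do
    let lo ← leq (h u) t2
    let hi ← leq t1 (h u)
    return !lo && !hi
  -- keep the sample if some `u ∈ X` has `mu (X \ Ball(u, rad)) ≤ cap`
  let keep ← each (List.finRange n) false fun u found => do
    let far ← total n fun v => do
      let dist2 ← total k fun i => do
        let x ← minus (psi u i) (psi v i)
        times x x
      let near ← leq (← sqrt dist2) rad
      if X v && !near then pure (mu v) else num 0
    let ok ← leq far cap
    return found || (X u && ok)
  let X' ← tab n fun u => pure (keep && X u)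
  let Y' ← tab n fun u => pure (keep && Y u)
  let Z' ← tab n fun u => pure (keep && Z u)
  return (X', Y', Z')

/-- The state of Step 2 after `t` rounds: `Xi` is the union of all sets `X`, `Y`, `Z` so far,
`Sig` of all crude parts, `Gam` of all crude buffers; `parts` lists the crude pairs. -/
structure CrudeState (n : ℕ) where
  Xi : VSet n
  Sig : VSet n
  Gam : VSet n
  parts : List (VSet n × VSet n)

/-- One round of Step 2. -/
def crudeRound {n : ℕ} (sample : ℕ → Prog R (VSet n × VSet n × VSet n)) (s : ℕ)
    (st : CrudeState n) : Prog R (CrudeState n) := do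
  let (X, Y, Z) ← sample s
  let P ← tab n fun u => pure (X u && !st.Xi u)
  let Sig ← tab n fun u => pure (st.Sig u || P u)
  let B ← tab n fun u => pure ((X u || Y u) && !(Sig u || st.Gam u))
  let Gam ← tab n fun u => pure (st.Gam u || B u)
  let Xi ← tab n fun u => pure (st.Xi u || X u || Y u || Z u)
  return { Xi := Xi, Sig := Sig, Gam := Gam, parts := (P, B) :: st.parts }

/-- A refined part `P` with its buffer `B` and the rest `A'`, `A''` of the crude part. -/
structure Piece (n : ℕ) where
  P : VSet n
  B : VSet n
  A' : VSet n
  A'' : VSet n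

/-- The refinement of the crude pair `(tP, tB)` by the threshold `r`, with bands of ratio
`1 + e`. -/
def refine {n : ℕ} (mu : Fin n → R) (e : R) (tP tB : VSet n) (r : R) : Prog R (Piece n) := do
  let q ← plus (← num 1) e
  let r1 ← quot r q
  let r2 ← quot r1 q
  let a ← tab n fun u => leq r (mu u)
  let b ← tab n fun u => leq r1 (mu u)
  let c ← tab n fun u => leq (mu u) r2
  let P ← tab n fun u => pure (tP u && a u)
  let B ← tab n fun u => pure ((tB u && b u) || (tP u && b u && !a u))
  let A' ← tab n fun u => pure (tP u && c u)
  let A'' ← tab n fun u => pure (tP u && !c u && !b u)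
  return { P := P, B := B, A' := A', A'' := A'' }

/-- Checks the constraints of Step 3 (including that `P` is nonempty) and returns the truth
value and the buffered expansion. `b1` bounds `|B| / |P|`, `b2` bounds `|A''| / |P|`, `kap * d`
bounds the two edge counts divided by `|P|`; `W` is the set `Σ_T ∪ R_P`. -/
def check {n : ℕ} (w : Fin n → Fin n → ℕ) (d : ℕ) (b1 b2 kap : R) (W tP : VSet n)
    (p : Piece n) : Prog R (Bool × R) := do
  let sP ← size p.P
  let sB ← size p.B
  let sA ← size p.A''
  let vol ← times (← num d) sP
  let PB ← tab n fun u => pure (p.P u || p.B u)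
  let out ← tab n fun u => pure (!PB u)
  let W' ← tab n fun u => pure (W u && !tP u)
  let bound ← times kap vol
  let c0 ← leq (← num 1) sP
  let c1 ← leq sB (← times b1 sP)
  let c2 ← leq sA (← times b2 sP)
  let c3 ← leq (← cutSize w p.A' PB) bound
  let c4 ← leq (← cutSize w PB W') bound
  let phi ← quot (← cutSize w p.P out) vol
  return (c0 && c1 && c2 && c3 && c4, phi)

/-- The thresholds to be tried: all means of two elements of the set which consists of `0` and
the numbers `mu u`, `(1 + e) mu u`, `(1 + e)² mu u`. They meet every value and every
gap between two values at which one of the sets in `refine` changes. -/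
def candidates {n : ℕ} (mu : Fin n → R) (e : R) : Prog R (List R) := do
  let q ← plus (← num 1) e
  let base ← each (List.finRange n) [← num 0] fun u l => do
    let x ← times q (mu u)
    let y ← times q x
    return mu u :: x :: y :: l
  each base [] fun a l => each base l fun b l' => do
    let c ← quot (← plus a b) (← num 2)
    return c :: l'

/-- The output of the algorithm. -/
structure Output (n : ℕ) where
  pieces : List (Piece n)
  RP : VSet n
  RB : VSet n

/-- Steps 3 and 4 for one crude pair: find a positive threshold `r` that minimizes the buffered
expansion subject to the constraints; keep the refined sets if there is one and the expansion is
at most `kap`, otherwise add the crude pair to the leftover sets. -/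
def refineStep {n : ℕ} (w : Fin n → Fin n → ℕ) (d : ℕ) (mu : Fin n → R) (e b1 b2 kap : R)
    (W : VSet n) (cands : List R) (c : VSet n × VSet n) (o : Output n) :
    Prog R (Output n) := do
  let (tP, tB) := c
  let best ← each cands (none : Option (R × R)) fun r best => do
    let npos ← leq r (← num 0)
    let p ← refine mu e tP tB r
    let (ok, phi) ← check w d b1 b2 kap W tP p
    if ok && !npos then
      match best with
      | none => pure (some (r, phi))
      | some (r', phi') =>
          let worse ← leq phi' phi
          pure (if worse then some (r', phi') else some (r, phi))
    else pure best
  let discard : Prog R (Output n) := do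
    let RP ← tab n fun u => pure (o.RP u || tP u)
    let RB ← tab n fun u => pure (o.RB u || tB u)
    return { pieces := o.pieces, RP := RP, RB := RB }
  match best with
  | none => discard
  | some (r, phi) =>
      let good ← leq phi kap
      if good then
        let p ← refine mu e tP tB r
        let RB ← tab n fun u => pure (o.RB u || (tB u && !p.B u))
        return { pieces := p :: o.pieces, RP := o.RP, RB := RB }
      else discard

/-- The partitioning algorithm for the graph with edge multiplicities `w` and degree `d`, with the parameters
`k`, `eps`, `del`, where `C1`, `C2` are the numbers `C'(del)`, `C''(del)`. The separators and
the bands of the thresholds are taken with `del/50` and `min eps (del/50)`. -/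
def partitionAlgorithm {n : ℕ} (w : Fin n → Fin n → ℕ) (d k : ℕ) (hk : 0 < k) (hkn : k ≤ n)
    (eps del C1 C2 : R) : Prog R (Output n) := do
  let one ← num 1
  let two ← num 2
  let kR ← num k
  let dlt ← quot del (← num 50)
  let e ← (do if (← leq eps dlt) then pure eps else pure dlt)
  -- Step 1
  let (bar, lamk) ← spectralEmbedding w d k hk hkn
  let mu ← tab n fun u => total k fun i => times (bar u i) (bar u i)
  let psi ← tab n fun u => do
    let len ← sqrt (mu u)
    tab k fun i => quot (bar u i) len
  let muV ← total n fun u => pure (mu u)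
  -- Step 2
  let rad ← sqrt (← quot dlt (← num 6))
  let dlt' ← quot dlt (← times two kR)
  let cap ← times dlt' muV
  -- threshold `t = 4 √(log m) / rad` for `m = 2 / dlt'`, and width `e / (exp 1 * (t + 1 / t))`
  let t ← quot (← times (← num 4) (← sqrt (← log (← quot two dlt')))) rad
  let width ← quot e (← times (← exp one) (← plus t (← quot one t)))
  let alpha ← gaussTail t
  let T ← natCeil (← times (← quot two alpha) (← log (← quot one dlt)))
  let none' ← tab n fun _ => pure false
  let st ← loop T { Xi := none', Sig := none', Gam := none', parts := [] }
    (crudeRound (separator psi mu t width rad cap))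
  let RP ← tab n fun u => pure (!st.Xi u)
  let RB ← tab n fun u => pure (!(st.Sig u || st.Gam u || RP u))
  -- Steps 3 and 4
  let b1 ← times C1 eps
  let b2 ← times (← num 10) eps
  let kap ← times (← times (← quot C2 eps) lamk) (← log kR)
  let W ← tab n fun u => pure (st.Sig u || RP u)
  let cands ← candidates mu e
  each st.parts { pieces := [], RP := RP, RB := RB } (refineStep w d mu e b1 b2 kap W cands)

end Algorithm

/-! ### What the algorithm has to find -/

/-- The set of vertices stored in an array of truth values. -/
def VSet.toFinset {n : ℕ} (S : VSet n) : Finset (Fin n) := Finset.univ.filter fun u => S u = true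

/-- The sets `P i`, `B i`, `A' i`, `A'' i` (`i < k'`) and `RP`, `RB` form a partial buffered
partitioning of `G` with the required properties; `b` stands for `C'(δ)` and `c` for `C''(δ)`. -/
structure IsPartialPartitioning {n d : ℕ} (G : RegularGraph n d) (k : ℕ) (ε δ b c : ℝ)
    (k' : ℕ) (P B A' A'' : Fin k' → Finset (Fin n)) (RP RB : Finset (Fin n)) : Prop where
  count : (1 - 2 * δ) * (k : ℝ) ≤ (k' : ℝ)
  disjoint_pieces : ∀ i j, i ≠ j →
    Disjoint (P i ∪ B i ∪ A' i ∪ A'' i) (P j ∪ B j ∪ A' j ∪ A'' j)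
  disjoint_inside : ∀ i, Disjoint (P i) (B i) ∧ Disjoint (P i) (A' i) ∧ Disjoint (P i) (A'' i) ∧
    Disjoint (B i) (A' i) ∧ Disjoint (B i) (A'' i) ∧ Disjoint (A' i) (A'' i)
  disjoint_RP : ∀ i, Disjoint RP (P i ∪ B i ∪ A' i ∪ A'' i)
  disjoint_RB : ∀ i, Disjoint RB (P i ∪ B i ∪ A' i ∪ A'' i)
  disjoint_RP_RB : Disjoint RP RB
  nonempty : ∀ i, (P i).Nonempty
  cover : ∀ u, u ∈ RP ∨ u ∈ RB ∨ ∃ i, u ∈ P i ∪ B i ∪ A' i ∪ A'' i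
  buffer : ∀ i, ((B i).card : ℝ) ≤ b * ε * ((P i).card : ℝ)
  expansion : ∀ i, G.expansion (P i) (B i) ≤ c / ε * G.lam k * Real.log k
  band : ∀ i, ((A'' i).card : ℝ) ≤ 10 * ε * ((P i).card : ℝ)
  leftover : (RB.card : ℝ) ≤ 16 * ε * n
  boundary : ∀ i, ∑ j, (G.cut (A' j) (P i ∪ B i) : ℝ) + (G.cut RP (P i ∪ B i) : ℝ) ≤
    2 * c / ε * G.lam k * Real.log k * ((d : ℝ) * ((P i).card : ℝ))

/-- The sets returned by the algorithm have the required properties. -/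
def Output.IsGood {n d : ℕ} (o : Output n) (G : RegularGraph n d) (k : ℕ) (ε δ b c : ℝ) : Prop :=
  IsPartialPartitioning G k ε δ b c o.pieces.length
    (fun i => (o.pieces.get i).P.toFinset) (fun i => (o.pieces.get i).B.toFinset)
    (fun i => (o.pieces.get i).A'.toFinset) (fun i => (o.pieces.get i).A''.toFinset)
    o.RP.toFinset o.RB.toFinset

/-- The law of a table of independent standard Gaussian numbers. -/
noncomputable def gaussTable : MeasureTheory.Measure (ℕ × ℕ → ℝ) :=
  MeasureTheory.Measure.infinitePi fun _ => ProbabilityTheory.gaussianReal 0 1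

end BufferedCheeger

open BufferedCheeger BufferedCheeger.Prog

namespace BufferedCheeger

/-! ### Values and step counts of the instructions and loops -/

namespace Prog

variable {α β γ : Type} (S : EigenSolver) (ω : ℕ × ℕ → ℝ)

/-! Write `μ(u) = ‖ū‖²`, `δ̂ = δ/50`, `ê = min(ε, δ̂)`, and let `α` be the Gaussian tail at the
threshold `t₀`. Disjointness, covering and the inequalities for each single piece hold for every
table of Gaussian numbers, since only pieces that pass the checks are output (`isGood_finalOutput`).
Chance decides only whether enough pieces are found and whether the leftover buffer is small.

Geometry. Orthonormality gives `μ(V) = k` and `Σ_v ⟨v̄, w⟩² = ‖w‖²`. Hence a small ball of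
directions has measure hardly more than 1 (`sum_ball_le`), and every crude part has measure at most
`1 + δ̂`; so refined parts of total measure close to `k` must be almost `k` in number. The
eigenvalue equations bound the sum of `‖ū - v̄‖²` over the edges by a multiple of `d k λ_k`. This
energy controls radial differences (`sqLength_sub_le`) as well as angular ones
(`sqLength_mul_sqDist_le`).

Separators. One sample contains a given `u` with probability at least `α/2`, has it in a buffer with
probability at most `ê α`, and separates `u` from `v` by a buffer with probability at most `40
(t₀²/ê) α ‖ψ(u) - ψ(v)‖²`. The dependence on the distance is quadratic because a projection has to
jump over a whole buffer. Only rounds before or at the first meeting with `u` matter, so a geometric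
series replaces `α` by a constant (`measure_exists_first_le`). Two buffers are needed: the first
separates a part from the vertices outside the part and its buffer, the second separates the part
together with its buffer from the vertices kept elsewhere. `firstSep_of_crudePart` and
`firstSep_of_crude` reduce these configurations to first separations. Markov's inequality for four
quantities then yields a good event of probability at least 3/8.

Radial step. The integral of `|P_r|` over `r > 0` is the measure of the crude part. If every `r`
violated a constraint or had large expansion, `|P_r|` would be bounded for each `r` by quantities
with a smaller integral, unless the crude buffer is heavy or the edge cost is large compared with
the part (`exists_threshold`). On the good event such exceptional parts carry little measure
altogether, which leaves enough refined ones (`le_card_refined`).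

Finally `t₀²` is of order `log k` for fixed `δ`, which is the source of the factor `log k` in the
bounds; for the same reason `1/α`, and with it the number of rounds and the running time, is
polynomial (`exists_sepRounds_le`). -/

theorem eval_bind' (p : Prog ℝ α) (f : α → Prog ℝ β) :
    (p.bind f).eval S ω = (f (p.eval S ω)).eval S ω := by
  induction p with
  | le x y k ih => exact ih _
  | _ => simp_all [Prog.bind, eval]

@[simp] theorem eval_bind (p : Prog ℝ α) (f : α → Prog ℝ β) :
    (p >>= f).eval S ω = (f (p.eval S ω)).eval S ω := eval_bind' S ω p f

theorem steps_bind' (p : Prog ℝ α) (f : α → Prog ℝ β) :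
    (p.bind f).steps S ω = p.steps S ω + (f (p.eval S ω)).steps S ω := by
  induction p with
  | le x y k ih => simp only [Prog.bind, eval, steps, ih]; omega
  | _ => simp_all [Prog.bind, eval, steps] <;> omega

@[simp] theorem steps_bind (p : Prog ℝ α) (f : α → Prog ℝ β) :
    (p >>= f).steps S ω = p.steps S ω + (f (p.eval S ω)).steps S ω := steps_bind' S ω p f

@[simp] theorem eval_pure (a : α) : (pure a : Prog ℝ α).eval S ω = a := rfl
@[simp] theorem steps_pure (a : α) : (pure a : Prog ℝ α).steps S ω = 0 := rfl
@[simp] theorem eval_ret (a : α) : (ret a : Prog ℝ α).eval S ω = a := rfl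
@[simp] theorem steps_ret (a : α) : (ret a : Prog ℝ α).steps S ω = 0 := rfl
@[simp] theorem eval_tick (p : Prog ℝ α) : (tick p).eval S ω = p.eval S ω := rfl
@[simp] theorem steps_tick (p : Prog ℝ α) : (tick p).steps S ω = p.steps S ω + 1 := rfl
@[simp] theorem eval_num (m : ℕ) : (num m : Prog ℝ ℝ).eval S ω = m := rfl
@[simp] theorem steps_num (m : ℕ) : (num m : Prog ℝ ℝ).steps S ω = 1 := rfl
@[simp] theorem eval_sqrt (x : ℝ) : (sqrt x).eval S ω = Real.sqrt x := rfl
@[simp] theorem steps_sqrt (x : ℝ) : (sqrt x).steps S ω = 1 := rfl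
@[simp] theorem eval_log (x : ℝ) : (log x).eval S ω = Real.log x := rfl
@[simp] theorem steps_log (x : ℝ) : (log x).steps S ω = 1 := rfl
@[simp] theorem eval_exp (x : ℝ) : (exp x).eval S ω = Real.exp x := rfl
@[simp] theorem steps_exp (x : ℝ) : (exp x).steps S ω = 1 := rfl
@[simp] theorem eval_gaussTail (x : ℝ) : (gaussTail x).eval S ω =
    (ProbabilityTheory.gaussianReal 0 1).real (Set.Ici x) := rfl
@[simp] theorem steps_gaussTail (x : ℝ) : (gaussTail x).steps S ω = 1 := rfl
@[simp] theorem eval_plus (x y : ℝ) : (plus x y).eval S ω = x + y := rfl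
@[simp] theorem steps_plus (x y : ℝ) : (plus x y).steps S ω = 1 := rfl
@[simp] theorem eval_minus (x y : ℝ) : (minus x y).eval S ω = x - y := rfl
@[simp] theorem steps_minus (x y : ℝ) : (minus x y).steps S ω = 1 := rfl
@[simp] theorem eval_times (x y : ℝ) : (times x y).eval S ω = x * y := rfl
@[simp] theorem steps_times (x y : ℝ) : (times x y).steps S ω = 1 := rfl
@[simp] theorem eval_quot (x y : ℝ) : (quot x y).eval S ω = x / y := rfl
@[simp] theorem steps_quot (x y : ℝ) : (quot x y).steps S ω = 1 := rfl
@[simp] theorem eval_leq (x y : ℝ) : (leq x y).eval S ω = decide (x ≤ y) := by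
  simp only [leq, eval]
@[simp] theorem steps_leq (x y : ℝ) : (leq x y).steps S ω = 1 := rfl
@[simp] theorem eval_normal (i j : ℕ) : (normal i j).eval S ω = ω (i, j) := rfl
@[simp] theorem steps_normal (i j : ℕ) : (normal i j : Prog ℝ ℝ).steps S ω = 1 := rfl
@[simp] theorem eval_natCeil (x : ℝ) : (natCeil x).eval S ω = ⌈x⌉₊ := rfl
@[simp] theorem steps_natCeil (x : ℝ) : (natCeil x).steps S ω = ⌈x⌉₊ + 1 := by
  simp [natCeil, steps]
@[simp] theorem eval_solve (n : ℕ) (M : Fin n → Fin n → ℝ) :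
    (solve n M).eval S ω = S n M := rfl
@[simp] theorem steps_solve (n : ℕ) (M : Fin n → Fin n → ℝ) :
    (solve n M).steps S ω = n ^ 3 := by
  simp [solve, steps]

@[simp] theorem eval_tab (n : ℕ) (f : Fin n → Prog ℝ α) :
    (tab n f).eval S ω = fun i => (f i).eval S ω := by
  induction n with
  | zero => funext i; exact i.elim0
  | succ n ih =>
    simp only [tab, eval_bind, eval_tick, ih, eval_pure]
    funext i
    refine Fin.cases ?_ (fun j => ?_) i <;> simp

@[simp] theorem eval_total (n : ℕ) (f : Fin n → Prog ℝ ℝ) :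
    (total n f).eval S ω = ∑ i, (f i).eval S ω := by
  induction n with
  | zero => simp [total]
  | succ n ih => simp [total, ih, Fin.sum_univ_succ]

@[simp] theorem eval_each (l : List β) (s : α) (body : β → α → Prog ℝ α) :
    (each l s body).eval S ω = l.foldl (fun s b => (body b s).eval S ω) s := by
  induction l generalizing s with
  | nil => simp [each]
  | cons b l ih => simp [each, ih]

@[simp] theorem eval_loop_succ (T : ℕ) (s : α) (body : ℕ → α → Prog ℝ α) :
    (loop (T + 1) s body).eval S ω = (body T ((loop T s body).eval S ω)).eval S ω := by
  simp [loop]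

@[simp] theorem eval_ite (c : Prop) [Decidable c] (p q : Prog ℝ α) :
    (if c then p else q).eval S ω = if c then p.eval S ω else q.eval S ω := by
  split <;> rfl

@[simp] theorem steps_ite (c : Prop) [Decidable c] (p q : Prog ℝ α) :
    (if c then p else q).steps S ω = if c then p.steps S ω else q.steps S ω := by
  split <;> rfl

end Prog

/-! ### Values of the parts of the algorithm -/

section Values

variable {n : ℕ} (S : EigenSolver) (ω : ℕ × ℕ → ℝ)

@[simp] theorem mem_toFinset (A : VSet n) (u : Fin n) : u ∈ A.toFinset ↔ A u = true := by
  simp [VSet.toFinset]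

@[simp] theorem eval_size (A : VSet n) : (size A).eval S ω = (A.toFinset.card : ℝ) := by
  simp [size, VSet.toFinset]

theorem eval_cutSize {d : ℕ} (G : RegularGraph n d) (A B : VSet n) :
    (cutSize G.mult A B).eval S ω = (G.cut A.toFinset B.toFinset : ℝ) := by
  simp only [cutSize, eval_total, eval_num, RegularGraph.cut, VSet.toFinset]
  push_cast
  rw [Finset.sum_filter]
  refine Finset.sum_congr rfl fun u _ => ?_
  rw [Finset.sum_filter]
  by_cases h : A u <;> simp [h]

/-- The coordinate of `psi u` in the direction `g`. -/
noncomputable def proj {k : ℕ} (psi : Fin n → Fin k → ℝ) (g : Fin k → ℝ) (u : Fin n) : ℝ :=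
  ∑ i, psi u i * g i

/-- The measure of the part of `{v | t ≤ proj psi g v}` at distance more than `rad` from `u`. -/
noncomputable def farMeasure {k : ℕ} (psi : Fin n → Fin k → ℝ) (mu : Fin n → ℝ) (t rad : ℝ)
    (g : Fin k → ℝ) (u : Fin n) : ℝ :=
  ∑ v, if t ≤ proj psi g v ∧ rad < Real.sqrt (∑ i, (psi u i - psi v i) * (psi u i - psi v i))
    then mu v else 0

/-- The condition under which a sample is not discarded. -/
def Kept {k : ℕ} (psi : Fin n → Fin k → ℝ) (mu : Fin n → ℝ) (t rad cap : ℝ)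
    (g : Fin k → ℝ) : Prop :=
  ∃ u, t ≤ proj psi g u ∧ farMeasure psi mu t rad g u ≤ cap

open Classical in
/-- The three sets of a sample, as a function of the Gaussian vector. -/
noncomputable def sampleOf {k : ℕ} (psi : Fin n → Fin k → ℝ) (mu : Fin n → ℝ)
    (t w rad cap : ℝ) (g : Fin k → ℝ) : VSet n × VSet n × VSet n :=
  (fun u => decide (Kept psi mu t rad cap g ∧ t ≤ proj psi g u),
   fun u => decide (Kept psi mu t rad cap g ∧ t - w < proj psi g u ∧ proj psi g u < t),
   fun u => decide (Kept psi mu t rad cap g ∧ t - w - w < proj psi g u ∧ proj psi g u < t - w))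

theorem foldl_or {β : Type} (l : List β) (p : β → Bool) (b : Bool) :
    l.foldl (fun s a => s || p a) b = (b || l.any p) := by
  induction l generalizing b with
  | nil => simp
  | cons a l ih => simp [ih, Bool.or_assoc]

theorem eval_separator {k : ℕ} (psi : Fin n → Fin k → ℝ) (mu : Fin n → ℝ)
    (t w rad cap : ℝ) (s : ℕ) :
    (separator psi mu t w rad cap s).eval S ω =
      sampleOf psi mu t w rad cap (fun i => ω (s, i)) := by
  classical
  have hk : (List.finRange n).any (fun u => (decide (t ≤ proj psi (fun i => ω (s, i)) u) &&
      decide (farMeasure psi mu t rad (fun i => ω (s, i)) u ≤ cap))) =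
      decide (Kept psi mu t rad cap (fun i => ω (s, i))) := by
    rw [Bool.eq_iff_iff, decide_eq_true_eq]
    simp [Kept]
  simp only [separator, eval_bind, eval_tab, eval_total, eval_times, eval_normal, eval_minus,
    eval_leq, eval_pure, eval_each, eval_ite, eval_sqrt, eval_num]
  have h1 : ∀ u, (∑ x, if (decide (t ≤ ∑ i, psi x i * ω (s, ↑i)) &&
              !decide (√(∑ x_1, (psi u x_1 - psi x x_1) * (psi u x_1 - psi x x_1)) ≤ rad)) =
            true then mu x else ((0 : ℕ) : ℝ)) = farMeasure psi mu t rad (fun i => ω (s, i)) u := by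
    intro u
    simp [farMeasure, proj]
  simp only [h1]
  rw [foldl_or]
  simp only [proj] at hk
  rw [hk]
  simp only [sampleOf, proj]
  refine Prod.ext ?_ (Prod.ext ?_ ?_) <;> funext u <;> rw [Bool.eq_iff_iff] <;>
    simp [lt_sub_iff_add_lt]

/-- One round of the crude partition. -/
def crudeNext (smp : VSet n × VSet n × VSet n) (st : CrudeState n) : CrudeState n :=
  let P : VSet n := fun u => smp.1 u && !st.Xi u
  let Sig : VSet n := fun u => st.Sig u || P u
  let B : VSet n := fun u => (smp.1 u || smp.2.1 u) && !(Sig u || st.Gam u)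
  { Xi := fun u => st.Xi u || smp.1 u || smp.2.1 u || smp.2.2 u
    Sig := Sig
    Gam := fun u => st.Gam u || B u
    parts := (P, B) :: st.parts }

theorem eval_crudeRound (sample : ℕ → Prog ℝ (VSet n × VSet n × VSet n)) (s : ℕ)
    (st : CrudeState n) :
    (crudeRound sample s st).eval S ω = crudeNext ((sample s).eval S ω) st := by
  simp [crudeRound, crudeNext]

/-- The state of the crude partition after `T` rounds with the given samples. -/
def crudeState (smp : ℕ → VSet n × VSet n × VSet n) : ℕ → CrudeState n
  | 0 => { Xi := fun _ => false, Sig := fun _ => false, Gam := fun _ => false, parts := [] }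
  | t + 1 => crudeNext (smp t) (crudeState smp t)

theorem eval_loop_crudeRound (sample : ℕ → Prog ℝ (VSet n × VSet n × VSet n)) (T : ℕ) :
    (loop T { Xi := fun _ => false, Sig := fun _ => false, Gam := fun _ => false, parts := [] }
      (crudeRound sample)).eval S ω = crudeState (fun s => (sample s).eval S ω) T := by
  induction T with
  | zero => rfl
  | succ T ih => rw [eval_loop_succ, ih, eval_crudeRound, crudeState]

/-- The refinement of a crude pair by a threshold. -/
noncomputable def refinePiece (mu : Fin n → ℝ) (e : ℝ) (tP tB : VSet n) (r : ℝ) : Piece n where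
  P := fun u => tP u && decide (r ≤ mu u)
  B := fun u => (tB u && decide (r / (1 + e) ≤ mu u)) ||
    (tP u && decide (r / (1 + e) ≤ mu u) && !decide (r ≤ mu u))
  A' := fun u => tP u && decide (mu u ≤ r / (1 + e) / (1 + e))
  A'' := fun u => tP u && !decide (mu u ≤ r / (1 + e) / (1 + e)) && !decide (r / (1 + e) ≤ mu u)

theorem eval_refine (mu : Fin n → ℝ) (e : ℝ) (tP tB : VSet n) (r : ℝ) :
    (refine mu e tP tB r).eval S ω = refinePiece mu e tP tB r := by
  simp [refine, refinePiece]

/-- The constraints on a refined piece. -/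
def Feasible {d : ℕ} (G : RegularGraph n d) (b1 b2 kap : ℝ) (W tP : VSet n) (p : Piece n) :
    Prop :=
  1 ≤ (p.P.toFinset.card : ℝ) ∧ (p.B.toFinset.card : ℝ) ≤ b1 * p.P.toFinset.card ∧
  (p.A''.toFinset.card : ℝ) ≤ b2 * p.P.toFinset.card ∧
  (G.cut p.A'.toFinset (p.P.toFinset ∪ p.B.toFinset) : ℝ) ≤ kap * (d * p.P.toFinset.card) ∧
  (G.cut (p.P.toFinset ∪ p.B.toFinset) (W.toFinset \ tP.toFinset) : ℝ) ≤
    kap * (d * p.P.toFinset.card)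

open Classical in
theorem eval_check {d : ℕ} (G : RegularGraph n d) (b1 b2 kap : ℝ) (W tP : VSet n) (p : Piece n) :
    (check G.mult d b1 b2 kap W tP p).eval S ω =
      (decide (Feasible G b1 b2 kap W tP p), G.expansion p.P.toFinset p.B.toFinset) := by
  have h1 : VSet.toFinset (fun u => p.P u || p.B u) = p.P.toFinset ∪ p.B.toFinset := by
    ext; simp
  have h2 : VSet.toFinset (fun u => W u && !tP u) = W.toFinset \ tP.toFinset := by
    ext; simp
  have h3 : VSet.toFinset (fun u => !(p.P u || p.B u)) =
      Finset.univ \ (p.P.toFinset ∪ p.B.toFinset) := by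
    ext; simp
  simp only [check, eval_bind, eval_tab, eval_pure, eval_size, eval_num, eval_times, eval_leq,
    eval_cutSize, eval_quot, h1, h2, h3]
  refine Prod.ext ?_ rfl
  rw [Bool.eq_iff_iff]
  simp [Feasible, and_assoc]

/-- The values between which the thresholds are taken. -/
noncomputable def breakpoints (mu : Fin n → ℝ) (e : ℝ) : List ℝ :=
  (List.finRange n).foldl
    (fun l u => mu u :: (1 + e) * mu u :: (1 + e) * ((1 + e) * mu u) :: l) [0]

theorem mem_breakpoints (mu : Fin n → ℝ) (e x : ℝ) : x ∈ breakpoints mu e ↔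
    x = 0 ∨ ∃ u, x = mu u ∨ x = (1 + e) * mu u ∨ x = (1 + e) * ((1 + e) * mu u) := by
  have : ∀ (l : List (Fin n)) (l0 : List ℝ), x ∈ l.foldl
    (fun l u => mu u :: (1 + e) * mu u :: (1 + e) * ((1 + e) * mu u) :: l) l0 ↔ x ∈ l0 ∨
    ∃ u ∈ l, x = mu u ∨ x = (1 + e) * mu u ∨ x = (1 + e) * ((1 + e) * mu u) := by
    intro l
    induction l with
    | nil => simp
    | cons a l ih =>
      intro l0
      simp only [List.foldl_cons, ih, List.mem_cons, exists_eq_or_imp]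
      grind
  rw [breakpoints, this]
  simp

/-- The thresholds which are tried. -/
noncomputable def thresholds (mu : Fin n → ℝ) (e : ℝ) : List ℝ :=
  (breakpoints mu e).foldl
    (fun l a => (breakpoints mu e).foldl (fun l' b => (a + b) / 2 :: l') l) []

theorem eval_candidates (mu : Fin n → ℝ) (e : ℝ) :
    (candidates mu e).eval S ω = thresholds mu e := by
  simp [candidates, thresholds, breakpoints]

theorem mem_foldl_cons {β : Type} (f : β → ℝ) (x : ℝ) (l : List β) (l0 : List ℝ) :
    x ∈ l.foldl (fun l' b => f b :: l') l0 ↔ x ∈ l0 ∨ ∃ b ∈ l, x = f b := by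
  induction l generalizing l0 with
  | nil => simp
  | cons a l ih => simp only [List.foldl_cons, ih, List.mem_cons, exists_eq_or_imp]; grind

theorem mem_thresholds (mu : Fin n → ℝ) (e x : ℝ) : x ∈ thresholds mu e ↔
    ∃ a ∈ breakpoints mu e, ∃ b ∈ breakpoints mu e, x = (a + b) / 2 := by
  have : ∀ (l l0 : List ℝ), x ∈ l.foldl
    (fun l a => (breakpoints mu e).foldl (fun l' b => (a + b) / 2 :: l') l) l0 ↔ x ∈ l0 ∨
    ∃ a ∈ l, ∃ b ∈ breakpoints mu e, x = (a + b) / 2 := by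
    intro l
    induction l with
    | nil => simp
    | cons a l ih =>
      intro l0
      simp only [List.foldl_cons, ih, mem_foldl_cons, List.mem_cons, exists_eq_or_imp]
      grind
  rw [thresholds, this]
  simp

end Values

end BufferedCheeger

namespace BufferedCheeger

/-! ### The scan for the best threshold -/

section Search

open Classical in
/-- One step of the search for the best threshold. -/
noncomputable def searchStep (feas : ℝ → Prop) (phi : ℝ → ℝ) (best : Option (ℝ × ℝ)) (r : ℝ) :
    Option (ℝ × ℝ) :=
  if feas r ∧ 0 < r then
    match best with
    | none => some (r, phi r)
    | some (r', phi') => if phi' ≤ phi r then some (r', phi') else some (r, phi r)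
  else best

/-- Loop invariant of a linear scan, with `l0` as the list of thresholds tried so far: the stored
candidate is admissible and carries its true value, and no admissible threshold tried so far has a
smaller one. -/
theorem searchStep_foldl_spec (feas : ℝ → Prop) (phi : ℝ → ℝ) (l : List ℝ)
    (b : Option (ℝ × ℝ)) (l0 : List ℝ)
    (hb : ∀ q ∈ b, q.1 ∈ l0 ∧ feas q.1 ∧ 0 < q.1 ∧ q.2 = phi q.1)
    (hb' : ∀ r ∈ l0, feas r → 0 < r → ∃ q ∈ b, q.2 ≤ phi r) :
    (∀ q ∈ l.foldl (searchStep feas phi) b,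
      q.1 ∈ l0 ++ l ∧ feas q.1 ∧ 0 < q.1 ∧ q.2 = phi q.1) ∧
    (∀ r ∈ l0 ++ l, feas r → 0 < r → ∃ q ∈ l.foldl (searchStep feas phi) b, q.2 ≤ phi r) := by
  induction l generalizing b l0 with
  | nil => exact ⟨by simpa using hb, by simpa using hb'⟩
  | cons a l ih =>
    have := ih (searchStep feas phi b a) (l0 ++ [a]) ?_ ?_
    · simpa using this
    · intro q hq
      unfold searchStep at hq
      split_ifs at hq with h
      · cases b with
        | none =>
          simp only [Option.mem_def, Option.some.injEq] at hq
          subst hq; simp [h]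
        | some p =>
          simp only at hq
          split_ifs at hq with h2
          · have := hb q hq
            simp [this]
          · simp only [Option.mem_def, Option.some.injEq] at hq
            subst hq; simp [h]
      · have := hb q hq
        simp [this]
    · intro r hr hf h0
      rw [List.mem_append, List.mem_singleton] at hr
      unfold searchStep
      rcases hr with hr | rfl
      · obtain ⟨q, hq, hle⟩ := hb' r hr hf h0
        split_ifs with h
        · cases b with
          | none => simp at hq
          | some p =>
            simp only [Option.mem_def, Option.some.injEq] at hq
            subst hq
            simp only
            split_ifs with h2
            · exact ⟨_, rfl, hle⟩
            · exact ⟨_, rfl, by simp only; linarith⟩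
        · exact ⟨q, hq, hle⟩
      · rw [if_pos ⟨hf, h0⟩]
        cases b with
        | none => exact ⟨_, rfl, le_rfl⟩
        | some p =>
          simp only
          split_ifs with h2
          · exact ⟨_, rfl, h2⟩
          · exact ⟨_, rfl, le_rfl⟩

open Classical in
/-- The best threshold of a list, if its value is at most `kap`. -/
noncomputable def bestThreshold (feas : ℝ → Prop) (phi : ℝ → ℝ) (kap : ℝ) (l : List ℝ) :
    Option ℝ :=
  match l.foldl (searchStep feas phi) none with
  | none => none
  | some (r, p) => if p ≤ kap then some r else none

theorem bestThreshold_eq_some {feas : ℝ → Prop} {phi : ℝ → ℝ} {kap : ℝ} {l : List ℝ} {r : ℝ}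
    (h : bestThreshold feas phi kap l = some r) : feas r ∧ 0 < r ∧ phi r ≤ kap := by
  have := (searchStep_foldl_spec feas phi l none [] (by simp) (by simp)).1
  unfold bestThreshold at h
  split at h
  · simp at h
  · next r' p heq =>
    rw [heq] at this
    have := this (r', p) rfl
    split_ifs at h with hp
    simp only [Option.some.injEq] at h
    subst h
    simp only at this
    exact ⟨this.2.1, this.2.2.1, this.2.2.2 ▸ hp⟩

/-- Completeness of the search: since the scan minimizes, a single admissible threshold in the list
with value at most `kap` forces acceptance. Thus the analysis only has to exhibit one threshold, not
the chosen one. -/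
theorem exists_bestThreshold {feas : ℝ → Prop} {phi : ℝ → ℝ} {kap : ℝ} {l : List ℝ} {r : ℝ}
    (hr : r ∈ l) (hf : feas r) (h0 : 0 < r) (hk : phi r ≤ kap) :
    ∃ r', bestThreshold feas phi kap l = some r' := by
  obtain ⟨q, hq, hle⟩ := (searchStep_foldl_spec feas phi l none [] (by simp) (by simp)).2 r
    (by simpa using hr) hf h0
  unfold bestThreshold
  rw [Option.mem_def] at hq
  rw [hq]
  exact ⟨q.1, if_pos (hle.trans hk)⟩

end Search

/-! ### The algorithm as a function of the Gaussian table -/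

section Output

variable {n d : ℕ}

/-- The threshold chosen by the algorithm for a crude pair, if the pair is refined. -/
noncomputable def chosenThreshold (G : RegularGraph n d) (mu : Fin n → ℝ) (e b1 b2 kap : ℝ)
    (W : VSet n) (c : VSet n × VSet n) : Option ℝ :=
  bestThreshold (fun r => Feasible G b1 b2 kap W c.1 (refinePiece mu e c.1 c.2 r))
    (fun r => G.expansion (refinePiece mu e c.1 c.2 r).P.toFinset
      (refinePiece mu e c.1 c.2 r).B.toFinset) kap (thresholds mu e)

/-- The effect of a crude pair on the output. -/
noncomputable def refineOutput (G : RegularGraph n d) (mu : Fin n → ℝ) (e b1 b2 kap : ℝ)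
    (W : VSet n) (o : Output n) (c : VSet n × VSet n) : Output n :=
  match chosenThreshold G mu e b1 b2 kap W c with
  | none => { pieces := o.pieces, RP := fun u => o.RP u || c.1 u, RB := fun u => o.RB u || c.2 u }
  | some r => { pieces := refinePiece mu e c.1 c.2 r :: o.pieces, RP := o.RP,
                RB := fun u => o.RB u || (c.2 u && !(refinePiece mu e c.1 c.2 r).B u) }

theorem eval_refineStep (S : EigenSolver) (ω : ℕ × ℕ → ℝ) (G : RegularGraph n d)
    (mu : Fin n → ℝ) (e b1 b2 kap : ℝ) (W : VSet n) (c : VSet n × VSet n) (o : Output n) :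
    (refineStep G.mult d mu e b1 b2 kap W (thresholds mu e) c o).eval S ω =
      refineOutput G mu e b1 b2 kap W o c := by
  obtain ⟨tP, tB⟩ := c
  unfold refineStep
  dsimp only
  rw [eval_bind, eval_each]
  -- The body of the loop agrees with `searchStep` only after evaluation, so it is rewritten under
  -- the fold; the negated test `r ≤ 0` becomes `0 < r`.
  conv in (List.foldl _ none _) =>
    arg 1
    equals searchStep
        (fun r => Feasible G b1 b2 kap W tP (refinePiece mu e tP tB r))
        (fun r => G.expansion (refinePiece mu e tP tB r).P.toFinset
          (refinePiece mu e tP tB r).B.toFinset) =>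
        funext best r
        simp only [eval_bind, eval_num, eval_leq, eval_refine, eval_check, eval_ite, eval_pure]
        unfold searchStep
        by_cases hf : Feasible G b1 b2 kap W tP (refinePiece mu e tP tB r) ∧ 0 < r
        · rw [if_pos hf, if_pos (by simpa using hf)]
          cases best with
          | none => rfl
          | some p => simp
        · rw [if_neg hf, if_neg (by simpa using hf)]
  unfold refineOutput chosenThreshold bestThreshold
  simp only
  cases (thresholds mu e).foldl (searchStep
        (fun r => Feasible G b1 b2 kap W tP (refinePiece mu e tP tB r))
        (fun r => G.expansion (refinePiece mu e tP tB r).P.toFinset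
          (refinePiece mu e tP tB r).B.toFinset)) none with
  | none => simp
  | some p =>
    obtain ⟨r, phi⟩ := p
    by_cases h : phi ≤ kap <;> simp [h, eval_refine]

/-- The vectors of the spectral embedding. -/
noncomputable def embedding (S : EigenSolver) (G : RegularGraph n d) {k : ℕ} (hkn : k ≤ n) (u : Fin n)
    (i : Fin k) : ℝ :=
  (S n (fun u v => (if u = v then 1 else 0) - (G.mult u v : ℝ) / d)).2 (i.castLE hkn) u

/-- The `k`-th eigenvalue returned by the solver. -/
noncomputable def solverEigenvalue (S : EigenSolver) (G : RegularGraph n d) {k : ℕ} (hk : 0 < k)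
    (hkn : k ≤ n) : ℝ :=
  (S n (fun u v => (if u = v then 1 else 0) - (G.mult u v : ℝ) / d)).1 ⟨k - 1, by omega⟩

/-- The square of the length of a vector of the embedding. -/
def sqLength {k : ℕ} (bar : Fin n → Fin k → ℝ) (u : Fin n) : ℝ := ∑ i, bar u i * bar u i

/-- The normalized vectors of the embedding. -/
noncomputable def normalized {k : ℕ} (bar : Fin n → Fin k → ℝ) (u : Fin n) (i : Fin k) : ℝ :=
  bar u i / Real.sqrt (sqLength bar u)

theorem eval_spectralEmbedding (S : EigenSolver) (ω : ℕ × ℕ → ℝ) (G : RegularGraph n d) {k : ℕ}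
    (hk : 0 < k) (hkn : k ≤ n) :
    (spectralEmbedding G.mult d k hk hkn).eval S ω =
      (embedding S G hkn, solverEigenvalue S G hk hkn) := by
  have : (fun u v => ((if u = v then 1 else 0 : ℕ) : ℝ) - (G.mult u v : ℝ) / d) =
    (fun u v => (if u = v then 1 else 0) - (G.mult u v : ℝ) / d) := by
    funext u v; split <;> simp
  simp only [spectralEmbedding, eval_bind, eval_tab, eval_num, eval_quot, eval_minus, eval_solve,
    eval_pure, this]
  rfl

/-- The upper tail of the standard Gaussian distribution. -/
noncomputable def gaussianTail (x : ℝ) : ℝ :=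
  (ProbabilityTheory.gaussianReal 0 1).real (Set.Ici x)

/-- The radius of the separators. -/
noncomputable def sepRadius (dl : ℝ) : ℝ := Real.sqrt (dl / 6)

/-- The threshold of the separators. -/
noncomputable def sepThreshold (dl : ℝ) (k : ℕ) : ℝ :=
  4 * Real.sqrt (Real.log (2 / (dl / (2 * k)))) / sepRadius dl

/-- The width of the buffers of the separators. -/
noncomputable def sepWidth (e t : ℝ) : ℝ := e / (Real.exp 1 * (t + 1 / t))

/-- The number of separators. -/
noncomputable def sepRounds (dl : ℝ) (k : ℕ) : ℕ :=
  ⌈2 / gaussianTail (sepThreshold dl k) * Real.log (1 / dl)⌉₊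

/-- The sample drawn in a round of the algorithm. -/
noncomputable def roundSample {k : ℕ} (bar : Fin n → Fin k → ℝ) (dl e : ℝ) (ω : ℕ × ℕ → ℝ)
    (s : ℕ) : VSet n × VSet n × VSet n :=
  sampleOf (normalized bar) (sqLength bar) (sepThreshold dl k) (sepWidth e (sepThreshold dl k))
    (sepRadius dl) (dl / (2 * k) * ∑ u, sqLength bar u) (fun i => ω (s, i))

/-- The output of Steps 3 and 4. -/
noncomputable def finalOutput (G : RegularGraph n d) (mu : Fin n → ℝ) (e b1 b2 kap : ℝ)
    (st : CrudeState n) : Output n :=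
  st.parts.foldl (refineOutput G mu e b1 b2 kap (fun u => st.Sig u || !st.Xi u))
    { pieces := [], RP := fun u => !st.Xi u, RB := fun u => !(st.Sig u || st.Gam u || !st.Xi u) }

/-- This detaches correctness from the program. The randomness enters only through `roundSample`;
all the rest is a deterministic function of the samples. -/
theorem eval_partitionAlgorithm (S : EigenSolver) (ω : ℕ × ℕ → ℝ) (G : RegularGraph n d) {k : ℕ}
    (hk : 0 < k) (hkn : k ≤ n) (eps del C1 C2 : ℝ) :
    (partitionAlgorithm G.mult d k hk hkn eps del C1 C2).eval S ω =
      finalOutput G (sqLength (embedding S G hkn)) (min eps (del / 50)) (C1 * eps) (10 * eps)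
        (C2 / eps * solverEigenvalue S G hk hkn * Real.log k)
        (crudeState (roundSample (embedding S G hkn) (del / 50) (min eps (del / 50)) ω)
          (sepRounds (del / 50) k)) := by
  have he : (if eps ≤ del / 50 then eps else del / 50) = min eps (del / 50) := by
    rw [min_def]
  simp only [partitionAlgorithm, eval_bind, eval_num, eval_quot, eval_leq, eval_ite, eval_pure,
    decide_eq_true_eq, eval_spectralEmbedding, eval_tab, eval_total, eval_times, eval_sqrt,
    eval_log, eval_exp, eval_plus, eval_gaussTail, eval_natCeil, eval_loop_crudeRound,
    eval_separator, eval_candidates, eval_each, eval_refineStep]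
  simp only [Nat.cast_one, Nat.cast_ofNat, he]
  rfl

end Output

end BufferedCheeger

namespace BufferedCheeger

/-! ### Bounds for the number of steps -/

namespace Prog

variable {α β : Type} {S : EigenSolver} {ω : ℕ × ℕ → ℝ}

/-- The continuation is bounded only at the actual value of `p`. This matters because later loops
run over computed lists and over a computed number of rounds, so their cost depends on earlier
values. -/
theorem steps_bind_le {p : Prog ℝ α} {f : α → Prog ℝ β} {a b : ℕ} (hp : p.steps S ω ≤ a)
    (hf : ∀ x, x = p.eval S ω → (f x).steps S ω ≤ b) : (p >>= f).steps S ω ≤ a + b := by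
  rw [steps_bind]
  exact Nat.add_le_add hp (hf _ rfl)

theorem steps_pure_le (a : α) : (pure a : Prog ℝ α).steps S ω ≤ 0 := le_rfl

theorem steps_ite_le {c : Prop} [Decidable c] {p q : Prog ℝ α} {a b : ℕ}
    (hp : p.steps S ω ≤ a) (hq : q.steps S ω ≤ b) :
    (if c then p else q).steps S ω ≤ a + b := by
  split <;> omega

theorem steps_tab_le {n b : ℕ} {f : Fin n → Prog ℝ α} (h : ∀ i, (f i).steps S ω ≤ b) :
    (tab n f).steps S ω ≤ n * (b + 1) := by
  induction n with
  | zero => simp [tab]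
  | succ n ih =>
    simp only [tab, steps_bind, steps_tick, steps_pure]
    have h1 := ih (f := fun i => f i.succ) fun i => h i.succ
    have h2 := h 0
    rw [Nat.succ_mul]; omega

theorem steps_total_le {n b : ℕ} {f : Fin n → Prog ℝ ℝ} (h : ∀ i, (f i).steps S ω ≤ b) :
    (total n f).steps S ω ≤ n * (b + 2) + 1 := by
  induction n with
  | zero => simp [total]
  | succ n ih =>
    simp only [total, steps_bind, steps_tick, steps_plus]
    have h1 := ih (f := fun i => f i.succ) fun i => h i.succ
    have h2 := h 0
    rw [Nat.succ_mul]; omega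

theorem steps_each_le {l : List β} {s : α} {body : β → α → Prog ℝ α} {b : ℕ}
    (h : ∀ x s, (body x s).steps S ω ≤ b) : (each l s body).steps S ω ≤ l.length * (b + 1) := by
  induction l generalizing s with
  | nil => simp [each]
  | cons x l ih =>
    simp only [each, steps_bind, steps_tick, List.length_cons]
    have h1 := ih (s := (body x s).eval S ω)
    have h2 := h x s
    rw [eval_tick, Nat.succ_mul]; omega

theorem steps_loop_le {T : ℕ} {s : α} {body : ℕ → α → Prog ℝ α} {b : ℕ}
    (h : ∀ t s, (body t s).steps S ω ≤ b) : (loop T s body).steps S ω ≤ T * (b + 1) := by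
  induction T with
  | zero => simp [loop]
  | succ T ih =>
    simp only [loop, steps_bind, steps_tick]
    have h2 := h T ((loop T s body).eval S ω)
    rw [Nat.succ_mul]; omega

end Prog

section Steps

variable {n : ℕ} {S : EigenSolver} {ω : ℕ × ℕ → ℝ}

theorem steps_size_le (A : VSet n) : (size A).steps S ω ≤ n * 3 + 1 :=
  steps_total_le fun _ => le_rfl

theorem steps_cutSize_le (w : Fin n → Fin n → ℕ) (A B : VSet n) :
    (cutSize w A B).steps S ω ≤ n * ((n * 3 + 1) + 2) + 1 :=
  steps_total_le fun _ => steps_total_le fun _ => le_rfl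

theorem steps_spectralEmbedding_le (w : Fin n → Fin n → ℕ) (d k : ℕ) (hk : 0 < k)
    (hkn : k ≤ n) : (spectralEmbedding w d k hk hkn).steps S ω ≤
      n * (n * 6 + 1) + (n ^ 3 + n * (k + 1)) := by
  refine (steps_bind_le (steps_tab_le fun _ => steps_tab_le fun _ => (show _ ≤ 5 from ?_))
    fun L _ => steps_bind_le (steps_solve S ω n L).le fun x _ =>
      steps_bind_le (a := n * (k * 1 + 1)) (steps_tab_le fun _ => steps_tab_le fun _ => le_rfl)
        fun _ _ => steps_pure_le _).trans ?_
  · simp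
  · nlinarith

/-- The cubic term comes from the test that keeps or discards the sample: a distance of vectors with
`k ≤ n` coordinates for every pair of vertices. -/
theorem steps_separator_le {k : ℕ} (psi : Fin n → Fin k → ℝ) (mu : Fin n → ℝ)
    (t w rad cap : ℝ) (s : ℕ) (hn : 1 ≤ n) (hk : k ≤ n) :
    (separator psi mu t w rad cap s).steps S ω ≤ 60 * n ^ 3 := by
  have h1 : (tab k fun i => normal s i : Prog ℝ (Fin k → ℝ)).steps S ω ≤ k * (1 + 1) :=
    steps_tab_le fun i => by simp
  refine (steps_bind_le h1 fun g _ => steps_bind_le (steps_tab_le fun u => steps_total_le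
    (b := 1) fun i => by simp) fun h _ => steps_bind_le (a := 1) (by simp) fun t1 _ =>
    steps_bind_le (a := 1) (by simp) fun t2 _ => steps_bind_le (steps_tab_le (b := 1)
    fun _ => by simp) fun X _ => steps_bind_le (steps_tab_le (b := 2) fun _ => by simp)
    fun Y _ => steps_bind_le (steps_tab_le (b := 2) fun _ => by simp) fun Z _ =>
    steps_bind_le (steps_each_le fun u found => steps_bind_le (steps_total_le fun v =>
      steps_bind_le (steps_total_le (b := 2) fun i => by simp) fun dist2 _ =>
      steps_bind_le (a := 1) (by simp) fun x _ => steps_bind_le (a := 1) (by simp) fun near _ =>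
      steps_ite_le (steps_pure_le _) (steps_num S ω 0).le) fun far _ =>
      steps_bind_le (a := 1) (by simp) fun ok _ => steps_pure_le _) fun keep _ =>
    steps_bind_le (steps_tab_le fun _ => steps_pure_le _) fun X' _ =>
    steps_bind_le (steps_tab_le fun _ => steps_pure_le _) fun Y' _ =>
    steps_bind_le (steps_tab_le fun _ => steps_pure_le _) fun Z' _ =>
    steps_pure_le _).trans ?_
  rw [List.length_finRange]
  have e1 : n * k ≤ n ^ 2 := by nlinarith
  have e2 : n * n * k ≤ n ^ 3 := by nlinarith [Nat.mul_le_mul_left (n * n) hk]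
  have e3 : n ≤ n ^ 2 := by nlinarith
  have e4 : n ^ 2 ≤ n ^ 3 := Nat.pow_le_pow_right hn (by norm_num)
  nlinarith

theorem steps_crudeRound_le (sample : ℕ → Prog ℝ (VSet n × VSet n × VSet n)) (s : ℕ)
    (st : CrudeState n) (b : ℕ) (h : ∀ s, (sample s).steps S ω ≤ b) :
    (crudeRound sample s st).steps S ω ≤ b + 5 * n := by
  refine (steps_bind_le (h s) fun x _ =>
    steps_bind_le (steps_tab_le fun _ => steps_pure_le _) fun _ _ =>
    steps_bind_le (steps_tab_le fun _ => steps_pure_le _) fun _ _ =>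
    steps_bind_le (steps_tab_le fun _ => steps_pure_le _) fun _ _ =>
    steps_bind_le (steps_tab_le fun _ => steps_pure_le _) fun _ _ =>
    steps_bind_le (steps_tab_le fun _ => steps_pure_le _) fun _ _ =>
    steps_pure_le _).trans ?_
  omega

theorem steps_refine_le (mu : Fin n → ℝ) (e : ℝ) (tP tB : VSet n) (r : ℝ) :
    (refine mu e tP tB r).steps S ω ≤ 10 * n + 4 := by
  refine (steps_bind_le (a := 1) (by simp) fun _ _ => steps_bind_le (a := 1) (by simp) fun _ _ =>
    steps_bind_le (a := 1) (by simp) fun _ _ => steps_bind_le (a := 1) (by simp) fun _ _ =>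
    steps_bind_le (steps_tab_le (b := 1) fun _ => by simp) fun _ _ =>
    steps_bind_le (steps_tab_le (b := 1) fun _ => by simp) fun _ _ =>
    steps_bind_le (steps_tab_le (b := 1) fun _ => by simp) fun _ _ =>
    steps_bind_le (steps_tab_le fun _ => steps_pure_le _) fun _ _ =>
    steps_bind_le (steps_tab_le fun _ => steps_pure_le _) fun _ _ =>
    steps_bind_le (steps_tab_le fun _ => steps_pure_le _) fun _ _ =>
    steps_bind_le (steps_tab_le fun _ => steps_pure_le _) fun _ _ =>
    steps_pure_le _).trans ?_
  omega

theorem steps_check_le (w : Fin n → Fin n → ℕ) (d : ℕ) (b1 b2 kap : ℝ) (W tP : VSet n)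
    (p : Piece n) (hn : 1 ≤ n) : (check w d b1 b2 kap W tP p).steps S ω ≤ 60 * n ^ 2 := by
  refine (steps_bind_le (steps_size_le _) fun _ _ => steps_bind_le (steps_size_le _) fun _ _ =>
    steps_bind_le (steps_size_le _) fun _ _ => steps_bind_le (a := 1) (by simp) fun _ _ =>
    steps_bind_le (a := 1) (by simp) fun _ _ =>
    steps_bind_le (steps_tab_le fun _ => steps_pure_le _) fun _ _ =>
    steps_bind_le (steps_tab_le fun _ => steps_pure_le _) fun _ _ =>
    steps_bind_le (steps_tab_le fun _ => steps_pure_le _) fun _ _ =>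
    steps_bind_le (a := 1) (by simp) fun _ _ => steps_bind_le (a := 1) (by simp) fun _ _ =>
    steps_bind_le (a := 1) (by simp) fun _ _ => steps_bind_le (a := 1) (by simp) fun _ _ =>
    steps_bind_le (a := 1) (by simp) fun _ _ => steps_bind_le (a := 1) (by simp) fun _ _ =>
    steps_bind_le (a := 1) (by simp) fun _ _ => steps_bind_le (steps_cutSize_le _ _ _) fun _ _ =>
    steps_bind_le (a := 1) (by simp) fun _ _ => steps_bind_le (steps_cutSize_le _ _ _) fun _ _ =>
    steps_bind_le (a := 1) (by simp) fun _ _ => steps_bind_le (steps_cutSize_le _ _ _) fun _ _ =>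
    steps_bind_le (a := 1) (by simp) fun _ _ => steps_pure_le _).trans ?_
  nlinarith

theorem length_breakpoints (mu : Fin n → ℝ) (e : ℝ) :
    (breakpoints mu e).length = 3 * n + 1 := by
  have : ∀ (l : List (Fin n)) (l0 : List ℝ), (l.foldl
    (fun l u => mu u :: (1 + e) * mu u :: (1 + e) * ((1 + e) * mu u) :: l) l0).length =
      3 * l.length + l0.length := by
    intro l
    induction l with
    | nil => simp
    | cons a l ih => intro l0; simp only [List.foldl_cons, ih, List.length_cons]; omega
  rw [breakpoints, this]
  simp

theorem length_thresholds (mu : Fin n → ℝ) (e : ℝ) :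
    (thresholds mu e).length = (3 * n + 1) * (3 * n + 1) := by
  have h : ∀ (a : ℝ) (l l0 : List ℝ),
      (l.foldl (fun l' b => (a + b) / 2 :: l') l0).length = l.length + l0.length := by
    intro a l
    induction l with
    | nil => simp
    | cons b l ih => intro l0; simp only [List.foldl_cons, ih, List.length_cons]; omega
  have : ∀ (l l0 : List ℝ), (l.foldl
    (fun l a => (breakpoints mu e).foldl (fun l' b => (a + b) / 2 :: l') l) l0).length =
      (3 * n + 1) * l.length + l0.length := by
    intro l
    induction l with
    | nil => simp
    | cons a l ih =>
      intro l0
      simp only [List.foldl_cons, ih, h, List.length_cons, length_breakpoints]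
      ring
  rw [thresholds, this, length_breakpoints]
  simp

theorem steps_candidates_le (mu : Fin n → ℝ) (e : ℝ) (hn : 1 ≤ n) :
    (candidates mu e).steps S ω ≤ 120 * n ^ 2 := by
  unfold candidates
  refine (steps_bind_le (a := 1) (by simp) fun _ _ => steps_bind_le (a := 1) (by simp) fun q hq =>
    steps_bind_le (a := 1) (by simp) fun z hz => steps_bind_le
    (a := n * 3) ?_ fun base hb => (show _ ≤ (3 * n + 1) * ((3 * n + 1) * 4 + 1) from ?_)).trans ?_
  · refine (steps_each_le (b := 2) fun _ _ => by simp).trans ?_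
    simp
  rotate_left
  · nlinarith
  have : base = breakpoints mu e := by
    subst hb hz hq
    simp_all [breakpoints]
  refine (steps_each_le (b := (3 * n + 1) * 4) fun _ _ =>
    (steps_each_le (b := 3) fun _ _ => by simp).trans ?_).trans ?_
  all_goals rw [this, length_breakpoints]

/-- There are quadratically many thresholds, and checking one of them counts edges in quadratic
time. -/
theorem steps_refineStep_le (w : Fin n → Fin n → ℕ) (d : ℕ) (mu : Fin n → ℝ)
    (e b1 b2 kap : ℝ) (W : VSet n) (cands : List ℝ) (c : VSet n × VSet n) (o : Output n)
    (hn : 1 ≤ n) (hc : cands.length = (3 * n + 1) * (3 * n + 1)) :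
    (refineStep w d mu e b1 b2 kap W cands c o).steps S ω ≤ 1600 * n ^ 4 := by
  have hr : ∀ tP tB r, (refine mu e tP tB r).steps S ω ≤ 14 * n := fun tP tB r =>
    (steps_refine_le mu e tP tB r).trans (by omega)
  refine (steps_bind_le (steps_each_le fun _ _ => steps_bind_le (a := 1) (by simp) fun _ _ =>
    steps_bind_le (a := 1) (by simp) fun _ _ => steps_bind_le (hr _ _ _) fun _ _ =>
    steps_bind_le (steps_check_le _ _ _ _ _ _ _ _ hn) fun _ _ =>
    (show _ ≤ 1 from ?_)) fun best _ => (show _ ≤ 20 * n from ?_)).trans ?_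
  · dsimp only
    rw [steps_ite]
    split
    · split <;> simp
    · simp
  · have hd : ∀ f g : Fin n → Bool, (tab n fun u => (pure (f u) : Prog ℝ Bool)).steps S ω ≤ n * 1 :=
      fun f g => steps_tab_le fun _ => steps_pure_le _
    dsimp only
    split
    · refine (steps_bind_le (steps_tab_le fun _ => steps_pure_le _) fun _ _ =>
        steps_bind_le (steps_tab_le fun _ => steps_pure_le _) fun _ _ => steps_pure_le _).trans ?_
      omega
    · refine (steps_bind_le (a := 1) (by simp) fun _ _ => steps_ite_le
        (steps_bind_le (hr _ _ _) fun _ _ =>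
          steps_bind_le (steps_tab_le fun _ => steps_pure_le _) fun _ _ => steps_pure_le _)
        (steps_bind_le (steps_tab_le fun _ => steps_pure_le _) fun _ _ =>
          steps_bind_le (steps_tab_le fun _ => steps_pure_le _) fun _ _ =>
          steps_pure_le _)).trans ?_
      omega
  · rw [hc]
    have e3 : n ≤ n ^ 2 := by nlinarith
    have e4 : n ^ 2 ≤ n ^ 4 := Nat.pow_le_pow_right hn (by norm_num)
    have h2 : (3 * n + 1) * (3 * n + 1) ≤ 16 * n ^ 2 := by nlinarith
    calc _ ≤ 16 * n ^ 2 * (80 * n ^ 2) + 20 * n :=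
          Nat.add_le_add (Nat.mul_le_mul h2 (by nlinarith)) le_rfl
      _ ≤ _ := by nlinarith

theorem length_parts_crudeState (smp : ℕ → VSet n × VSet n × VSet n) (T : ℕ) :
    (crudeState smp T).parts.length = T := by
  induction T with
  | zero => rfl
  | succ T ih => simp [crudeState, crudeNext, ih]

theorem steps_partitionAlgorithm_le {d k : ℕ} (w : Fin n → Fin n → ℕ) (hk : 0 < k)
    (hkn : k ≤ n) (eps del C1 C2 : ℝ) :
    (partitionAlgorithm w d k hk hkn eps del C1 C2).steps S ω ≤
      2500 * n ^ 4 * (sepRounds (del / 50) k + 1) := by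
  have hn : 1 ≤ n := hk.trans_le hkn
  unfold partitionAlgorithm
  refine (steps_bind_le (a := 1) (by simp) fun one hone => steps_bind_le (a := 1) (by simp)
    fun two htwo => steps_bind_le (a := 1) (by simp) fun kR hkR =>
    steps_bind_le (a := 1) (by simp) fun x0 hx0 => steps_bind_le (a := 1) (by simp)
    fun dlt hdlt => steps_bind_le (a := 1) (by simp) fun e he =>
    steps_bind_le (steps_spectralEmbedding_le _ _ _ _ _) fun x1 _ =>
    steps_bind_le (steps_tab_le fun _ => steps_total_le (b := 1) fun _ => by simp) fun mu _ =>
    steps_bind_le (steps_tab_le fun _ => steps_bind_le (a := 1) (by simp) fun _ _ =>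
      steps_tab_le (b := 1) fun _ => by simp) fun psi _ =>
    steps_bind_le (steps_total_le (b := 0) fun _ => by simp) fun muV _ =>
    steps_bind_le (a := 1) (by simp) fun x2 hx2 => steps_bind_le (a := 1) (by simp) fun x3 hx3 =>
    steps_bind_le (a := 1) (by simp) fun rad hrad =>
    steps_bind_le (a := 1) (by simp) fun x4 hx4 => steps_bind_le (a := 1) (by simp) fun dlt' hd' =>
    steps_bind_le (a := 1) (by simp) fun cap _ =>
    steps_bind_le (a := 1) (by simp) fun x5 hx5 => steps_bind_le (a := 1) (by simp) fun x6 hx6 =>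
    steps_bind_le (a := 1) (by simp) fun x7 hx7 => steps_bind_le (a := 1) (by simp) fun x8 hx8 =>
    steps_bind_le (a := 1) (by simp) fun x9 hx9 => steps_bind_le (a := 1) (by simp) fun t ht =>
    steps_bind_le (a := 1) (by simp) fun _ _ => steps_bind_le (a := 1) (by simp) fun _ _ =>
    steps_bind_le (a := 1) (by simp) fun _ _ => steps_bind_le (a := 1) (by simp) fun _ _ =>
    steps_bind_le (a := 1) (by simp) fun width _ =>
    steps_bind_le (a := 1) (by simp) fun alpha halpha =>
    steps_bind_le (a := 1) (by simp) fun y1 hy1 => steps_bind_le (a := 1) (by simp) fun y2 hy2 =>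
    steps_bind_le (a := 1) (by simp) fun y3 hy3 => steps_bind_le (a := 1) (by simp) fun y4 hy4 =>
    -- The budget is generous: `1601 * n ^ 4` per crude pair, and `68 * n ^ 4` per round for
    -- sampling and bookkeeping, of which one unit pays for the rounding up; the remaining terms
    -- cover the list of thresholds and the arrays.
    (show _ ≤ 68 * n ^ 4 * (sepRounds (del / 50) k + 1) + (130 * n ^ 2 +
      sepRounds (del / 50) k * (1601 * n ^ 4) + 9 * n) from ?_)).trans ?_
  -- The equations recorded for the intermediate values identify the rounded number with the formula
  -- for the number of rounds.
  · have hy : ⌈y4⌉₊ = sepRounds (del / 50) k := by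
      simp only [eval_num, eval_quot, eval_times, eval_sqrt, eval_log, eval_gaussTail, Nat.cast_one,
        Nat.cast_ofNat] at *
      rw [sepRounds, sepThreshold, sepRadius, gaussianTail]
      subst_vars
      rfl
    have hs : ∀ s : ℕ, (separator psi mu t width rad cap s).steps S ω ≤ 60 * n ^ 3 := fun s =>
      steps_separator_le _ _ _ _ _ _ _ hn hkn
    have hl : ∀ T s0, (loop T s0 (crudeRound (separator psi mu t width rad cap))).steps S ω ≤
        T * (60 * n ^ 3 + 5 * n + 1) := fun T s0 =>
      steps_loop_le (fun s st => steps_crudeRound_le _ s st _ hs)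
    refine le_trans (steps_bind_le (steps_natCeil S ω y4).le fun T hT =>
      (show _ ≤ 67 * n ^ 4 * (sepRounds (del / 50) k + 1) + (120 * n ^ 2 +
        sepRounds (del / 50) k * (1601 * n ^ 4) + 9 * n) from ?_)) ?_
    rotate_left
    · rw [hy]
      have e8 : sepRounds (del / 50) k + 1 ≤ n ^ 4 * (sepRounds (del / 50) k + 1) :=
        Nat.le_mul_of_pos_left _ (by positivity)
      linarith [Nat.zero_le (n ^ 2)]
    have hT' : T = sepRounds (del / 50) k := by rw [hT, eval_natCeil, hy]
    rw [hT']
    refine le_trans (steps_bind_le (steps_tab_le fun _ => steps_pure_le _) fun none' hnone =>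
      steps_bind_le (hl _ _) fun st hst =>
      steps_bind_le (steps_tab_le fun _ => steps_pure_le _) fun RP _ =>
      steps_bind_le (steps_tab_le fun _ => steps_pure_le _) fun RB _ =>
      steps_bind_le (a := 1) (by simp) fun _ _ => steps_bind_le (a := 1) (by simp) fun _ _ =>
      steps_bind_le (a := 1) (by simp) fun _ _ => steps_bind_le (a := 1) (by simp) fun _ _ =>
      steps_bind_le (a := 1) (by simp) fun _ _ => steps_bind_le (a := 1) (by simp) fun _ _ =>
      steps_bind_le (a := 1) (by simp) fun _ _ =>
      steps_bind_le (steps_tab_le fun _ => steps_pure_le _) fun W _ =>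
      steps_bind_le (steps_candidates_le _ _ hn) fun cands hcands =>
      (show _ ≤ sepRounds (del / 50) k * (1600 * n ^ 4 + 1) from ?_)) ?_
    · have h1 : st.parts.length = sepRounds (del / 50) k := by
        rw [hst, hnone, eval_tab]
        simp only [eval_pure]
        rw [eval_loop_crudeRound, length_parts_crudeState]
      refine (steps_each_le fun c o => steps_refineStep_le _ _ _ _ _ _ _ _ _ _ _ hn ?_).trans ?_
      · rw [hcands, eval_candidates, length_thresholds]
      · rw [h1]
    · generalize sepRounds (del / 50) k = T
      have e3 : n ≤ n ^ 2 := by nlinarith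
      have e4 : n ^ 2 ≤ n ^ 3 := Nat.pow_le_pow_right hn (by norm_num)
      have e5 : n ^ 3 ≤ n ^ 4 := Nat.pow_le_pow_right hn (by norm_num)
      have e6 : T * n ≤ T * n ^ 4 := Nat.mul_le_mul_left T (by omega)
      have e7 : T * n ^ 3 ≤ T * n ^ 4 := Nat.mul_le_mul_left T e5
      have e8 : T ≤ T * n ^ 4 := Nat.le_mul_of_pos_right T (by positivity)
      linarith
  · generalize sepRounds (del / 50) k = T
    have e1 : n * k ≤ n ^ 2 := by nlinarith
    have e3 : n ≤ n ^ 2 := by nlinarith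
    have e4 : n ^ 2 ≤ n ^ 3 := Nat.pow_le_pow_right hn (by norm_num)
    have e5 : n ^ 3 ≤ n ^ 4 := Nat.pow_le_pow_right hn (by norm_num)
    linarith [Nat.zero_le (T * n ^ 4)]

end Steps

end BufferedCheeger

namespace BufferedCheeger

/-! ### Tail estimates for the standard Gaussian, and the number of rounds -/

section GaussianTail

open MeasureTheory ProbabilityTheory Real Filter Topology

/-- The standard Gaussian density. -/
noncomputable def gaussDensity (x : ℝ) : ℝ := (√(2 * π))⁻¹ * rexp (-(x ^ 2 / 2))

theorem gaussDensity_pos (x : ℝ) : 0 < gaussDensity x := by unfold gaussDensity; positivity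

theorem gaussianPDFReal_eq_gaussDensity : gaussianPDFReal 0 1 = gaussDensity := by
  funext x
  simp [gaussianPDFReal, gaussDensity, neg_div]

theorem integrable_gaussDensity : Integrable gaussDensity := by
  rw [← gaussianPDFReal_eq_gaussDensity]
  exact integrable_gaussianPDFReal 0 1

theorem gaussianReal_real_eq (s : Set ℝ) :
    (gaussianReal 0 1).real s = ∫ x in s, gaussDensity x := by
  rw [measureReal_def, gaussianReal_apply_eq_integral 0 one_ne_zero,
    gaussianPDFReal_eq_gaussDensity, ENNReal.toReal_ofReal]
  exact integral_nonneg fun x => (gaussDensity_pos x).le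

theorem gaussianTail_eq (t : ℝ) : gaussianTail t = ∫ x in Set.Ioi t, gaussDensity x := by
  rw [gaussianTail, gaussianReal_real_eq, integral_Ici_eq_integral_Ioi]

theorem hasDerivAt_gaussDensity (x : ℝ) :
    HasDerivAt gaussDensity (-x * gaussDensity x) x := by
  unfold gaussDensity
  have h : HasDerivAt (fun x : ℝ => -(x ^ 2 / 2)) (-x) x := by
    exact (((hasDerivAt_pow 2 x).div_const 2).fun_neg).congr_deriv (by simp)
  exact (h.exp.const_mul (√(2 * π))⁻¹).congr_deriv (by ring)

theorem tendsto_gaussDensity : Tendsto gaussDensity atTop (𝓝 0) := by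
  unfold gaussDensity
  rw [← mul_zero (√(2 * π))⁻¹]
  refine Tendsto.const_mul _ (tendsto_exp_neg_atTop_nhds_zero.comp ?_)
  exact (tendsto_pow_atTop two_ne_zero).atTop_div_const two_pos

/-- On `(t, ∞)` one has `t φ(x) ≤ x φ(x)`, and `x φ(x)` is the derivative of `-φ`. -/
theorem gaussianTail_le {t : ℝ} (ht : 0 < t) : gaussianTail t ≤ gaussDensity t / t := by
  have hd : ∀ x ∈ Set.Ioi t, HasDerivAt (fun x => -gaussDensity x) (x * gaussDensity x) x :=
    fun x _ => by simpa using (hasDerivAt_gaussDensity x).fun_neg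
  have hc : ContinuousWithinAt (fun x => -gaussDensity x) (Set.Ici t) t :=
    (hasDerivAt_gaussDensity t).fun_neg.continuousAt.continuousWithinAt
  have hp : ∀ x ∈ Set.Ioi t, 0 ≤ x * gaussDensity x := fun x hx =>
    mul_nonneg (ht.trans hx).le (gaussDensity_pos x).le
  have hl : Tendsto (fun x => -gaussDensity x) atTop (𝓝 0) := by
    simpa using tendsto_gaussDensity.neg
  have h1 := integral_Ioi_of_hasDerivAt_of_nonneg hc hd hp hl
  have h2 := integrableOn_Ioi_deriv_of_nonneg hc hd hp hl
  rw [gaussianTail_eq, le_div_iff₀ ht, ← integral_mul_const]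
  calc _ ≤ ∫ x in Set.Ioi t, x * gaussDensity x := by
        refine setIntegral_mono_on (integrable_gaussDensity.integrableOn.mul_const _) h2
          measurableSet_Ioi fun x hx => ?_
        rw [mul_comm]
        exact mul_le_mul_of_nonneg_right (le_of_lt hx) (gaussDensity_pos x).le
    _ = _ := by rw [h1]; simp

/-- The function `-φ(x) x / (x² + 1)` has derivative `φ(x) (x⁴ + 2x² - 1) / (x² + 1)²`, which is at
most `φ(x)`. For `x ≥ 1` this derivative is nonnegative, so its improper integral is the difference
of the boundary values. -/
theorem le_gaussianTail {t : ℝ} (ht : 1 ≤ t) :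
    gaussDensity t / (t + 1 / t) ≤ gaussianTail t := by
  have hd : ∀ x, HasDerivAt (fun x => -(gaussDensity x * (x / (x ^ 2 + 1))))
      (gaussDensity x * ((x ^ 4 + 2 * x ^ 2 - 1) / (x ^ 2 + 1) ^ 2)) x := fun x => by
    have h0 : x ^ 2 + 1 ≠ 0 := by positivity
    have h1 : HasDerivAt (fun x : ℝ => x / (x ^ 2 + 1))
        ((1 * (x ^ 2 + 1) - x * (2 * x)) / (x ^ 2 + 1) ^ 2) x := by
      refine (hasDerivAt_id x).div ?_ h0
      simpa using (hasDerivAt_pow 2 x).add_const (1 : ℝ)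
    refine ((hasDerivAt_gaussDensity x).fun_mul h1).fun_neg.congr_deriv ?_
    field_simp
    ring
  have hc : ContinuousWithinAt (fun x => -(gaussDensity x * (x / (x ^ 2 + 1)))) (Set.Ici t) t :=
    (hd t).continuousAt.continuousWithinAt
  have hp : ∀ x ∈ Set.Ioi t,
      0 ≤ gaussDensity x * ((x ^ 4 + 2 * x ^ 2 - 1) / (x ^ 2 + 1) ^ 2) := fun x hx => by
    have hx1 : 1 ≤ x := ht.trans (le_of_lt hx)
    have : 0 ≤ x ^ 4 + 2 * x ^ 2 - 1 := by nlinarith [sq_nonneg (x ^ 2)]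
    have := (gaussDensity_pos x).le
    positivity
  have hl : Tendsto (fun x => -(gaussDensity x * (x / (x ^ 2 + 1)))) atTop (𝓝 0) := by
    rw [← neg_zero]
    refine Tendsto.neg (squeeze_zero' (g := gaussDensity) ?_ ?_ tendsto_gaussDensity)
    · filter_upwards [eventually_ge_atTop 0] with x hx
      have := (gaussDensity_pos x).le
      positivity
    · filter_upwards [eventually_ge_atTop 0] with x hx
      refine mul_le_of_le_one_right (gaussDensity_pos x).le ?_
      rw [div_le_one (by positivity)]
      nlinarith [sq_nonneg (x - 1)]
  have h1 := integral_Ioi_of_hasDerivAt_of_nonneg hc (fun x _ => hd x) hp hl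
  have h2 := integrableOn_Ioi_deriv_of_nonneg hc (fun x _ => hd x) hp hl
  have h3 : gaussDensity t / (t + 1 / t) = gaussDensity t * (t / (t ^ 2 + 1)) := by
    have : t ≠ 0 := by positivity
    field_simp
  rw [h3, gaussianTail_eq]
  calc _ = ∫ x in Set.Ioi t, gaussDensity x * ((x ^ 4 + 2 * x ^ 2 - 1) / (x ^ 2 + 1) ^ 2) := by
        rw [h1]; ring
    _ ≤ _ := by
        refine setIntegral_mono_on h2 integrable_gaussDensity.integrableOn
          measurableSet_Ioi fun x hx => ?_
        refine mul_le_of_le_one_right (gaussDensity_pos x).le ?_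
        rw [div_le_one (by positivity)]
        nlinarith

theorem gaussianTail_pos {t : ℝ} (ht : 1 ≤ t) : 0 < gaussianTail t := by
  refine lt_of_lt_of_le ?_ (le_gaussianTail ht)
  have := gaussDensity_pos t
  positivity

theorem gaussDensity_anti {a x : ℝ} (ha : 0 ≤ a) (hx : a ≤ x) :
    gaussDensity x ≤ gaussDensity a := by
  unfold gaussDensity
  gcongr

theorem gaussianReal_Icc_le {a b c : ℝ} (hc : 0 ≤ c) (hca : c ≤ a) :
    gaussianReal 0 1 (Set.Icc a b) ≤ ENNReal.ofReal (gaussDensity c * (b - a)) := by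
  rcases lt_or_ge b a with h | h
  · simp [Set.Icc_eq_empty_of_lt h]
  rw [gaussianReal_apply_eq_integral 0 one_ne_zero, gaussianPDFReal_eq_gaussDensity]
  refine ENNReal.ofReal_le_ofReal ?_
  calc _ ≤ ∫ x in Set.Icc a b, gaussDensity c :=
        setIntegral_mono_on integrable_gaussDensity.integrableOn (by simp) measurableSet_Icc
          fun x hx => gaussDensity_anti hc (hca.trans hx.1)
    _ = _ := by
        rw [setIntegral_const, smul_eq_mul, measureReal_def, Real.volume_Icc,
          ENNReal.toReal_ofReal (by linarith), mul_comm]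

/-- The exact ratio is `exp (t s - s² / 2)`. As `t s` is tiny for the buffers, the density hardly
changes across them. -/
theorem gaussDensity_sub_le {t s : ℝ} : gaussDensity (t - s) ≤ rexp (t * s) * gaussDensity t := by
  unfold gaussDensity
  rw [mul_left_comm, ← Real.exp_add]
  gcongr
  nlinarith [sq_nonneg s]

/-- The gap between `t²` and `t'²` makes the density drop by `m²`. One factor `m ≥ 2` is spent on
the discrepancy `t + 1 / t ≤ 2 t` between the upper and the lower tail estimate, the other one
remains. -/
theorem gaussianTail_le_div {t t' m : ℝ} (ht : 1 ≤ t) (ht' : 0 < t') (hm : 2 ≤ m)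
    (h : t ^ 2 + 4 * Real.log m ≤ t' ^ 2) : gaussianTail t' ≤ gaussianTail t / m := by
  have hlog : 0 ≤ Real.log m := Real.log_nonneg (by linarith)
  have htt : t ≤ t' := by nlinarith
  have h1 : gaussDensity t' ≤ gaussDensity t * (m ^ 2)⁻¹ := by
    unfold gaussDensity
    rw [mul_assoc]
    refine mul_le_mul_of_nonneg_left ?_ (by positivity)
    have : (m ^ 2)⁻¹ = rexp (-(2 * Real.log m)) := by
      rw [Real.exp_neg, mul_comm, Real.exp_mul, Real.exp_log (by linarith)]
      norm_num
    rw [this, ← Real.exp_add]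
    gcongr
    linarith
  have h0 := gaussDensity_pos t
  calc gaussianTail t' ≤ gaussDensity t' / t' := gaussianTail_le ht'
    _ ≤ gaussDensity t * (m ^ 2)⁻¹ / t := by gcongr
    _ ≤ gaussDensity t / (t + 1 / t) / m := by
        have : t + 1 / t ≤ 2 * t := by
          have : 1 / t ≤ 1 := by rw [div_le_one (by linarith)]; exact ht
          linarith
        rw [div_div, ← div_eq_mul_inv, div_div]
        refine div_le_div_of_nonneg_left h0.le (by positivity) ?_
        calc (t + 1 / t) * m ≤ (2 * t) * m := by gcongr
          _ ≤ m ^ 2 * t := by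
              nlinarith [mul_nonneg (mul_nonneg (by linarith : 0 ≤ m) (by linarith : 0 ≤ m - 2))
                (by linarith : 0 ≤ t)]
    _ ≤ _ := by gcongr; exact le_gaussianTail ht

theorem sepRadius_pos {dl : ℝ} (h : 0 < dl) : 0 < sepRadius dl := by
  unfold sepRadius; positivity

theorem sepThreshold_sq {dl : ℝ} {k : ℕ} (h0 : 0 < dl) (h1 : dl ≤ 1) (hk : 1 ≤ k) :
    sepThreshold dl k ^ 2 = 96 / dl * Real.log (4 * k / dl) := by
  have hk' : (1 : ℝ) ≤ k := by exact_mod_cast hk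
  have he : 2 / (dl / (2 * k)) = 4 * k / dl := by field_simp; norm_num
  have hl : 0 ≤ Real.log (4 * k / dl) := Real.log_nonneg (by
    rw [le_div_iff₀ h0]; linarith)
  rw [sepThreshold, he, sepRadius, div_pow, mul_pow, Real.sq_sqrt hl, Real.sq_sqrt (by positivity)]
  field_simp
  ring

theorem one_le_sepThreshold {dl : ℝ} {k : ℕ} (h0 : 0 < dl) (h1 : dl ≤ 1) (hk : 1 ≤ k) :
    1 ≤ sepThreshold dl k := by
  have hk' : (1 : ℝ) ≤ k := by exact_mod_cast hk
  have hp : 0 ≤ sepThreshold dl k := by unfold sepThreshold sepRadius; positivity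
  have hl : 1 ≤ Real.log (4 * k / dl) := by
    rw [Real.le_log_iff_exp_le (by positivity), le_div_iff₀ h0]
    nlinarith [Real.exp_one_lt_d9, Real.exp_pos 1]
  have h96 : 96 ≤ 96 / dl := by rw [le_div_iff₀ h0]; linarith
  have := sepThreshold_sq h0 h1 hk
  nlinarith

/-- The reciprocal tail is at most `6 exp (t²)`, and `t²` is a constant multiple of the logarithm of
`4 k / dl`; hence it is a power of `k` with exponent depending only on `dl`. -/
theorem exists_sepRounds_le {dl : ℝ} (h0 : 0 < dl) (h1 : dl ≤ 1) :
    ∃ c : ℕ, ∀ k : ℕ, 1 ≤ k → sepRounds dl k ≤ c * k ^ c := by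
  have hbase : ∀ k : ℕ, 1 ≤ k → (gaussianTail (sepThreshold dl k))⁻¹ ≤
      6 * (4 * k / dl) ^ (96 / dl) := by
    intro k hk
    have hk' : (1 : ℝ) ≤ k := by exact_mod_cast hk
    set t := sepThreshold dl k with ht
    have ht1 : 1 ≤ t := one_le_sepThreshold h0 h1 hk
    have hm : 0 < 4 * k / dl := by positivity
    have hpow : (4 * k / dl) ^ (96 / dl) = rexp (t ^ 2) := by
      rw [sepThreshold_sq h0 h1 hk, Real.rpow_def_of_pos hm, mul_comm]
    rw [hpow]
    have h2 : √(2 * π) ≤ 3 := by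
      rw [Real.sqrt_le_left (by norm_num)]
      nlinarith [Real.pi_lt_d2]
    -- This absorbs the polynomial factor of the tail estimate into a second copy of the
    -- exponential.
    have htexp : t ≤ rexp (t ^ 2 / 2) := by
      have := Real.add_one_le_exp (t ^ 2 / 2)
      nlinarith [sq_nonneg (t - 1)]
    have h3 : (6 * rexp (t ^ 2))⁻¹ ≤ gaussianTail t := by
      refine le_trans ?_ (le_gaussianTail ht1)
      have h4 : t + 1 / t ≤ 2 * t := by
        have : 1 / t ≤ 1 := by rw [div_le_one (by linarith)]; exact ht1
        linarith
      unfold gaussDensity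
      rw [Real.exp_neg, ← mul_inv, ← one_div, ← one_div, div_div]
      refine one_div_le_one_div_of_le (by positivity) ?_
      calc √(2 * π) * rexp (t ^ 2 / 2) * (t + 1 / t)
          ≤ 3 * rexp (t ^ 2 / 2) * (2 * rexp (t ^ 2 / 2)) := by gcongr; linarith
        _ = 6 * rexp (t ^ 2) := by
            rw [show t ^ 2 = t ^ 2 / 2 + t ^ 2 / 2 by ring, Real.exp_add]; ring_nf
    exact inv_le_of_inv_le₀ (by positivity) h3
  obtain ⟨a, ha⟩ := exists_nat_ge (96 / dl)
  obtain ⟨b, hb⟩ := exists_nat_ge (12 * (4 / dl) ^ (96 / dl) * Real.log (1 / dl))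
  refine ⟨max a b, fun k hk => ?_⟩
  have hk' : (1 : ℝ) ≤ k := by exact_mod_cast hk
  have hlog : 0 ≤ Real.log (1 / dl) := Real.log_nonneg (by rw [le_div_iff₀ h0]; linarith)
  have hc : sepRounds dl k ≤ b * k ^ a := by
    rw [sepRounds, Nat.ceil_le]
    push_cast
    calc 2 / gaussianTail (sepThreshold dl k) * Real.log (1 / dl)
        = 2 * (gaussianTail (sepThreshold dl k))⁻¹ * Real.log (1 / dl) := by
          rw [div_eq_mul_inv]
      _ ≤ 2 * (6 * (4 * k / dl) ^ (96 / dl)) * Real.log (1 / dl) := by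
          gcongr; exact hbase k hk
      _ = (12 * (4 / dl) ^ (96 / dl) * Real.log (1 / dl)) * (k : ℝ) ^ (96 / dl) := by
          rw [show 4 * (k : ℝ) / dl = 4 / dl * k by ring,
            Real.mul_rpow (by positivity) (by positivity)]
          ring
      _ ≤ b * (k : ℝ) ^ a := by
          gcongr
          rw [← Real.rpow_natCast]
          exact Real.rpow_le_rpow_of_exponent_le hk' ha
  exact hc.trans (Nat.mul_le_mul (le_max_right _ _) (Nat.pow_le_pow_right hk (le_max_left _ _)))

end GaussianTail

end BufferedCheeger

namespace BufferedCheeger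

/-! ### Linear forms of a standard Gaussian vector -/

section GaussianVector

open MeasureTheory ProbabilityTheory Real Filter Topology

/-- The law of a standard Gaussian vector. -/
noncomputable def gaussVec (k : ℕ) : Measure (Fin k → ℝ) :=
  Measure.pi fun _ => gaussianReal 0 1

instance (k : ℕ) : IsProbabilityMeasure (gaussVec k) := by
  unfold gaussVec; infer_instance

/-- The linear form with the given coefficients. -/
noncomputable def lin {k : ℕ} (a : Fin k → ℝ) : (Fin k → ℝ) →L[ℝ] ℝ :=
  ∑ i, a i • ContinuousLinearMap.proj i

theorem lin_apply {k : ℕ} (a g : Fin k → ℝ) : lin a g = ∑ i, a i * g i := by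
  simp [lin]

theorem lin_add {k : ℕ} (a b g : Fin k → ℝ) : lin (a + b) g = lin a g + lin b g := by
  simp [lin_apply, add_mul, Finset.sum_add_distrib]

theorem lin_smul {k : ℕ} (c : ℝ) (a g : Fin k → ℝ) : lin (c • a) g = c * lin a g := by
  simp [lin_apply, Finset.mul_sum, mul_assoc]

variable {k : ℕ}

theorem measurable_lin (a : Fin k → ℝ) : Measurable (lin a) := (lin a).continuous.measurable

theorem map_eval_gaussVec (i : Fin k) :
    (gaussVec k).map (fun g => g i) = gaussianReal 0 1 :=
  (measurePreserving_eval (fun _ : Fin k => gaussianReal 0 1) i).map_eq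

theorem hasLaw_eval (i : Fin k) : HasLaw (fun g : Fin k → ℝ => g i) (gaussianReal 0 1)
    (gaussVec k) := ⟨(measurable_pi_apply i).aemeasurable, map_eval_gaussVec i⟩

theorem iIndepFun_eval : iIndepFun (fun i (g : Fin k → ℝ) => g i) (gaussVec k) :=
  iIndepFun_pi (X := fun _ x => x) fun _ => aemeasurable_id

theorem hasGaussianLaw_id : HasGaussianLaw (fun g : Fin k → ℝ => g) (gaussVec k) :=
  iIndepFun_eval.hasGaussianLaw fun i => (hasLaw_eval i).hasGaussianLaw

theorem memLp_eval (i : Fin k) : MemLp (fun g : Fin k → ℝ => g i) 2 (gaussVec k) :=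
  (hasLaw_eval i).hasGaussianLaw.memLp_two

theorem covariance_eval (i j : Fin k) :
    cov[fun g : Fin k → ℝ => g i, fun g => g j; gaussVec k] = if i = j then 1 else 0 := by
  split_ifs with h
  · subst h
    rw [covariance_self (measurable_pi_apply i).aemeasurable, (hasLaw_eval i).variance_eq, variance_id_gaussianReal]
    simp
  · exact (iIndepFun_eval.indepFun h).covariance_eq_zero (memLp_eval i) (memLp_eval j)

theorem covariance_lin (a b : Fin k → ℝ) :
    cov[lin a, lin b; gaussVec k] = ∑ i, a i * b i := by
  have h : ∀ a : Fin k → ℝ, (lin a : (Fin k → ℝ) → ℝ) = fun g => ∑ i, a i * g i := fun a => by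
    funext g; exact lin_apply a g
  rw [h, h, covariance_fun_sum_fun_sum (fun i => (memLp_eval i).const_mul _)
    (fun i => (memLp_eval i).const_mul _)]
  simp only [covariance_const_mul_left, covariance_const_mul_right, covariance_eval]
  simp [mul_comm]

theorem integral_lin (a : Fin k → ℝ) : ∫ g, lin a g ∂gaussVec k = 0 := by
  simp only [lin_apply]
  rw [integral_finsetSum _ fun i _ => ((memLp_eval i).integrable (by norm_num)).const_mul _]
  refine Finset.sum_eq_zero fun i _ => ?_
  rw [integral_const_mul, (hasLaw_eval i).integral_eq]
  simp

theorem hasGaussianLaw_lin (a : Fin k → ℝ) : HasGaussianLaw (lin a) (gaussVec k) :=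
  hasGaussianLaw_id.map (lin a)

theorem variance_lin (a : Fin k → ℝ) : Var[lin a; gaussVec k] = ∑ i, a i * a i := by
  rw [← covariance_self (measurable_lin a).aemeasurable, covariance_lin]

theorem map_lin (a : Fin k → ℝ) (ha : ∑ i, a i * a i = 1) :
    (gaussVec k).map (lin a) = gaussianReal 0 1 := by
  rw [(hasGaussianLaw_lin a).map_eq_gaussianReal, integral_lin, variance_lin, ha]
  simp

theorem measure_lin_preimage {a : Fin k → ℝ} (ha : ∑ i, a i * a i = 1) {s : Set ℝ}
    (hs : MeasurableSet s) : gaussVec k {g | lin a g ∈ s} = gaussianReal 0 1 s := by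
  rw [← map_lin a ha, Measure.map_apply (measurable_lin a) hs]
  rfl

/-- Needed for coefficient vectors that are not normalized, and possibly zero: the part of one
direction orthogonal to another. -/
theorem lintegral_lin_sq (a : Fin k → ℝ) :
    ∫⁻ y, ENNReal.ofReal (y ^ 2) ∂(gaussVec k).map (lin a) =
      ENNReal.ofReal (∑ i, a i * a i) := by
  rw [lintegral_map (by fun_prop) (measurable_lin a), ← variance_lin,
    variance_eq_integral (measurable_lin a).aemeasurable, integral_lin]
  simp only [sub_zero]
  rw [ofReal_integral_eq_lintegral_ofReal _ (ae_of_all _ fun _ => sq_nonneg _)]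
  exact (hasGaussianLaw_lin a).memLp_two.integrable_sq

theorem indepFun_lin {a b : Fin k → ℝ} (h : ∑ i, a i * b i = 0) :
    IndepFun (lin a) (lin b) (gaussVec k) :=
  HasGaussianLaw.indepFun_of_covariance_eq_zero
    (hasGaussianLaw_id.map ((lin a).prod (lin b))) (by rw [covariance_lin, h])

/-- The square of the distance of two vectors. -/
def sqDist (a b : Fin k → ℝ) : ℝ := ∑ i, (a i - b i) * (a i - b i)

theorem sqDist_nonneg (a b : Fin k → ℝ) : 0 ≤ sqDist a b :=
  Finset.sum_nonneg fun _ _ => mul_self_nonneg _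

theorem sqDist_comm (a b : Fin k → ℝ) : sqDist a b = sqDist b a :=
  Finset.sum_congr rfl fun _ _ => by ring

theorem sqDist_eq (a b : Fin k → ℝ) :
    sqDist a b = ∑ i, a i * a i + ∑ i, b i * b i - 2 * ∑ i, a i * b i := by
  rw [sqDist, Finset.mul_sum, ← Finset.sum_add_distrib, ← Finset.sum_sub_distrib]
  exact Finset.sum_congr rfl fun _ _ => by ring

theorem measure_lin_ge {a : Fin k → ℝ} (ha : ∑ i, a i * a i = 1) (t : ℝ) :
    gaussVec k {g | t ≤ lin a g} = ENNReal.ofReal (gaussianTail t) := by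
  rw [gaussianTail, ofReal_measureReal]
  exact measure_lin_preimage ha measurableSet_Ici

/-- The probability that both projections exceed a threshold. -/
theorem measure_lin_ge_and_le {a b : Fin k → ℝ} (ha : ∑ i, a i * a i = 1)
    (hb : ∑ i, b i * b i = 1) {t m r : ℝ} (ht : 1 ≤ t) (hm : 2 ≤ m)
    (hr : r ≤ sqDist a b) (htr : 16 * Real.log m ≤ t ^ 2 * r) :
    gaussVec k {g | t ≤ lin a g ∧ t ≤ lin b g} ≤ ENNReal.ofReal (gaussianTail t / m) := by
  have hc := sqDist_eq a b
  rw [ha, hb] at hc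
  -- If both projections reach `t`, the projection on `a + b` reaches `2 t`, while the squared
  -- length of `a + b` is only `4` minus the squared distance. So a standard Gaussian exceeds `2 t /
  -- √s`, which is noticeably larger than `t`.
  set s := ∑ i, (a + b) i * (a + b) i with hs
  have hs' : s = 4 - sqDist a b := by
    have : s = ∑ i, a i * a i + ∑ i, b i * b i + 2 * ∑ i, a i * b i := by
      rw [hs, Finset.mul_sum, ← Finset.sum_add_distrib, ← Finset.sum_add_distrib]
      exact Finset.sum_congr rfl fun i _ => by simp only [Pi.add_apply]; ring
    rw [this, ha, hb]; linarith
  have hs0 : 0 ≤ s := Finset.sum_nonneg fun _ _ => mul_self_nonneg _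
  rcases hs0.eq_or_lt with h0 | hpos
  -- Antipodal directions: their projections are opposite and cannot both reach a positive
  -- threshold.
  · have hz : ∀ g, lin (a + b) g = 0 := fun g => by
      rw [lin_apply]
      refine Finset.sum_eq_zero fun i _ => ?_
      have := (Finset.sum_eq_zero_iff_of_nonneg
        (fun i _ => mul_self_nonneg ((a + b) i))).1 h0.symm i (Finset.mem_univ i)
      rw [mul_self_eq_zero.1 this, zero_mul]
    have : {g | t ≤ lin a g ∧ t ≤ lin b g} = ∅ := by
      ext g
      simp only [Set.mem_ofPred_eq, Set.mem_empty_iff_false, iff_false, not_and, not_le]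
      intro h
      have := hz g
      rw [lin_add] at this
      linarith
    rw [this]; simp
  · have hq : 0 < √s := Real.sqrt_pos.2 hpos
    have hss : √s * √s = s := Real.mul_self_sqrt hpos.le
    have hunit : ∑ i, ((√s)⁻¹ • (a + b)) i * ((√s)⁻¹ • (a + b)) i = 1 := by
      have : ∑ i, ((√s)⁻¹ • (a + b)) i * ((√s)⁻¹ • (a + b)) i = (√s * √s)⁻¹ * s := by
        rw [hs, Finset.mul_sum]
        exact Finset.sum_congr rfl fun i _ => by
          simp only [Pi.smul_apply, smul_eq_mul, mul_inv]; ring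
      rw [this, hss, inv_mul_cancel₀ hpos.ne']
    calc _ ≤ gaussVec k {g | 2 * t / √s ≤ lin ((√s)⁻¹ • (a + b)) g} := by
          refine measure_mono fun g hg => ?_
          simp only [Set.mem_ofPred_eq] at hg ⊢
          rw [lin_smul, lin_add, div_eq_inv_mul]
          gcongr
          linarith
      _ = _ := measure_lin_ge hunit _
      _ ≤ _ := by
          refine ENNReal.ofReal_le_ofReal (gaussianTail_le_div ht (by positivity) hm ?_)
          rw [div_pow, Real.sq_sqrt hpos.le, le_div_iff₀ hpos, hs']
          have hd := sqDist_nonneg a b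
          have hl : 0 ≤ Real.log m := Real.log_nonneg (by linarith)
          have : t ^ 2 * r ≤ t ^ 2 * sqDist a b := by gcongr
          nlinarith [mul_nonneg hl hd]

/-- The probability that the projections of two close vectors are separated. -/
theorem measure_lin_sep_le {a b : Fin k → ℝ} (ha : ∑ i, a i * a i = 1)
    (hb : ∑ i, b i * b i = 1) {t w : ℝ} (ht : 0 ≤ t) (hw : 0 < w)
    (hd : sqDist a b ≤ 1) :
    gaussVec k {g | t ≤ lin a g ∧ lin b g ≤ t - w} ≤
      ENNReal.ofReal (2 * gaussDensity t * (t / 2 + 1 / (4 * w)) * sqDist a b) := by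
  have hc := sqDist_eq a b
  rw [ha, hb] at hc
  set c := ∑ i, a i * b i with hcdef
  have hd0 := sqDist_nonneg a b
  have hc1 : 1 / 2 ≤ c := by linarith
  -- Decompose `b = c a + y` with `y` orthogonal to `a`. The two projections are then independent,
  -- and for a fixed value `z` of the second one the event confines the first to an interval
  -- starting at `t`.
  set y : Fin k → ℝ := b + (-c) • a with hy
  have hay : ∑ i, a i * y i = 0 := by
    have : ∑ i, a i * y i = c + (-c) * ∑ i, a i * a i := by
      rw [hcdef, Finset.mul_sum, ← Finset.sum_add_distrib]
      exact Finset.sum_congr rfl fun i _ => by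
        simp only [hy, Pi.add_apply, Pi.smul_apply, smul_eq_mul]; ring
    rw [this, ha]; ring
  have hyy : ∑ i, y i * y i = 1 - c ^ 2 := by
    have : ∀ r : ℝ, ∑ i, (b + (-r) • a) i * (b + (-r) • a) i =
        ∑ i, b i * b i - 2 * r * ∑ i, a i * b i + r ^ 2 * ∑ i, a i * a i := fun r => by
      rw [Finset.mul_sum, Finset.mul_sum, ← Finset.sum_sub_distrib, ← Finset.sum_add_distrib]
      exact Finset.sum_congr rfl fun i _ => by
        simp only [Pi.add_apply, Pi.smul_apply, smul_eq_mul]; ring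
    rw [hy, this, ha, hb, ← hcdef]; ring
  have hb' : ∀ g, lin b g = c * lin a g + lin y g := fun g => by
    rw [hy, lin_add, lin_smul]; ring
  set ν := (gaussVec k).map (lin y) with hν
  have hjoint : (gaussVec k).map (fun g => (lin a g, lin y g)) = (gaussianReal 0 1).prod ν := by
    rw [(indepFun_iff_map_prod_eq_prod_map_map (measurable_lin a).aemeasurable
      (measurable_lin y).aemeasurable).1 (indepFun_lin hay), map_lin a ha]
  have hmeas : MeasurableSet {p : ℝ × ℝ | t ≤ p.1 ∧ c * p.1 + p.2 ≤ t - w} :=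
    (measurableSet_le measurable_const measurable_fst).inter
      (measurableSet_le
        (by fun_prop : Measurable fun p : ℝ × ℝ => c * p.1 + p.2) measurable_const)
  have : IsProbabilityMeasure ν :=
    Measure.isProbabilityMeasure_map (measurable_lin y).aemeasurable
  have h1 : {g | t ≤ lin a g ∧ lin b g ≤ t - w} =
      (fun g => (lin a g, lin y g)) ⁻¹' {p : ℝ × ℝ | t ≤ p.1 ∧ c * p.1 + p.2 ≤ t - w} := by
    ext g; simp [hb']
  have hpd := (gaussDensity_pos t).le
  rw [h1, ← Measure.map_apply ((measurable_lin a).prodMk (measurable_lin y)) hmeas, hjoint,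
    Measure.prod_apply_symm hmeas]
  calc ∫⁻ z, gaussianReal 0 1 ((fun x => (x, z)) ⁻¹' {p : ℝ × ℝ | t ≤ p.1 ∧ c * p.1 + p.2 ≤ t - w})
        ∂ν
      ≤ ∫⁻ z, (ENNReal.ofReal (2 * gaussDensity t * (t * sqDist a b / 2)) +
          ENNReal.ofReal (2 * gaussDensity t / (4 * w)) * ENNReal.ofReal (z ^ 2)) ∂ν := by
        refine lintegral_mono fun z => ?_
        have hsub : (fun x => (x, z)) ⁻¹' {p : ℝ × ℝ | t ≤ p.1 ∧ c * p.1 + p.2 ≤ t - w} ⊆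
            Set.Icc t ((t - w - z) / c) := by
          intro x hx
          simp only [Set.mem_preimage, Set.mem_ofPred_eq] at hx
          refine ⟨hx.1, ?_⟩
          rw [le_div_iff₀ (by linarith)]
          linarith
        refine (measure_mono hsub).trans ((gaussianReal_Icc_le ht le_rfl).trans ?_)
        rw [← ENNReal.ofReal_mul (by positivity), ← ENNReal.ofReal_add (by positivity)
          (by positivity)]
        refine ENNReal.ofReal_le_ofReal ?_
        -- Completing the square uses up the gap `w` and leaves a term quadratic in `z`. As the mean
        -- of `z²` is `1 - c²`, which is at most the squared distance, the final bound is linear in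
        -- the squared distance.
        have hz : -z ≤ w + z ^ 2 / (4 * w) := by
          rw [← sub_nonneg]
          have : w + z ^ 2 / (4 * w) - -z = (2 * w + z) ^ 2 / (4 * w) := by field_simp; ring
          rw [this]; positivity
        -- The factor 2 is the bound for `1 / c`; the term with `t` comes from `1 - c`, which is
        -- half of the squared distance.
        have hlen : (t - w - z) / c - t ≤ 2 * (t * sqDist a b / 2 + z ^ 2 / (4 * w)) := by
          rw [sub_le_iff_le_add, div_le_iff₀ (by linarith)]
          have hq : 0 ≤ z ^ 2 / (4 * w) := by positivity
          have h2 : 0 ≤ t * sqDist a b := by positivity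
          have h3 : 1 - c = sqDist a b / 2 := by linarith
          have h4 : t - t * c = t * sqDist a b / 2 := by rw [← mul_one_sub, h3]; ring
          nlinarith
        calc gaussDensity t * ((t - w - z) / c - t)
            ≤ gaussDensity t * (2 * (t * sqDist a b / 2 + z ^ 2 / (4 * w))) := by gcongr
          _ = _ := by ring
    _ = ENNReal.ofReal (2 * gaussDensity t * (t * sqDist a b / 2)) +
          ENNReal.ofReal (2 * gaussDensity t / (4 * w)) * ENNReal.ofReal (1 - c ^ 2) := by
        rw [lintegral_add_left measurable_const, lintegral_const, measure_univ, mul_one, lintegral_const_mul _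
          (by fun_prop), hν, lintegral_lin_sq, hyy]
    _ ≤ _ := by
        have hcc : 1 - c ^ 2 ≤ sqDist a b := by nlinarith
        refine (add_le_add le_rfl (mul_le_mul_right (ENNReal.ofReal_le_ofReal hcc) _)).trans ?_
        rw [← ENNReal.ofReal_mul (by positivity), ← ENNReal.ofReal_add (by positivity)
          (by positivity)]
        refine ENNReal.ofReal_le_ofReal (le_of_eq ?_)
        ring

end GaussianVector

end BufferedCheeger

namespace BufferedCheeger

/-! ### One sample of an orthogonal separator -/

section Separator

open MeasureTheory ProbabilityTheory Real Filter Topology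

variable {n k : ℕ} {psi : Fin n → Fin k → ℝ} {mu : Fin n → ℝ} {dl e : ℝ}

/-- The data of a separator: the directions are unit vectors or zero. -/
structure IsSepData (psi : Fin n → Fin k → ℝ) (mu : Fin n → ℝ) (dl e : ℝ) : Prop where
  one_le : 1 ≤ k
  e_pos : 0 < e
  e_le : e ≤ dl
  dl_le : dl ≤ 1 / 100
  mu_nonneg : ∀ u, 0 ≤ mu u
  total_pos : 0 < ∑ u, mu u
  unit_or_zero : ∀ u, (∑ i, psi u i * psi u i = 1) ∨ psi u = 0

/-- The sample drawn by the separator with the parameters of the algorithm. -/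
noncomputable def drawn (psi : Fin n → Fin k → ℝ) (mu : Fin n → ℝ) (dl e : ℝ) (g : Fin k → ℝ) :
    VSet n × VSet n × VSet n :=
  sampleOf psi mu (sepThreshold dl k) (sepWidth e (sepThreshold dl k)) (sepRadius dl)
    (dl / (2 * k) * ∑ u, mu u) g

/-- A sample separates `u` from `v` by a buffer. -/
def SepFrom (s : VSet n × VSet n × VSet n) (u v : Fin n) : Prop :=
  (s.1 u = true ∧ s.1 v = false ∧ s.2.1 v = false) ∨
    ((s.1 u = true ∨ s.2.1 u = true) ∧ s.1 v = false ∧ s.2.1 v = false ∧ s.2.2 v = false)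

namespace IsSepData

theorem dl_pos (h : IsSepData psi mu dl e) : 0 < dl := h.e_pos.trans_le h.e_le

theorem one_le_threshold (h : IsSepData psi mu dl e) : 1 ≤ sepThreshold dl k :=
  one_le_sepThreshold h.dl_pos (h.dl_le.trans (by norm_num)) h.one_le

/-- The width is designed to cancel the factor `t + 1 / t` of the lower tail estimate, so that the
density at `t` times the width is at most `e / exp 1` times the tail. -/
theorem width_mul (h : IsSepData psi mu dl e) :
    sepWidth e (sepThreshold dl k) * (sepThreshold dl k + 1 / sepThreshold dl k) =
      e / Real.exp 1 := by
  have := h.one_le_threshold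
  have : 0 < sepThreshold dl k + 1 / sepThreshold dl k := by positivity
  rw [sepWidth]
  field_simp

theorem width_pos (h : IsSepData psi mu dl e) : 0 < sepWidth e (sepThreshold dl k) := by
  have := h.one_le_threshold
  have := h.e_pos
  unfold sepWidth
  positivity

theorem threshold_mul_width_le (h : IsSepData psi mu dl e) :
    sepThreshold dl k * sepWidth e (sepThreshold dl k) ≤ 1 / 200 := by
  have h1 := h.one_le_threshold
  have h2 := h.width_mul
  have h3 := h.width_pos
  have h4 : e / Real.exp 1 ≤ 1 / 200 := by
    rw [div_le_iff₀ (Real.exp_pos 1)]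
    have := Real.exp_one_gt_d9
    have := h.e_le
    have := h.dl_le
    nlinarith
  have h5 : 0 ≤ sepWidth e (sepThreshold dl k) * (1 / sepThreshold dl k) := by positivity
  nlinarith

theorem width_le (h : IsSepData psi mu dl e) :
    sepWidth e (sepThreshold dl k) ≤ 1 / 200 := by
  have h1 := h.one_le_threshold
  have h3 := h.width_pos
  have := h.threshold_mul_width_le
  nlinarith

theorem proj_eq_zero {u : Fin n} (hu : psi u = 0) (g : Fin k → ℝ) : proj psi g u = 0 := by
  simp [proj, hu]

theorem proj_eq_lin (g : Fin k → ℝ) (u : Fin n) : proj psi g u = lin (psi u) g :=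
  (lin_apply _ _).symm

theorem measurable_proj (u : Fin n) : Measurable fun g : Fin k → ℝ => proj psi g u := by
  simp only [proj_eq_lin]
  exact measurable_lin _

theorem measurableSet_kept (t rad cap : ℝ) :
    MeasurableSet {g : Fin k → ℝ | Kept psi mu t rad cap g} := by
  have hm : ∀ u, Measurable fun g : Fin k → ℝ => farMeasure psi mu t rad g u := fun u => by
    unfold farMeasure
    refine Finset.measurable_sum _ fun v _ => Measurable.ite ?_ measurable_const measurable_const
    exact (measurableSet_le measurable_const (measurable_proj v)).inter (MeasurableSet.const _)
  unfold Kept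
  simp only [Set.ofPred_exists]
  exact MeasurableSet.iUnion fun u =>
    (measurableSet_le measurable_const (measurable_proj u)).inter
      (measurableSet_le (hm u) measurable_const)

theorem measurable_drawn : Measurable (drawn psi mu dl e) := by
  have hb : ∀ f : (Fin k → ℝ) → VSet n, (∀ u, MeasurableSet {g | f g u = true}) → Measurable f :=
    fun f hf => measurable_pi_iff.2 fun u => measurable_to_bool (hf u)
  unfold drawn sampleOf
  refine (hb _ fun u => ?_).prodMk ((hb _ fun u => ?_).prodMk (hb _ fun u => ?_)) <;>
    simp only [decide_eq_true_eq]
  · exact (measurableSet_kept _ _ _).inter (measurableSet_le measurable_const (measurable_proj u))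
  · exact (measurableSet_kept _ _ _).inter ((measurableSet_lt measurable_const
      (measurable_proj u)).inter (measurableSet_lt (measurable_proj u) measurable_const))
  · exact (measurableSet_kept _ _ _).inter ((measurableSet_lt measurable_const
      (measurable_proj u)).inter (measurableSet_lt (measurable_proj u) measurable_const))

/-- A vertex with a direction gets into a sample with probability at least half of the
Gaussian tail. -/
theorem le_measure_mem (h : IsSepData psi mu dl e) {u : Fin n}
    (hu : ∑ i, psi u i * psi u i = 1) :
    ENNReal.ofReal (gaussianTail (sepThreshold dl k) / 2) ≤
      gaussVec k {g | (drawn psi mu dl e g).1 u = true} := by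
  set t := sepThreshold dl k with ht
  set cap := dl / (2 * k) * ∑ u, mu u with hcap
  have ht1 : 1 ≤ t := h.one_le_threshold
  have hk : (1 : ℝ) ≤ k := by exact_mod_cast h.one_le
  have hdl := h.dl_pos
  have hA := gaussianTail_pos ht1
  have hcap0 : 0 < cap := by have := h.total_pos; positivity
  set m : ℝ := 4 * k / dl with hm
  have hm2 : 2 ≤ m := by
    rw [hm, le_div_iff₀ hdl]; have := h.dl_le; linarith
  -- The only way to lose `u` after its projection has reached the threshold. It suffices that this
  -- has probability at most half of the tail.
  set Q := {g : Fin k → ℝ | t ≤ proj psi g u ∧ cap < farMeasure psi mu t (sepRadius dl) g u}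
  have hpair : ∀ v, sepRadius dl < √(sqDist (psi u) (psi v)) →
      gaussVec k {g | t ≤ proj psi g u ∧ t ≤ proj psi g v} ≤
        ENNReal.ofReal (gaussianTail t / m) := by
    intro v hv
    rcases h.unit_or_zero v with hv1 | hv0
    · simp only [proj_eq_lin]
      refine measure_lin_ge_and_le hu hv1 ht1 hm2 (r := sepRadius dl ^ 2) ?_ ?_
      · rw [← Real.sq_sqrt (sqDist_nonneg (psi u) (psi v))]
        exact pow_le_pow_left₀ (sepRadius_pos hdl).le hv.le 2
      · rw [ht, sepThreshold_sq hdl (h.dl_le.trans (by norm_num)) h.one_le, sepRadius,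
          Real.sq_sqrt (by positivity)]
        refine le_of_eq ?_
        field_simp
        ring
    · have : {g : Fin k → ℝ | t ≤ proj psi g u ∧ t ≤ proj psi g v} = ∅ := by
        ext g
        simp only [Set.mem_ofPred_eq, Set.mem_empty_iff_false, iff_false, not_and, not_le]
        intro _
        rw [proj_eq_zero hv0]; linarith
      rw [this]; simp
  have hpm : ∀ v, MeasurableSet {g : Fin k → ℝ | t ≤ proj psi g u ∧ t ≤ proj psi g v} := fun v =>
    (measurableSet_le measurable_const (measurable_proj u)).inter
      (measurableSet_le measurable_const (measurable_proj v))
  -- The expected far measure on the event that `u` reaches the threshold. Each far `v` contributes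
  -- at most `mu v` times the tail over `m`; with `m = 4 k / dl` the total is `cap` times half of
  -- the tail, and Markov's inequality bounds `Q`.
  have hint : ∫⁻ g, ∑ v, ENNReal.ofReal (if sepRadius dl < √(sqDist (psi u) (psi v)) then mu v
      else 0) * Set.indicator {g | t ≤ proj psi g u ∧ t ≤ proj psi g v} 1 g ∂gaussVec k ≤
      ENNReal.ofReal (cap * (gaussianTail t / 2)) := by
    rw [lintegral_finsetSum]
    · calc _ ≤ ∑ v, ENNReal.ofReal (mu v) * ENNReal.ofReal (gaussianTail t / m) := by
            refine Finset.sum_le_sum fun v _ => ?_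
            rw [lintegral_const_mul' _ _ ENNReal.ofReal_ne_top, lintegral_indicator_one (hpm v)]
            split_ifs with hv
            · gcongr
              exact hpair v hv
            · simp
        _ = ENNReal.ofReal (∑ v, mu v) * ENNReal.ofReal (gaussianTail t / m) := by
            rw [← Finset.sum_mul, ENNReal.ofReal_sum_of_nonneg fun v _ => h.mu_nonneg v]
        _ = _ := by
            rw [← ENNReal.ofReal_mul h.total_pos.le, hcap, hm]
            congr 1
            field_simp
            ring
    · exact fun v _ => (measurable_one.indicator (hpm v)).const_mul _
  have hQ : gaussVec k Q ≤ ENNReal.ofReal (gaussianTail t / 2) := by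
    have hsub : Q ⊆ {g | ENNReal.ofReal cap ≤ ∑ v, ENNReal.ofReal
        (if sepRadius dl < √(sqDist (psi u) (psi v)) then mu v else 0) *
          Set.indicator {g | t ≤ proj psi g u ∧ t ≤ proj psi g v} 1 g} := by
      rintro g ⟨hg, hfar⟩
      refine (ENNReal.ofReal_le_ofReal hfar.le).trans ?_
      rw [farMeasure, ENNReal.ofReal_sum_of_nonneg]
      · refine Finset.sum_le_sum fun v _ => ?_
        split_ifs with h1 h2 h2
        · have : g ∈ {g : Fin k → ℝ | t ≤ proj psi g u ∧ t ≤ proj psi g v} := ⟨hg, h1.1⟩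
          rw [Set.indicator_of_mem this]; simp
        · exact absurd h1.2 h2
        · simp
        · simp
      · intro v _
        split_ifs
        · exact h.mu_nonneg v
        · exact le_rfl
    refine (measure_mono hsub).trans ((meas_ge_le_lintegral_div (Finset.measurable_sum _ fun v _ =>
      (measurable_one.indicator (hpm v)).const_mul _).aemeasurable
      (ENNReal.ofReal_pos.2 hcap0).ne' ENNReal.ofReal_ne_top).trans ?_)
    refine (ENNReal.div_le_div_right hint _).trans ?_
    rw [← ENNReal.ofReal_div_of_pos hcap0, mul_div_cancel_left₀ _ hcap0.ne']
  -- Outside `Q` the vertex `u` is itself a centre that justifies keeping the sample.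
  have hX : {g | (drawn psi mu dl e g).1 u = true} ⊇ {g | t ≤ lin (psi u) g} \ Q := by
    rintro g ⟨hg, hq⟩
    simp only [Set.mem_ofPred_eq] at hg
    rw [← proj_eq_lin] at hg
    simp only [drawn, sampleOf, Set.mem_ofPred_eq, decide_eq_true_eq]
    refine ⟨⟨u, hg, ?_⟩, hg⟩
    by_contra hc
    exact hq ⟨hg, not_le.1 hc⟩
  calc _ = ENNReal.ofReal (gaussianTail t) - ENNReal.ofReal (gaussianTail t / 2) := by
        rw [← ENNReal.ofReal_sub _ (by positivity)]; congr 1; ring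
    _ ≤ gaussVec k {g | t ≤ lin (psi u) g} - gaussVec k Q := by
        rw [measure_lin_ge hu]; gcongr
    _ ≤ gaussVec k ({g | t ≤ lin (psi u) g} \ Q) := le_measure_sdiff
    _ ≤ _ := measure_mono hX

/-- The buffers have small probability. -/
theorem measure_buffers_le (h : IsSepData psi mu dl e) {u : Fin n}
    (hu : ∑ i, psi u i * psi u i = 1) :
    gaussVec k {g | (drawn psi mu dl e g).2.1 u = true ∨ (drawn psi mu dl e g).2.2 u = true} ≤
      ENNReal.ofReal (e * gaussianTail (sepThreshold dl k)) := by
  set t := sepThreshold dl k with ht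
  set w := sepWidth e t with hw
  have ht1 : 1 ≤ t := h.one_le_threshold
  have hw0 : 0 < w := h.width_pos
  have hw1 : w ≤ 1 / 200 := h.width_le
  have htw : t * w ≤ 1 / 200 := h.threshold_mul_width_le
  have he := h.e_pos
  have hsub : {g | (drawn psi mu dl e g).2.1 u = true ∨ (drawn psi mu dl e g).2.2 u = true} ⊆
      {g | lin (psi u) g ∈ Set.Icc (t - 2 * w) t} := by
    intro g hg
    simp only [drawn, sampleOf, Set.mem_ofPred_eq, decide_eq_true_eq, proj_eq_lin] at hg
    simp only [Set.mem_ofPred_eq, Set.mem_Icc]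
    rcases hg with ⟨_, h1, h2⟩ | ⟨_, h1, h2⟩ <;> constructor <;> linarith
  refine (measure_mono hsub).trans ?_
  rw [measure_lin_preimage hu measurableSet_Icc]
  refine (gaussianReal_Icc_le (by linarith) le_rfl).trans (ENNReal.ofReal_le_ofReal ?_)
  have hd := gaussDensity_pos t
  -- The two buffers have total width `2 w`; the factor `exp 1` in the definition of the width pays
  -- for this 2 and for the variation of the density.
  have hexp : rexp (t * (2 * w)) * 2 ≤ rexp 1 := by
    have h1 : rexp (t * (2 * w)) ≤ rexp (1 / 100) := Real.exp_le_exp.2 (by linarith)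
    have h2 : rexp (1 / 100) ≤ 1.2 := by
      have := Real.exp_bound_div_one_sub_of_interval (x := 1 / 100) (by norm_num) (by norm_num)
      refine this.trans (by norm_num)
    have := Real.exp_one_gt_d9
    linarith
  have hlow := le_gaussianTail ht1
  rw [div_le_iff₀ (by positivity)] at hlow
  have hwm : w * (t + 1 / t) = e / rexp 1 := h.width_mul
  calc gaussDensity (t - 2 * w) * (t - (t - 2 * w))
      ≤ rexp (t * (2 * w)) * gaussDensity t * (2 * w) := by
        have := gaussDensity_sub_le (t := t) (s := 2 * w)
        rw [sub_sub_cancel]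
        gcongr
    _ ≤ rexp (t * (2 * w)) * (gaussianTail t * (t + 1 / t)) * (2 * w) := by gcongr
    _ = rexp (t * (2 * w)) * 2 * gaussianTail t * (w * (t + 1 / t)) := by ring
    _ ≤ rexp 1 * gaussianTail t * (e / rexp 1) := by
        rw [hwm]
        have := (gaussianTail_pos ht1).le
        gcongr
    _ = e * gaussianTail t := by field_simp

/-- For close unit vectors, `measure_lin_sep_le` is applied at the threshold `t` for the first
buffer and at `t - w` for the second. If the squared distance is at least 1, which includes the case
of a zero direction of `v`, it is enough that `u` lies above `t - w` with probability at most twice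
the tail. A zero direction of `u` is never above `t - w`. -/
theorem measure_sepFrom_le (h : IsSepData psi mu dl e) (u v : Fin n) :
    gaussVec k {g | SepFrom (drawn psi mu dl e g) u v} ≤
      ENNReal.ofReal (20 * sepThreshold dl k ^ 2 / e * gaussianTail (sepThreshold dl k) *
        sqDist (psi u) (psi v)) := by
  set t := sepThreshold dl k with ht
  set w := sepWidth e t with hw
  have ht1 : 1 ≤ t := h.one_le_threshold
  have hw0 : 0 < w := h.width_pos
  have hw1 : w ≤ 1 / 200 := h.width_le
  have htw : t * w ≤ 1 / 200 := h.threshold_mul_width_le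
  have he := h.e_pos
  have he1 : e ≤ 1 / 100 := h.e_le.trans h.dl_le
  have hA := gaussianTail_pos ht1
  have hwm : w * (t + 1 / t) = e / rexp 1 := h.width_mul
  have hlow := le_gaussianTail ht1
  rw [div_le_iff₀ (by positivity)] at hlow
  have hd := gaussDensity_pos t
  have hdw : gaussDensity (t - w) ≤ 1.2 * gaussDensity t := by
    refine gaussDensity_sub_le.trans ?_
    gcongr
    have h1 : rexp (t * w) ≤ rexp (1 / 200) := Real.exp_le_exp.2 htw
    have := Real.exp_bound_div_one_sub_of_interval (x := 1 / 200) (by norm_num) (by norm_num)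
    exact (h1.trans this).trans (by norm_num)
  -- The buffers are open strips, so a projection equal to `t - w` lies in neither of them. This
  -- boundary case is split off and turns out to be a null event.
  have hsub : {g | SepFrom (drawn psi mu dl e g) u v} ⊆
      {g | t - w ≤ proj psi g u} ∩ ({g | t ≤ proj psi g u ∧ proj psi g v ≤ t - w} ∪
        {g | t - w ≤ proj psi g u ∧ proj psi g v ≤ t - w - w} ∪ {g | proj psi g v = t - w}) := by
    intro g hg
    simp only [SepFrom, drawn, sampleOf, Set.mem_ofPred_eq, decide_eq_true_eq,
      decide_eq_false_iff_not] at hg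
    simp only [Set.mem_inter_iff, Set.mem_union, Set.mem_ofPred_eq]
    rcases hg with ⟨⟨hk, h1⟩, h2, h3⟩ | ⟨h1, h2, h3, h4⟩
    · have h2' : proj psi g v < t := not_le.1 fun hc => h2 ⟨hk, hc⟩
      have h3' : proj psi g v ≤ t - w := not_lt.1 fun hc => h3 ⟨hk, hc, h2'⟩
      exact ⟨by linarith, Or.inl (Or.inl ⟨h1, h3'⟩)⟩
    · have hk : Kept psi mu t (sepRadius dl) (dl / (2 * k) * ∑ u, mu u) g := by
        rcases h1 with h1 | h1 <;> exact h1.1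
      have h1' : t - w ≤ proj psi g u := by
        rcases h1 with h1 | h1
        · linarith [h1.2]
        · exact h1.2.1.le
      have h2' : proj psi g v < t := not_le.1 fun hc => h2 ⟨hk, hc⟩
      have h3' : proj psi g v ≤ t - w := not_lt.1 fun hc => h3 ⟨hk, hc, h2'⟩
      refine ⟨h1', ?_⟩
      rcases h3'.eq_or_lt with h5 | h5
      · exact Or.inr h5
      · exact Or.inl (Or.inr ⟨h1', not_lt.1 fun hc => h4 ⟨hk, hc, h5⟩⟩)
  refine (measure_mono hsub).trans ?_
  rcases h.unit_or_zero u with hu | hu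
  swap
  · have : {g : Fin k → ℝ | t - w ≤ proj psi g u} = ∅ := by
      ext g
      simp only [Set.mem_ofPred_eq, Set.mem_empty_iff_false, iff_false, not_le, proj_eq_zero hu]
      linarith
    rw [this]; simp
  by_cases hcase : (∑ i, psi v i * psi v i = 1) ∧ sqDist (psi u) (psi v) ≤ 1
  · obtain ⟨hv, hle⟩ := hcase
    have hD := sqDist_nonneg (psi u) (psi v)
    refine (measure_mono Set.inter_subset_right).trans ((measure_union_le _ _).trans ?_)
    have h0 : gaussVec k {g | proj psi g v = t - w} = 0 := by
      simp only [proj_eq_lin]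
      have hz := measure_lin_preimage hv (measurableSet_singleton (t - w))
      simp only [Set.mem_singleton_iff] at hz
      have := nullSingletonClass_gaussianReal (μ := 0) (v := 1) one_ne_zero
      rw [hz, measure_singleton]
    rw [h0, add_zero]
    refine (measure_union_le _ _).trans ?_
    simp only [proj_eq_lin]
    -- Serves both thresholds, `τ = t` and `τ = t - w`. The factor `t²` arises from two factors `t +
    -- 1 / t ≤ 2 t`, one from the tail estimate and one from `1 / w`.
    have hone : ∀ τ, 0 ≤ τ → τ ≤ t → gaussDensity τ ≤ 1.2 * gaussDensity t →
        2 * gaussDensity τ * (τ / 2 + 1 / (4 * w)) * sqDist (psi u) (psi v) ≤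
        10 * t ^ 2 / e * gaussianTail t * sqDist (psi u) (psi v) := by
      intro τ hτ0 hτ hφ
      refine mul_le_mul_of_nonneg_right ?_ hD
      have h1 : τ / 2 + 1 / (4 * w) ≤ 0.26 / w := by
        rw [le_div_iff₀ hw0, add_mul]
        have : 1 / (4 * w) * w = 1 / 4 := by field_simp
        rw [this]
        nlinarith
      have hsum : t + 1 / t ≤ 2 * t := by
        have : 1 / t ≤ 1 := by rw [div_le_one (by linarith)]; exact ht1
        linarith
      have hinv : 1 / w = rexp 1 * (t + 1 / t) / e := by
        have : 0 < t + 1 / t := by positivity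
        rw [hw, sepWidth, one_div_div]
      calc 2 * gaussDensity τ * (τ / 2 + 1 / (4 * w))
          ≤ 2 * (1.2 * gaussDensity t) * (0.26 / w) := by gcongr
        _ = 0.624 * gaussDensity t * (1 / w) := by ring
        _ ≤ 0.624 * (gaussianTail t * (2 * t)) * (rexp 1 * (2 * t) / e) := by
            rw [hinv]
            gcongr
            exact hlow.trans (by gcongr)
        _ = (2.496 * rexp 1) * (t ^ 2 / e * gaussianTail t) := by ring
        _ ≤ 10 * (t ^ 2 / e * gaussianTail t) := by
            gcongr
            linarith [Real.exp_one_lt_d9]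
        _ = _ := by ring
    calc _ ≤ ENNReal.ofReal (10 * t ^ 2 / e * gaussianTail t * sqDist (psi u) (psi v)) +
          ENNReal.ofReal (10 * t ^ 2 / e * gaussianTail t * sqDist (psi u) (psi v)) := by
          refine add_le_add ?_ ?_
          · exact (measure_lin_sep_le hu hv (by linarith) hw0 hle).trans
              (ENNReal.ofReal_le_ofReal (hone t (by linarith) le_rfl (by linarith)))
          · exact (measure_lin_sep_le hu hv (by linarith) hw0 hle).trans
              (ENNReal.ofReal_le_ofReal (hone (t - w) (by linarith) (by linarith) hdw))
      _ = _ := by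
          rw [← ENNReal.ofReal_add (by positivity) (by positivity)]
          congr 1; ring
  · have hD : 1 ≤ sqDist (psi u) (psi v) := by
      rcases h.unit_or_zero v with hv | hv
      · exact le_of_lt (not_le.1 fun hc => hcase ⟨hv, hc⟩)
      · simp [sqDist, hv, hu]
    refine (measure_mono Set.inter_subset_left).trans ?_
    have hsub2 : {g : Fin k → ℝ | t - w ≤ proj psi g u} ⊆
        {g | t ≤ lin (psi u) g} ∪ {g | lin (psi u) g ∈ Set.Icc (t - w) t} := by
      intro g hg
      simp only [Set.mem_union, Set.mem_ofPred_eq, Set.mem_Icc, proj_eq_lin] at hg ⊢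
      rcases le_total t (lin (psi u) g) with h1 | h1
      · exact Or.inl h1
      · exact Or.inr ⟨hg, h1⟩
    refine (measure_mono hsub2).trans ((measure_union_le _ _).trans ?_)
    rw [measure_lin_ge hu, measure_lin_preimage hu measurableSet_Icc]
    refine (add_le_add le_rfl (gaussianReal_Icc_le (by linarith) le_rfl)).trans ?_
    have hdd := gaussDensity_pos (t - w)
    rw [sub_sub_cancel, ← ENNReal.ofReal_add hA.le (by positivity)]
    refine ENNReal.ofReal_le_ofReal ?_
    have h2 : gaussDensity (t - w) * w ≤ gaussianTail t := by
      calc gaussDensity (t - w) * w ≤ 1.2 * (gaussianTail t * (t + 1 / t)) * w := by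
            gcongr; exact hdw.trans (by gcongr)
        _ = 1.2 * gaussianTail t * (e / rexp 1) := by rw [← hwm]; ring
        _ ≤ 1.2 * gaussianTail t * (1 / 100 / 1) := by
            gcongr; exact Real.one_le_exp zero_le_one
        _ ≤ gaussianTail t := by linarith
    have h3 : 2 ≤ 20 * t ^ 2 / e := by
      rw [le_div_iff₀ he]; nlinarith
    calc _ ≤ 2 * gaussianTail t * 1 := by linarith
      _ ≤ _ := by gcongr

/-- Two vertices are unlikely to be separated by a buffer. -/
theorem measure_sep_le (h : IsSepData psi mu dl e) (u v : Fin n) :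
    gaussVec k {g | SepFrom (drawn psi mu dl e g) u v ∨ SepFrom (drawn psi mu dl e g) v u} ≤
      ENNReal.ofReal (40 * sepThreshold dl k ^ 2 / e * gaussianTail (sepThreshold dl k) *
        sqDist (psi u) (psi v)) := by
  have he := h.e_pos
  have hA := gaussianTail_pos h.one_le_threshold
  have hD := sqDist_nonneg (psi u) (psi v)
  refine (measure_union_le _ _).trans ((add_le_add (h.measure_sepFrom_le u v)
    (h.measure_sepFrom_le v u)).trans (le_of_eq ?_))
  rw [sqDist_comm (psi v), ← ENNReal.ofReal_add (by positivity) (by positivity)]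
  congr 1; ring

end IsSepData

end Separator

end BufferedCheeger

namespace BufferedCheeger

/-! ### Independent rounds -/

section Rounds

open MeasureTheory ProbabilityTheory Real Filter Topology

section Abstract

variable {Ω β : Type*} [MeasurableSpace Ω] [MeasurableSpace β] {P : Measure Ω}
  {ν : Measure β} [IsProbabilityMeasure ν] {f : ℕ → Ω → β}

theorem measure_forall_mem_le (hf : ∀ s, Measurable (f s)) (hi : iIndepFun f P)
    (hν : ∀ s, P.map (f s) = ν) {A : Set β} (hA : MeasurableSet A) {q : ℝ}
    (hq0 : 0 ≤ q) (hq : ENNReal.ofReal q ≤ ν Aᶜ) (T : ℕ) :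
    P {x | ∀ j < T, f j x ∈ A} ≤ ENNReal.ofReal ((1 - q) ^ T) := by
  have hA' : ν A ≤ ENNReal.ofReal (1 - q) := by
    have := prob_compl_eq_one_sub (μ := ν) hA.compl
    rw [compl_compl] at this
    rw [this, ENNReal.ofReal_sub _ hq0, ENNReal.ofReal_one]
    gcongr
  have hq1 : 0 ≤ 1 - q := by
    have : ENNReal.ofReal q ≤ 1 := hq.trans prob_le_one
    rw [ENNReal.ofReal_le_one] at this
    linarith
  have : {x | ∀ j < T, f j x ∈ A} = ⋂ j ∈ Finset.range T, f j ⁻¹' A := by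
    ext x; simp
  rw [this, hi.measure_inter_preimage_eq_mul (Finset.range T) fun _ _ => hA,
    ENNReal.ofReal_pow hq1]
  calc _ = ∏ j ∈ Finset.range T, ν A := Finset.prod_congr rfl fun j _ => by
        rw [← hν j, Measure.map_apply (hf j) hA]
    _ = ν A ^ T := by simp
    _ ≤ _ := by gcongr

/-- By independence the event has probability at most `(1 - q) ^ s * b` in round `s`; the geometric
series gives `b / q` regardless of the number of rounds. In the applications `A` says that `u` is
missed, and `q` and `b` are both proportional to the tail, which therefore cancels. -/
theorem measure_exists_first_le (hf : ∀ s, Measurable (f s)) (hi : iIndepFun f P)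
    (hν : ∀ s, P.map (f s) = ν) {A B : Set β} (hA : MeasurableSet A) (hB : MeasurableSet B)
    {q b : ℝ} (hq0 : 0 < q) (hq : ENNReal.ofReal q ≤ ν Aᶜ) (hb0 : 0 ≤ b)
    (hb : ν B ≤ ENNReal.ofReal b) (T : ℕ) :
    P {x | ∃ s < T, (∀ j < s, f j x ∈ A) ∧ f s x ∈ B} ≤ ENNReal.ofReal (b / q) := by
  have hq1 : 0 ≤ 1 - q := by
    have : ENNReal.ofReal q ≤ 1 := hq.trans prob_le_one
    rw [ENNReal.ofReal_le_one] at this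
    linarith
  have hA' : ν A ≤ ENNReal.ofReal (1 - q) := by
    have := prob_compl_eq_one_sub (μ := ν) hA.compl
    rw [compl_compl] at this
    rw [this, ENNReal.ofReal_sub _ hq0.le, ENNReal.ofReal_one]
    gcongr
  have hone : ∀ s, P {x | (∀ j < s, f j x ∈ A) ∧ f s x ∈ B} ≤
      ENNReal.ofReal ((1 - q) ^ s * b) := by
    intro s
    have : {x | (∀ j < s, f j x ∈ A) ∧ f s x ∈ B} =
        ⋂ j ∈ Finset.range (s + 1), f j ⁻¹' (if j = s then B else A) := by
      ext x
      simp only [Set.mem_ofPred_eq, Set.mem_iInter, Finset.mem_range, Set.mem_preimage]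
      constructor
      · rintro ⟨h1, h2⟩ j hj
        split_ifs with h
        · rw [h]; exact h2
        · exact h1 j (by omega)
      · intro h
        refine ⟨fun j hj => ?_, ?_⟩
        · have := h j (by omega)
          rwa [if_neg (by omega)] at this
        · have := h s (by omega)
          rwa [if_pos rfl] at this
    rw [this, hi.measure_inter_preimage_eq_mul (Finset.range (s + 1))
      (fun j _ => by split_ifs <;> assumption), Finset.prod_range_succ, if_pos rfl,
      ENNReal.ofReal_mul (by positivity), ENNReal.ofReal_pow hq1]
    refine mul_le_mul' ?_ ?_
    · calc _ = ∏ j ∈ Finset.range s, ν A := Finset.prod_congr rfl fun j hj => by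
            rw [if_neg (by have := Finset.mem_range.1 hj; omega), ← hν j,
              Measure.map_apply (hf j) hA]
        _ = ν A ^ s := by simp
        _ ≤ _ := by gcongr
    · rw [← Measure.map_apply (hf s) hB, hν s]; exact hb
  calc P {x | ∃ s < T, (∀ j < s, f j x ∈ A) ∧ f s x ∈ B}
      ≤ P (⋃ s ∈ Finset.range T, {x | (∀ j < s, f j x ∈ A) ∧ f s x ∈ B}) := by
        refine measure_mono fun x hx => ?_
        obtain ⟨s, hs, hx⟩ := hx
        exact Set.mem_biUnion (Finset.mem_coe.2 (Finset.mem_range.2 hs)) hx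
    _ ≤ ∑ s ∈ Finset.range T, P {x | (∀ j < s, f j x ∈ A) ∧ f s x ∈ B} :=
        measure_biUnion_finset_le _ _
    _ ≤ ∑ s ∈ Finset.range T, ENNReal.ofReal ((1 - q) ^ s * b) :=
        Finset.sum_le_sum fun s _ => hone s
    _ = ENNReal.ofReal ((∑ s ∈ Finset.range T, (1 - q) ^ s) * b) := by
        rw [Finset.sum_mul, ENNReal.ofReal_sum_of_nonneg fun s _ => by positivity]
    _ ≤ _ := by
        refine ENNReal.ofReal_le_ofReal ?_
        rw [div_eq_inv_mul]
        refine mul_le_mul_of_nonneg_right ?_ hb0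
        rw [← one_div, le_div_iff₀ hq0]
        have := geom_sum_mul_neg (1 - q) T
        rw [sub_sub_cancel] at this
        rw [this]
        have : 0 ≤ (1 - q) ^ T := by positivity
        linarith

end Abstract

instance : IsProbabilityMeasure gaussTable := by unfold gaussTable; infer_instance

/-- The vector used in a round. -/
def tableRow (k : ℕ) (s : ℕ) (ω : ℕ × ℕ → ℝ) : Fin k → ℝ := fun i => ω (s, i)

theorem measurable_tableRow (k s : ℕ) : Measurable (tableRow k s) :=
  measurable_pi_iff.2 fun _ => measurable_pi_apply _

theorem map_tableRow (k s : ℕ) : gaussTable.map (tableRow k s) = gaussVec k := by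
  have h1 : iIndepFun (fun (p : ℕ × ℕ) (ω : ℕ × ℕ → ℝ) => ω p) gaussTable :=
    iIndepFun_infinitePi (X := fun _ x => x) fun _ => measurable_id
  have h2 : iIndepFun (fun (i : Fin k) (ω : ℕ × ℕ → ℝ) => ω (s, i)) gaussTable :=
    h1.precomp (g := fun i : Fin k => (s, (i : ℕ))) fun i j hij => by
      simpa [Fin.ext_iff] using hij
  have hm : ∀ i : Fin k, AEMeasurable (fun ω : ℕ × ℕ → ℝ => ω (s, (i : ℕ))) gaussTable := fun i =>
    (measurable_pi_apply (s, (i : ℕ))).aemeasurable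
  have h3 := (iIndepFun_iff_map_fun_eq_pi_map hm).1 h2
  have h4 : ∀ p : ℕ × ℕ, gaussTable.map (fun ω => ω p) = gaussianReal 0 1 := fun p =>
    Measure.infinitePi_map_eval (fun _ : ℕ × ℕ => gaussianReal 0 1) p
  simp only [h4] at h3
  exact h3

/-- Currying turns the table into a product of sequences, one for each round, and a row is a
function of its own sequence. -/
theorem iIndepFun_tableRow (k : ℕ) : iIndepFun (fun s => tableRow k s) gaussTable := by
  have hc : gaussTable.map (MeasurableEquiv.curry ℕ ℕ ℝ) =
      Measure.infinitePi fun _ : ℕ => Measure.infinitePi fun _ : ℕ => gaussianReal 0 1 :=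
    Measure.infinitePi_map_curry (fun _ _ : ℕ => gaussianReal 0 1)
  have hX : Measurable fun (x : ℕ → ℝ) (i : Fin k) => x i :=
    measurable_pi_iff.2 fun i => measurable_pi_apply _
  have h := iIndepFun_infinitePi (P := fun _ : ℕ => Measure.infinitePi fun _ : ℕ => gaussianReal 0 1)
    (X := fun _ (x : ℕ → ℝ) (i : Fin k) => x i) fun _ => hX
  rw [← hc, iIndepFun_iff_measure_inter_preimage_eq_mul] at h
  rw [iIndepFun_iff_measure_inter_preimage_eq_mul]
  intro S sets hs
  have := h S hs
  have hm : ∀ i, Measurable fun ω : ℕ → ℕ → ℝ => fun j : Fin k => ω i j := fun i =>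
    hX.comp (measurable_pi_apply i)
  rw [Measure.map_apply (MeasurableEquiv.measurable _)
    (Finset.measurableSet_biInter S fun i hi => hm i (hs i hi))] at this
  rw [Finset.prod_congr rfl fun i hi => Measure.map_apply (MeasurableEquiv.measurable _)
    (hm i (hs i hi))] at this
  simp only [Set.preimage_iInter] at this
  exact this

variable {n k : ℕ} {psi : Fin n → Fin k → ℝ} {mu : Fin n → ℝ} {dl e : ℝ}

/-- The vertex is in none of the sets of the sample. -/
def Misses (s : VSet n × VSet n × VSet n) (u : Fin n) : Prop :=
  s.1 u = false ∧ s.2.1 u = false ∧ s.2.2 u = false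

/-- The first sample that contains `u` contains it in a buffer. -/
def FirstBuffer (smp : ℕ → VSet n × VSet n × VSet n) (T : ℕ) (u : Fin n) : Prop :=
  ∃ s < T, (∀ j < s, Misses (smp j) u) ∧ ((smp s).2.1 u = true ∨ (smp s).2.2 u = true)

/-- Some sample separates `u` and `v` by a buffer, and no earlier one contains `u`. -/
def FirstSep (smp : ℕ → VSet n × VSet n × VSet n) (T : ℕ) (u v : Fin n) : Prop :=
  ∃ s < T, (∀ j < s, Misses (smp j) u) ∧ (SepFrom (smp s) u v ∨ SepFrom (smp s) v u)

/-- The samples drawn in the rounds. -/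
noncomputable def drawnRound (psi : Fin n → Fin k → ℝ) (mu : Fin n → ℝ) (dl e : ℝ)
    (ω : ℕ × ℕ → ℝ) (s : ℕ) : VSet n × VSet n × VSet n := drawn psi mu dl e (tableRow k s ω)

namespace IsSepData

theorem measurableSet_drawn (S : Set (VSet n × VSet n × VSet n)) :
    MeasurableSet {g : Fin k → ℝ | drawn psi mu dl e g ∈ S} :=
  measurable_drawn (Set.toFinite S).measurableSet

theorem measurable_drawnRound (s : ℕ) :
    Measurable fun ω => drawnRound psi mu dl e ω s :=
  measurable_drawn.comp (measurable_tableRow k s)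

theorem le_measure_hit (h : IsSepData psi mu dl e) {u : Fin n}
    (hu : ∑ i, psi u i * psi u i = 1) :
    ENNReal.ofReal (gaussianTail (sepThreshold dl k) / 2) ≤
      gaussVec k {g | Misses (drawn psi mu dl e g) u}ᶜ := by
  refine (h.le_measure_mem hu).trans (measure_mono fun g hg => ?_)
  simp only [Set.mem_ofPred_eq] at hg
  simp [Misses, hg]

/-- The number of rounds is made for this: `(1 - α / 2) ^ T ≤ exp (-α T / 2) ≤ dl`. -/
theorem measure_never_le (h : IsSepData psi mu dl e) {u : Fin n}
    (hu : ∑ i, psi u i * psi u i = 1) :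
    gaussTable {ω | ∀ j < sepRounds dl k, Misses (drawnRound psi mu dl e ω j) u} ≤
      ENNReal.ofReal dl := by
  have hA := gaussianTail_pos h.one_le_threshold
  have h1 := measure_forall_mem_le (measurable_tableRow k) (iIndepFun_tableRow k) (map_tableRow k)
    (measurableSet_drawn {s | Misses s u}) (by positivity) (h.le_measure_hit hu) (sepRounds dl k)
  refine h1.trans (ENNReal.ofReal_le_ofReal ?_)
  set α := gaussianTail (sepThreshold dl k) with hα
  have hT : 2 / α * Real.log (1 / dl) ≤ sepRounds dl k := Nat.le_ceil _
  have hle : 1 - α / 2 ≤ rexp (-(α / 2)) := by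
    have := Real.add_one_le_exp (-(α / 2)); linarith
  have hα1 : α ≤ 1 := by rw [hα, gaussianTail]; exact measureReal_le_one
  calc (1 - α / 2) ^ sepRounds dl k ≤ rexp (-(α / 2)) ^ sepRounds dl k :=
        pow_le_pow_left₀ (by linarith) hle _
    _ = rexp (-(α / 2 * sepRounds dl k)) := by rw [← Real.exp_nat_mul]; congr 1; ring
    _ ≤ rexp (Real.log dl) := by
        refine Real.exp_le_exp.2 ?_
        rw [one_div, Real.log_inv] at hT
        have : α / 2 * (2 / α * -Real.log dl) ≤ α / 2 * sepRounds dl k := by gcongr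
        have h2 : α / 2 * (2 / α * -Real.log dl) = -Real.log dl := by field_simp
        linarith
    _ = dl := Real.exp_log h.dl_pos

theorem measure_firstBuffer_le (h : IsSepData psi mu dl e) (u : Fin n) :
    gaussTable {ω | FirstBuffer (drawnRound psi mu dl e ω) (sepRounds dl k) u} ≤
      ENNReal.ofReal (2 * e) := by
  have hA := gaussianTail_pos h.one_le_threshold
  have he := h.e_pos
  rcases h.unit_or_zero u with hu | hu
  · have h1 := measure_exists_first_le (measurable_tableRow k) (iIndepFun_tableRow k)
      (map_tableRow k) (measurableSet_drawn {s | Misses s u})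
      (measurableSet_drawn {s | s.2.1 u = true ∨ s.2.2 u = true}) (by positivity)
      (h.le_measure_hit hu) (by positivity) (h.measure_buffers_le hu) (sepRounds dl k)
    refine h1.trans (ENNReal.ofReal_le_ofReal (le_of_eq ?_))
    field_simp
  -- A zero direction has projection 0, which lies below both strips because `t - 2 w` is positive.
  · have : {ω | FirstBuffer (drawnRound psi mu dl e ω) (sepRounds dl k) u} = ∅ := by
      ext ω
      have h1 := h.one_le_threshold
      have h2 := h.width_le
      simp only [FirstBuffer, drawnRound, drawn, sampleOf, Set.mem_ofPred_eq, decide_eq_true_eq,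
        proj_eq_zero hu, Set.mem_empty_iff_false, iff_false, not_exists, not_and]
      rintro s - - (⟨-, h3, -⟩ | ⟨-, h3, -⟩) <;> linarith
    rw [this]; simp

theorem measure_firstSep_le (h : IsSepData psi mu dl e) {u : Fin n}
    (hu : ∑ i, psi u i * psi u i = 1) (v : Fin n) :
    gaussTable {ω | FirstSep (drawnRound psi mu dl e ω) (sepRounds dl k) u v} ≤
      ENNReal.ofReal (80 * sepThreshold dl k ^ 2 / e * sqDist (psi u) (psi v)) := by
  have hA := gaussianTail_pos h.one_le_threshold
  have he := h.e_pos
  have hD := sqDist_nonneg (psi u) (psi v)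
  have h1 := measure_exists_first_le (measurable_tableRow k) (iIndepFun_tableRow k)
    (map_tableRow k) (measurableSet_drawn {s | Misses s u})
    (measurableSet_drawn {s | SepFrom s u v ∨ SepFrom s v u}) (by positivity)
    (h.le_measure_hit hu) (by positivity) (h.measure_sep_le u v) (sepRounds dl k)
  refine h1.trans (ENNReal.ofReal_le_ofReal (le_of_eq ?_))
  field_simp
  ring

end IsSepData

end Rounds

end BufferedCheeger

namespace BufferedCheeger

/-! ### Combinatorics of the crude partition -/

section Crude

variable {n : ℕ} (smp : ℕ → VSet n × VSet n × VSet n)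

/-- The crude part of a round. -/
def crudePart (t : ℕ) : VSet n := fun u => (smp t).1 u && !(crudeState smp t).Xi u

/-- The crude buffer of a round. -/
def crudeBuf (t : ℕ) : VSet n := fun u =>
  ((smp t).1 u || (smp t).2.1 u) && !((crudeState smp (t + 1)).Sig u || (crudeState smp t).Gam u)

theorem crudeState_parts (T : ℕ) : (crudeState smp T).parts =
    (List.range T).reverse.map fun t => (crudePart smp t, crudeBuf smp t) := by
  induction T with
  | zero => rfl
  | succ T ih =>
    rw [List.range_succ, List.reverse_append]
    simp only [List.reverse_singleton, List.singleton_append, List.map_cons, ← ih]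
    rfl

theorem crudeState_Xi (T : ℕ) (u : Fin n) :
    (crudeState smp T).Xi u = true ↔ ∃ t < T, ¬ Misses (smp t) u := by
  induction T with
  | zero => simp [crudeState]
  | succ T ih =>
    simp only [crudeState, crudeNext, Bool.or_eq_true, ih, Nat.lt_succ_iff_lt_or_eq, Misses]
    constructor
    · rintro (((⟨t, ht, h⟩ | h) | h) | h)
      · exact ⟨t, Or.inl ht, h⟩
      all_goals exact ⟨T, Or.inr rfl, by simp [h]⟩
    · rintro ⟨t, ht | rfl, h⟩
      · exact Or.inl (Or.inl (Or.inl ⟨t, ht, h⟩))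
      · by_contra hc
        simp only [not_or, Bool.not_eq_true] at hc
        exact h ⟨hc.1.1.2, hc.1.2, hc.2⟩

theorem crudeState_Sig (T : ℕ) (u : Fin n) :
    (crudeState smp T).Sig u = true ↔ ∃ t < T, crudePart smp t u = true := by
  induction T with
  | zero => simp [crudeState]
  | succ T ih =>
    have : (crudeState smp (T + 1)).Sig u = ((crudeState smp T).Sig u || crudePart smp T u) := rfl
    rw [this, Bool.or_eq_true, ih]
    simp only [Nat.lt_succ_iff_lt_or_eq, or_and_right, exists_or, exists_eq_left]

theorem crudeState_Gam (T : ℕ) (u : Fin n) :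
    (crudeState smp T).Gam u = true ↔ ∃ t < T, crudeBuf smp t u = true := by
  induction T with
  | zero => simp [crudeState]
  | succ T ih =>
    have : (crudeState smp (T + 1)).Gam u = ((crudeState smp T).Gam u || crudeBuf smp T u) := rfl
    rw [this, Bool.or_eq_true, ih]
    simp only [Nat.lt_succ_iff_lt_or_eq, or_and_right, exists_or, exists_eq_left]

variable {smp} {s t T : ℕ} {u v : Fin n}

/-- A vertex met earlier only by one of the sets `Y`, `Z` is barred as well; this is what makes the
first meeting with a sample decisive. -/
theorem crudePart_iff : crudePart smp t u = true ↔
    (smp t).1 u = true ∧ ∀ j < t, Misses (smp j) u := by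
  rw [crudePart, Bool.and_eq_true, Bool.not_eq_true', ← Bool.not_eq_true, crudeState_Xi]
  simp

/-- The ranges `j ≤ t` and `j < t` differ because in each round the union of the parts is updated
before the buffer is formed. Unlike a part, a buffer may contain vertices met by earlier samples. -/
theorem crudeBuf_iff : crudeBuf smp t u = true ↔
    ((smp t).1 u = true ∨ (smp t).2.1 u = true) ∧ (∀ j ≤ t, ¬ crudePart smp j u = true) ∧
      ∀ j < t, ¬ crudeBuf smp j u = true := by
  rw [crudeBuf, Bool.and_eq_true, Bool.not_eq_true', ← Bool.not_eq_true, Bool.or_eq_true,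
    Bool.or_eq_true, crudeState_Sig, crudeState_Gam]
  simp only [not_or, not_exists, not_and, Nat.lt_succ_iff]

theorem crudePart_unique (hs : crudePart smp s u = true) (ht : crudePart smp t u = true) :
    s = t := by
  rw [crudePart_iff] at hs ht
  rcases lt_trichotomy s t with h | h | h
  · have := (ht.2 s h).1; simp [hs.1] at this
  · exact h
  · have := (hs.2 t h).1; simp [ht.1] at this

theorem crudeBuf_unique (hs : crudeBuf smp s u = true) (ht : crudeBuf smp t u = true) :
    s = t := by
  rw [crudeBuf_iff] at hs ht
  rcases lt_trichotomy s t with h | h | h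
  · exact absurd (crudeBuf_iff.2 hs) (ht.2.2 s h)
  · exact h
  · exact absurd (crudeBuf_iff.2 ht) (hs.2.2 t h)

/-- A buffer avoids all parts up to its own round, and a vertex of a buffer has met that round's
sample, so it cannot enter a later part. -/
theorem crudePart_not_crudeBuf (hs : crudePart smp s u = true) : ¬ crudeBuf smp t u = true := by
  intro ht
  have hb := crudeBuf_iff.1 ht
  rcases le_or_gt s t with h | h
  · exact hb.2.1 s h hs
  · have := (crudePart_iff.1 hs).2 t h
    rcases hb.1 with h1 | h1
    · simp [this.1] at h1
    · simp [this.2.1] at h1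

/-- If `v` is outside `X ∪ Y` of round `t`, that round separates by its first buffer. Otherwise `v`
can fail to enter the crude buffer only because an earlier part or buffer took it. It then lies in
`X ∪ Y` of that earlier round `j`, whereas `u` is missed there, so round `j` separates `v` from `u`
by its second buffer. -/
theorem firstSep_of_crudePart (htT : t < T) (hu : crudePart smp t u = true)
    (hv : ¬ crudePart smp t v = true) (hv' : ¬ crudeBuf smp t v = true) :
    FirstSep smp T u v := by
  obtain ⟨hX, hm⟩ := crudePart_iff.1 hu
  by_cases hxy : (smp t).1 v = true ∨ (smp t).2.1 v = true
  · have : ∃ j < t, (smp j).1 v = true ∨ (smp j).2.1 v = true := by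
      rw [crudeBuf_iff] at hv'
      by_contra hc
      push Not at hc
      refine hv' ⟨hxy, fun j hj hp => ?_, fun j hj hb => ?_⟩
      · rcases hj.eq_or_lt with rfl | hj
        · exact hv hp
        · exact (hc j hj).1 (crudePart_iff.1 hp).1
      · rcases (crudeBuf_iff.1 hb).1 with h | h
        · exact (hc j hj).1 h
        · exact (hc j hj).2 h
    obtain ⟨j, hj, hjv⟩ := this
    exact ⟨j, hj.trans htT, fun i hi => hm i (hi.trans hj), Or.inr (Or.inr ⟨hjv, hm j hj⟩)⟩
  · rw [not_or, Bool.not_eq_true, Bool.not_eq_true] at hxy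
    exact ⟨t, htT, hm, Or.inl (Or.inl ⟨hX, hxy.1, hxy.2⟩)⟩

/-- Here `v` is kept: it lies in some part, or is never met. If its part belongs to an earlier round
`i`, then `u` is outside `X ∪ Y` of round `i`, as otherwise it would have been taken by then; the
first buffer of round `i` separates. In the other cases `v` is missed in round `t`, whose second
buffer separates. -/
theorem firstSep_of_crude (htT : t < T)
    (hu : crudePart smp t u = true ∨ crudeBuf smp t u = true)
    (hv : ¬ crudePart smp t v = true)
    (hv' : (∃ i < T, crudePart smp i v = true) ∨ ∀ j < T, Misses (smp j) v) :
    FirstSep smp T v u := by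
  have hxy : (smp t).1 u = true ∨ (smp t).2.1 u = true := by
    rcases hu with hu | hu
    · exact Or.inl (crudePart_iff.1 hu).1
    · exact (crudeBuf_iff.1 hu).1
  rcases hv' with ⟨i, hi, hp⟩ | hm
  · obtain ⟨hX, hm⟩ := crudePart_iff.1 hp
    rcases lt_trichotomy i t with h | h | h
    · have hui : (smp i).1 u = false ∧ (smp i).2.1 u = false := by
        rcases hu with hu | hu
        · have := (crudePart_iff.1 hu).2 i h
          exact ⟨this.1, this.2.1⟩
        · rw [← Bool.not_eq_true, ← Bool.not_eq_true, ← not_or]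
          intro hc
          have hb := crudeBuf_iff.1 hu
          exact hb.2.2 i h (crudeBuf_iff.2 ⟨hc, fun j hj => hb.2.1 j (hj.trans h.le),
            fun j hj => hb.2.2 j (hj.trans h)⟩)
      exact ⟨i, hi, hm, Or.inl (Or.inl ⟨hX, hui⟩)⟩
    · exact absurd (h ▸ hp) hv
    · exact ⟨t, htT, fun j hj => hm j (hj.trans h), Or.inr (Or.inr ⟨hxy, hm t h⟩)⟩
  · exact ⟨t, htT, fun j hj => hm j (hj.trans htT), Or.inr (Or.inr ⟨hxy, hm t htT⟩)⟩

/-- At the first meeting, membership in `X` would put the vertex into the crude part of that round.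
-/
theorem firstBuffer_of_not_crudePart (h : ∃ t < T, ¬ Misses (smp t) u)
    (hp : ¬ ∃ t < T, crudePart smp t u = true) : FirstBuffer smp T u := by
  classical
  have h' : ∃ t, t < T ∧ ¬ Misses (smp t) u := h
  obtain ⟨ht, hm⟩ := Nat.find_spec h'
  have hmin : ∀ j < Nat.find h', Misses (smp j) u := fun j hj => by
    have := Nat.find_min h' hj
    by_contra hc
    exact this ⟨hj.trans ht, hc⟩
  refine ⟨Nat.find h', ht, hmin, ?_⟩
  by_contra hc
  rw [not_or, Bool.not_eq_true, Bool.not_eq_true] at hc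
  have hX : (smp (Nat.find h')).1 u = true := by
    by_contra hx
    exact hm ⟨Bool.not_eq_true _ ▸ hx, hc⟩
  exact hp ⟨_, ht, crudePart_iff.2 ⟨hX, hmin⟩⟩

end Crude

end BufferedCheeger

namespace BufferedCheeger

/-! ### Integration over the radial threshold -/

section Radial

open MeasureTheory Real

/-- A nonnegative measurable function whose integral is at most `L`. -/
structure HasIntLe {Ω : Type*} [MeasurableSpace Ω] (P : Measure Ω) (f : Ω → ℝ) (L : ℝ) : Prop where
  measurable : Measurable f
  nonneg : ∀ r, 0 ≤ f r
  bound_nonneg : 0 ≤ L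
  lintegral_le : ∫⁻ r, ENNReal.ofReal (f r) ∂P ≤ ENNReal.ofReal L

/-- The Lebesgue measure on the positive numbers. -/
noncomputable def radial : Measure ℝ := volume.restrict (Set.Ioi 0)

namespace HasIntLe

variable {Ω : Type*} [MeasurableSpace Ω] {P : Measure Ω}

theorem const [IsProbabilityMeasure P] {c : ℝ} (hc : 0 ≤ c) : HasIntLe P (fun _ => c) c :=
  ⟨measurable_const, fun _ => hc, hc, by simp⟩

theorem zero : HasIntLe P (fun _ => 0) 0 := ⟨measurable_const, fun _ => le_rfl, le_rfl, by simp⟩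

theorem add {f g : Ω → ℝ} {a b : ℝ} (hf : HasIntLe P f a) (hg : HasIntLe P g b) :
    HasIntLe P (fun r => f r + g r) (a + b) where
  measurable := hf.measurable.add hg.measurable
  nonneg r := add_nonneg (hf.nonneg r) (hg.nonneg r)
  bound_nonneg := add_nonneg hf.bound_nonneg hg.bound_nonneg
  lintegral_le := by
    simp only [fun r => ENNReal.ofReal_add (hf.nonneg r) (hg.nonneg r)]
    rw [lintegral_add_left hf.measurable.ennreal_ofReal,
      ENNReal.ofReal_add hf.bound_nonneg hg.bound_nonneg]
    exact add_le_add hf.lintegral_le hg.lintegral_le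

theorem const_mul {f : Ω → ℝ} {a c : ℝ} (hf : HasIntLe P f a) (hc : 0 ≤ c) :
    HasIntLe P (fun r => c * f r) (c * a) where
  measurable := hf.measurable.const_mul c
  nonneg r := mul_nonneg hc (hf.nonneg r)
  bound_nonneg := mul_nonneg hc hf.bound_nonneg
  lintegral_le := by
    simp only [ENNReal.ofReal_mul hc]
    rw [lintegral_const_mul _ hf.measurable.ennreal_ofReal]
    gcongr
    exact hf.lintegral_le

theorem sum {ι : Type*} (s : Finset ι) {f : ι → Ω → ℝ} {a : ι → ℝ}
    (h : ∀ i, HasIntLe P (f i) (a i)) : HasIntLe P (fun r => ∑ i ∈ s, f i r) (∑ i ∈ s, a i) := by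
  classical
  induction s using Finset.induction_on with
  | empty => simpa using zero
  | insert i s hi ih =>
    simp only [Finset.sum_insert hi]
    exact (h i).add ih

theorem mono {f : Ω → ℝ} {a b : ℝ} (hf : HasIntLe P f a) (hab : a ≤ b) : HasIntLe P f b :=
  ⟨hf.measurable, hf.nonneg, hf.bound_nonneg.trans hab,
    hf.lintegral_le.trans (ENNReal.ofReal_le_ofReal hab)⟩

theorem ite_const {f : Ω → ℝ} {a : ℝ} {c : Prop} [Decidable c] (hf : HasIntLe P f a) :
    HasIntLe P (fun r => if c then f r else 0) (if c then a else 0) := by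
  split_ifs
  · exact hf
  · exact zero

/-- Markov's inequality. -/
theorem measure_lt_le {f : Ω → ℝ} {L : ℝ} (h : HasIntLe P f L) {c : ℝ} (hc : 0 < c) :
    P {ω | c * L < f ω} ≤ ENNReal.ofReal (1 / c) := by
  -- The bound 0 does occur, namely for the edge cost if `λ_k = 0`. Then the function vanishes
  -- almost everywhere, so the strict inequality is a null event.
  rcases h.bound_nonneg.eq_or_lt with h0 | hL
  · have h1 : ∫⁻ r, ENNReal.ofReal (f r) ∂P = 0 := by
      have := h.lintegral_le
      rw [← h0, ENNReal.ofReal_zero] at this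
      exact le_antisymm this bot_le
    rw [lintegral_eq_zero_iff h.measurable.ennreal_ofReal] at h1
    have h2 : P {ω | c * L < f ω} = 0 := by
      refine measure_mono_null (fun ω hω => ?_) (ae_iff.1 h1)
      simp only [Set.mem_ofPred_eq, ← h0, mul_zero] at hω
      simpa using hω
    rw [h2]
    exact bot_le
  · have hcL : 0 < c * L := mul_pos hc hL
    calc P {ω | c * L < f ω} ≤ P {ω | ENNReal.ofReal (c * L) ≤ ENNReal.ofReal (f ω)} :=
          measure_mono fun ω hω => ENNReal.ofReal_le_ofReal (le_of_lt hω)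
      _ ≤ (∫⁻ r, ENNReal.ofReal (f r) ∂P) / ENNReal.ofReal (c * L) :=
          meas_ge_le_lintegral_div h.measurable.ennreal_ofReal.aemeasurable (by simpa using hcL)
            ENNReal.ofReal_ne_top
      _ ≤ ENNReal.ofReal L / ENNReal.ofReal (c * L) := by
          gcongr
          exact h.lintegral_le
      _ = ENNReal.ofReal (1 / c) := by
          rw [← ENNReal.ofReal_div_of_pos hcL]
          congr 1
          field_simp

theorem ite_event {p : Ω → Prop} [DecidablePred p] (hp : MeasurableSet {ω | p ω}) {c L : ℝ}
    (hc : 0 ≤ c) (hL : 0 ≤ L) (h : ENNReal.ofReal c * P {ω | p ω} ≤ ENNReal.ofReal L) :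
    HasIntLe P (fun ω => if p ω then c else 0) L where
  measurable := Measurable.ite hp measurable_const measurable_const
  nonneg r := by
    split_ifs
    exacts [hc, le_rfl]
  bound_nonneg := hL
  lintegral_le := by
    have : ∀ ω, ENNReal.ofReal (if p ω then c else 0) =
        {ω | p ω}.indicator (fun _ => ENNReal.ofReal c) ω := fun ω => by
      by_cases hω : p ω <;> simp [hω]
    simp only [this]
    rw [lintegral_indicator_const hp]
    exact h

theorem radial_indicator {p : ℝ → Prop} [DecidablePred p] (hp : MeasurableSet {r | p r}) {a b L : ℝ}
    (hsub : ∀ r, 0 < r → p r → a ≤ r ∧ r ≤ b) (hL : b - a ≤ L) (hL0 : 0 ≤ L) :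
    HasIntLe radial (fun r => if p r then 1 else 0) L where
  measurable := Measurable.ite hp measurable_const measurable_const
  nonneg r := by split_ifs <;> norm_num
  bound_nonneg := hL0
  lintegral_le := by
    calc _ ≤ ∫⁻ r in Set.Ioi 0, (Set.Icc a b).indicator 1 r := by
          refine setLIntegral_mono (measurable_one.indicator measurableSet_Icc) fun r hr => ?_
          split_ifs with h
          · rw [Set.indicator_of_mem (show r ∈ Set.Icc a b from hsub r hr h)]; simp
          · simp
      _ ≤ ∫⁻ r, (Set.Icc a b).indicator 1 r := setLIntegral_le_lintegral _ _
      _ = ENNReal.ofReal (b - a) := by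
          rw [lintegral_indicator_one measurableSet_Icc, Real.volume_Icc]
      _ ≤ _ := ENNReal.ofReal_le_ofReal hL

end HasIntLe

variable {n d : ℕ}

/-- Layer-cake formula: each `u` is counted for the thresholds in `(0, mu u]`, hence with total
length `mu u`. -/
theorem sum_le_of_hasIntLe {mu : Fin n → ℝ} (hmu : ∀ u, 0 ≤ mu u) (p : Fin n → Bool) {f : ℝ → ℝ}
    {L : ℝ} (hf : HasIntLe radial f L)
    (h : ∀ r, 0 < r → (∑ u, if p u = true ∧ r ≤ mu u then (1 : ℝ) else 0) ≤ f r) :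
    (∑ u, if p u = true then mu u else 0) ≤ L := by
  have h1 : ∫⁻ r in Set.Ioi 0, ENNReal.ofReal (∑ u, if p u = true ∧ r ≤ mu u then (1 : ℝ) else 0) =
      ENNReal.ofReal (∑ u, if p u = true then mu u else 0) := by
    have h2 : ∀ r : ℝ, ENNReal.ofReal (∑ u, if p u = true ∧ r ≤ mu u then (1 : ℝ) else 0) =
        ∑ u, if p u = true then (Set.Iic (mu u)).indicator 1 r else 0 := fun r => by
      rw [ENNReal.ofReal_sum_of_nonneg fun u _ => by split_ifs <;> norm_num]
      refine Finset.sum_congr rfl fun u _ => ?_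
      by_cases hp : p u = true <;> by_cases hr : r ≤ mu u <;> simp [hp, hr]
    simp only [h2]
    rw [lintegral_finsetSum]
    · rw [ENNReal.ofReal_sum_of_nonneg fun u _ => by split_ifs; exacts [hmu u, le_rfl]]
      refine Finset.sum_congr rfl fun u _ => ?_
      split_ifs
      · rw [lintegral_indicator_one measurableSet_Iic, Measure.restrict_apply measurableSet_Iic,
          Set.Iic_inter_Ioi, Real.volume_Ioc, sub_zero]
      · simp
    · intro u _
      split_ifs
      · exact measurable_one.indicator measurableSet_Iic
      · exact measurable_const
  have h3 : ENNReal.ofReal (∑ u, if p u = true then mu u else 0) ≤ ENNReal.ofReal L := by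
    rw [← h1]
    refine le_trans (setLIntegral_mono hf.measurable.ennreal_ofReal fun r hr => ?_) hf.lintegral_le
    exact ENNReal.ofReal_le_ofReal (h r hr)
  exact (ENNReal.ofReal_le_ofReal_iff hf.bound_nonneg).1 h3

/-- Thresholds between the same breakpoints refine a crude pair in the same way. -/
theorem exists_mem_thresholds {mu : Fin n → ℝ} {e : ℝ} (he : 0 < e) (tP tB : VSet n) {r : ℝ}
    (hr : 0 < r) {u0 : Fin n} (hu0 : r ≤ mu u0) :
    ∃ r' ∈ thresholds mu e, 0 < r' ∧ refinePiece mu e tP tB r' = refinePiece mu e tP tB r := by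
  classical
  set l := (breakpoints mu e).toFinset with hl
  have h0 : (0 : ℝ) ∈ l := by
    rw [hl, List.mem_toFinset, mem_breakpoints]; exact Or.inl rfl
  have hu : mu u0 ∈ l := by
    rw [hl, List.mem_toFinset, mem_breakpoints]; exact Or.inr ⟨u0, Or.inl rfl⟩
  -- The breakpoints next to `r` on both sides; if `r` is a breakpoint, then `a = b = r`. Their mean
  -- lies on the same side of every breakpoint as `r`, and the sets of a piece depend only on these
  -- comparisons. The breakpoint 0 also keeps the mean positive.
  obtain ⟨a, ha, hmax⟩ := (l.filter (· ≤ r)).exists_max_image id ⟨0, by simp [h0, hr.le]⟩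
  obtain ⟨b, hb, hmin⟩ := (l.filter (r ≤ ·)).exists_min_image id ⟨mu u0, by simp [hu, hu0]⟩
  simp only [Finset.mem_filter, id_eq, and_imp] at ha hb hmax hmin
  have h1 : ∀ x ∈ l, (r ≤ x ↔ (a + b) / 2 ≤ x) := by
    intro x hx
    constructor
    · intro h
      have := hmin x hx h
      linarith [ha.2]
    · intro h
      by_contra hc
      have := hmax x hx (not_le.1 hc).le
      linarith [ha.2, hb.2, not_le.1 hc]
  have h2 : ∀ x ∈ l, (x ≤ r ↔ x ≤ (a + b) / 2) := by
    intro x hx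
    constructor
    · intro h
      have := hmax x hx h
      linarith [hb.2, ha.2]
    · intro h
      by_contra hc
      have := hmin x hx (not_le.1 hc).le
      linarith [ha.2, hb.2, not_le.1 hc]
  have hb1 : ∀ u, mu u ∈ l := fun u => by
    rw [hl, List.mem_toFinset, mem_breakpoints]; exact Or.inr ⟨u, Or.inl rfl⟩
  have hb2 : ∀ u, (1 + e) * mu u ∈ l := fun u => by
    rw [hl, List.mem_toFinset, mem_breakpoints]; exact Or.inr ⟨u, Or.inr (Or.inl rfl)⟩
  have hb3 : ∀ u, (1 + e) * ((1 + e) * mu u) ∈ l := fun u => by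
    rw [hl, List.mem_toFinset, mem_breakpoints]; exact Or.inr ⟨u, Or.inr (Or.inr rfl)⟩
  refine ⟨(a + b) / 2, (mem_thresholds _ _ _).2 ⟨a, List.mem_toFinset.1 ha.1, b,
    List.mem_toFinset.1 hb.1, rfl⟩, not_le.1 fun hc => absurd ((h1 0 h0).2 hc) (not_le.2 hr), ?_⟩
  have hq : 0 < 1 + e := by linarith
  have e1 : ∀ u, ((a + b) / 2 ≤ mu u ↔ r ≤ mu u) := fun u => (h1 _ (hb1 u)).symm
  have e2 : ∀ u, ((a + b) / 2 / (1 + e) ≤ mu u ↔ r / (1 + e) ≤ mu u) := fun u => by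
    rw [div_le_iff₀' hq, div_le_iff₀' hq]; exact (h1 _ (hb2 u)).symm
  have e3 : ∀ u, (mu u ≤ (a + b) / 2 / (1 + e) / (1 + e) ↔ mu u ≤ r / (1 + e) / (1 + e)) :=
    fun u => by
      rw [le_div_iff₀' hq, le_div_iff₀' hq, le_div_iff₀' hq, le_div_iff₀' hq]
      exact (h2 _ (hb3 u)).symm
  simp only [refinePiece, e1, e2, e3]

/-- The cost of a crude pair: it bounds the integrals of the edge counts of the constraints. -/
noncomputable def partCost (G : RegularGraph n d) (mu : Fin n → ℝ) (e : ℝ)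
    (D : Fin n → Fin n → ℝ) (W tP tB : VSet n) : ℝ :=
  ∑ u, ∑ v, (G.mult u v : ℝ) * ((if tP u = true then (2 + e) * D u v else 0) +
    (if tP u = true ∧ tP v = false ∧ tB v = false then mu u else 0) +
    (if (tP u = true ∨ tB u = true) ∧ W v = true ∧ tP v = false then (1 + e) * mu u else 0))

theorem cut_eq_sum (G : RegularGraph n d) (S T : Finset (Fin n)) :
    (G.cut S T : ℝ) = ∑ u, ∑ v, (G.mult u v : ℝ) * (if u ∈ S ∧ v ∈ T then 1 else 0) := by
  have : ∀ u v, (G.mult u v : ℝ) * (if u ∈ S ∧ v ∈ T then 1 else 0) =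
      if u ∈ S then (if v ∈ T then (G.mult u v : ℝ) else 0) else 0 := fun u v => by
    by_cases h1 : u ∈ S <;> by_cases h2 : v ∈ T <;> simp [h1, h2]
  simp only [this, RegularGraph.cut]
  push_cast
  rw [← Finset.sum_subset (Finset.subset_univ S) fun u _ hu => by simp [hu]]
  refine Finset.sum_congr rfl fun u hu => ?_
  rw [← Finset.sum_subset (Finset.subset_univ T) fun v _ hv => by simp [hv]]
  refine Finset.sum_congr rfl fun v hv => ?_
  simp [hu, hv]

theorem card_eq_sum (S : Finset (Fin n)) :
    (S.card : ℝ) = ∑ u, if u ∈ S then (1 : ℝ) else 0 := by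
  simp

/-- If a crude pair has a small buffer and a small cost, then some threshold is feasible and gives
a small buffered expansion. -/
theorem exists_threshold (G : RegularGraph n d) (hd : 0 < d) {mu : Fin n → ℝ}
    (hmu : ∀ u, 0 ≤ mu u) {e b1 b2 kap x : ℝ} (he : 0 < e) (hb1 : 0 < b1) (hb2 : 0 < b2)
    (hx0 : 0 ≤ x)
    (hx : ∀ p c : ℕ, 1 ≤ p → p ≤ n → kap * ((d : ℝ) * p) < c → (p : ℝ) ≤ x * c)
    {D : Fin n → Fin n → ℝ} (hD0 : ∀ u v, 0 ≤ D u v) (hDs : ∀ u v, D u v = D v u)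
    (hD : ∀ u v, mu u - (1 + e) * mu v ≤ D u v) (W tP tB : VSet n)
    (hlt : 1 / b1 * (e * (∑ u, if tP u = true then mu u else 0) +
        (1 + e) * (∑ u, if tB u = true then mu u else 0)) +
      1 / b2 * ((1 + e) * e * ∑ u, if tP u = true then mu u else 0) +
      x * partCost G mu e D W tP tB < ∑ u, if tP u = true then mu u else 0) :
    ∃ r ∈ thresholds mu e, 0 < r ∧ Feasible G b1 b2 kap W tP (refinePiece mu e tP tB r) ∧
      G.expansion (refinePiece mu e tP tB r).P.toFinset
        (refinePiece mu e tP tB r).B.toFinset ≤ kap := by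
  classical
  have hq : 0 < 1 + e := by linarith
  suffices h : ∃ r, 0 < r ∧ Feasible G b1 b2 kap W tP (refinePiece mu e tP tB r) ∧
      G.expansion (refinePiece mu e tP tB r).P.toFinset
        (refinePiece mu e tP tB r).B.toFinset ≤ kap by
    obtain ⟨r, hr, hf, hk⟩ := h
    have : (refinePiece mu e tP tB r).P.toFinset.Nonempty := by
      rw [← Finset.card_pos]
      exact_mod_cast lt_of_lt_of_le one_pos hf.1
    obtain ⟨u0, hu0⟩ := this
    have hu0' : r ≤ mu u0 := by
      simp only [mem_toFinset, refinePiece, Bool.and_eq_true, decide_eq_true_eq] at hu0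
      exact hu0.2
    obtain ⟨r', h1, h2, h3⟩ := exists_mem_thresholds he tP tB hr hu0'
    exact ⟨r', h1, h2, by rw [h3]; exact hf, by rw [h3]; exact hk⟩
  -- If no threshold works, every `r > 0` satisfies `|P_r| ≤ fB r / b1 + fA r / b2 + x * fC r` for
  -- the functions below. Integration over `r` contradicts `hlt`.
  by_contra hcon
  push Not at hcon
  set fB : ℝ → ℝ := fun r => ∑ u, ((if tB u = true then
      (if r ≤ (1 + e) * mu u then (1 : ℝ) else 0) else 0) +
    (if tP u = true then (if mu u < r ∧ r ≤ (1 + e) * mu u then (1 : ℝ) else 0) else 0)) with hfB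
  set fA : ℝ → ℝ := fun r => ∑ u, if tP u = true then
      (if (1 + e) * mu u < r ∧ r ≤ (1 + e) * ((1 + e) * mu u) then (1 : ℝ) else 0) else 0 with hfA
  -- The summands stand for edges from `A'` to `P ∪ B`, from `P` to a crude vertex below the band,
  -- from `P` to a vertex outside the crude pair, and from `P ∪ B` to a kept vertex outside the
  -- crude part. The first two are open on intervals of lengths at most `(1 + e) * D v u` and `D u
  -- v`, whence the coefficient `2 + e` in `partCost`.
  set fC : ℝ → ℝ := fun r => ∑ u, ∑ v, (G.mult u v : ℝ) * ((if tP u = true then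
      (if (1 + e) * ((1 + e) * mu u) ≤ r ∧ r ≤ (1 + e) * mu v then (1 : ℝ) else 0) else 0) +
    (if tP u = true then (if (1 + e) * mu v < r ∧ r ≤ mu u then (1 : ℝ) else 0) else 0) +
    (if tP u = true ∧ tP v = false ∧ tB v = false then
      (if r ≤ mu u then (1 : ℝ) else 0) else 0) +
    (if (tP u = true ∨ tB u = true) ∧ W v = true ∧ tP v = false then
      (if r ≤ (1 + e) * mu u then (1 : ℝ) else 0) else 0)) with hfC
  have iB : HasIntLe radial fB (e * (∑ u, if tP u = true then mu u else 0) +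
        (1 + e) * (∑ u, if tB u = true then mu u else 0)) := by
    refine (HasIntLe.sum _ fun u => ((HasIntLe.radial_indicator (a := 0) (b := (1 + e) * mu u)
      measurableSet_Iic (fun r hr h => ⟨hr.le, h⟩) (L := (1 + e) * mu u) (by linarith)
      (mul_nonneg hq.le (hmu u))).ite_const (c := tB u = true)).add
      ((HasIntLe.radial_indicator (a := mu u) (b := (1 + e) * mu u)
      measurableSet_Ioc (fun r hr h => ⟨h.1.le, h.2⟩) (L := e * mu u) (by linarith)
      (mul_nonneg he.le (hmu u))).ite_const (c := tP u = true))).mono ?_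
    rw [Finset.mul_sum, Finset.mul_sum, ← Finset.sum_add_distrib]
    refine Finset.sum_le_sum fun u _ => ?_
    split_ifs <;> linarith
  have iA : HasIntLe radial fA ((1 + e) * e * ∑ u, if tP u = true then mu u else 0) := by
    refine (HasIntLe.sum _ fun u => (HasIntLe.radial_indicator (a := (1 + e) * mu u)
      (b := (1 + e) * ((1 + e) * mu u))
      measurableSet_Ioc (fun r hr h => ⟨h.1.le, h.2⟩) (L := (1 + e) * e * mu u) (by linarith)
      (by have := hmu u; positivity)).ite_const (c := tP u = true)).mono ?_
    rw [Finset.mul_sum]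
    refine Finset.sum_le_sum fun u _ => ?_
    split_ifs <;> linarith
  have iC : HasIntLe radial fC (partCost G mu e D W tP tB) := by
    refine (HasIntLe.sum _ fun u => HasIntLe.sum _ fun v => HasIntLe.const_mul
      (((((HasIntLe.radial_indicator (a := (1 + e) * ((1 + e) * mu u)) (b := (1 + e) * mu v)
      measurableSet_Icc (fun r hr h => ⟨h.1, h.2⟩) (L := (1 + e) * D v u) ?_ ?_).ite_const
        (c := tP u = true)).add
      ((HasIntLe.radial_indicator (a := (1 + e) * mu v) (b := mu u)
      measurableSet_Ioc (fun r hr h => ⟨h.1.le, h.2⟩) (L := D u v) (hD u v) (hD0 u v)).ite_const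
        (c := tP u = true))).add
      ((HasIntLe.radial_indicator (a := 0) (b := mu u)
      measurableSet_Iic (fun r hr h => ⟨hr.le, h⟩) (L := mu u) (by linarith)
        (hmu u)).ite_const (c := tP u = true ∧ tP v = false ∧ tB v = false))).add
      ((HasIntLe.radial_indicator (a := 0) (b := (1 + e) * mu u)
      measurableSet_Iic (fun r hr h => ⟨hr.le, h⟩) (L := (1 + e) * mu u) (by linarith)
        (mul_nonneg hq.le (hmu u))).ite_const
        (c := (tP u = true ∨ tB u = true) ∧ W v = true ∧ tP v = false)))
        (Nat.cast_nonneg (G.mult u v))).mono ?_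
    · rw [← mul_sub]; exact mul_le_mul_of_nonneg_left (hD v u) hq.le
    · exact mul_nonneg hq.le (hD0 v u)
    · refine Finset.sum_le_sum fun u _ => Finset.sum_le_sum fun v _ => ?_
      refine mul_le_mul_of_nonneg_left (le_of_eq ?_) (Nat.cast_nonneg _)
      rw [hDs v u]
      congr 2
      split_ifs <;> ring
  have key := sum_le_of_hasIntLe hmu tP (((iB.const_mul (one_div_pos.2 hb1).le).add
    (iA.const_mul (one_div_pos.2 hb2).le)).add (iC.const_mul hx0)) fun r hr => ?_
  · linarith
  set p := refinePiece mu e tP tB r with hp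
  have mP : ∀ u, u ∈ p.P.toFinset ↔ tP u = true ∧ r ≤ mu u := fun u => by
    simp [hp, refinePiece]
  have mB : ∀ u, u ∈ p.B.toFinset ↔ (tB u = true ∧ r ≤ (1 + e) * mu u) ∨
      (tP u = true ∧ mu u < r ∧ r ≤ (1 + e) * mu u) := fun u => by
    simp only [hp, refinePiece, mem_toFinset, Bool.or_eq_true, Bool.and_eq_true,
      decide_eq_true_eq, Bool.not_eq_true', decide_eq_false_iff_not, not_le, div_le_iff₀' hq]
    tauto
  have mA' : ∀ u, u ∈ p.A'.toFinset ↔ tP u = true ∧ (1 + e) * ((1 + e) * mu u) ≤ r := fun u => by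
    simp only [hp, refinePiece, mem_toFinset, Bool.and_eq_true, decide_eq_true_eq,
      le_div_iff₀' hq]
  have mA : ∀ u, u ∈ p.A''.toFinset ↔ tP u = true ∧ (1 + e) * mu u < r ∧
      r < (1 + e) * ((1 + e) * mu u) := fun u => by
    simp only [hp, refinePiece, mem_toFinset, Bool.and_eq_true,
      le_div_iff₀' hq, div_le_iff₀' hq, Bool.not_eq_true', decide_eq_false_iff_not, not_le]
    tauto
  have cP : (∑ u, if tP u = true ∧ r ≤ mu u then (1 : ℝ) else 0) = p.P.toFinset.card := by
    rw [card_eq_sum]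
    simp only [mP]
  have cB : (p.B.toFinset.card : ℝ) ≤ fB r := by
    rw [card_eq_sum]
    refine Finset.sum_le_sum fun u _ => ?_
    simp only [mB]
    split_ifs <;> first | (norm_num; done) | (exfalso; tauto)
  have cA : (p.A''.toFinset.card : ℝ) ≤ fA r := by
    rw [card_eq_sum]
    refine Finset.sum_le_sum fun u _ => ?_
    simp only [mA]
    split_ifs with h1 <;> first | (norm_num; done) | (have := h1.2.2.le; exfalso; tauto)
  have c1 : (G.cut p.A'.toFinset (p.P.toFinset ∪ p.B.toFinset) : ℝ) ≤ fC r := by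
    rw [cut_eq_sum]
    refine Finset.sum_le_sum fun u _ => Finset.sum_le_sum fun v _ =>
      mul_le_mul_of_nonneg_left ?_ (Nat.cast_nonneg _)
    refine le_trans ?_ (le_add_of_nonneg_right (by split_ifs <;> norm_num))
    refine le_trans ?_ (le_add_of_nonneg_right (by split_ifs <;> norm_num))
    refine le_trans ?_ (le_add_of_nonneg_right (by split_ifs <;> norm_num))
    split_ifs with h1 h2 h3 <;> try norm_num
    · rw [mA', Finset.mem_union, mP, mB] at h1
      refine h3 ⟨h1.1.2, ?_⟩
      have := hmu v
      rcases h1.2 with h | h | h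
      · nlinarith [h.2]
      · exact h.2
      · exact h.2.2
    · rw [mA'] at h1; exact h2 h1.1.1
  have c2 : (G.cut (p.P.toFinset ∪ p.B.toFinset) (W.toFinset \ tP.toFinset) : ℝ) ≤ fC r := by
    rw [cut_eq_sum]
    refine Finset.sum_le_sum fun u _ => Finset.sum_le_sum fun v _ =>
      mul_le_mul_of_nonneg_left ?_ (Nat.cast_nonneg _)
    refine le_trans ?_ (le_add_of_nonneg_left (add_nonneg (add_nonneg ?_ ?_) ?_))
    rotate_left
    · split_ifs <;> norm_num
    · split_ifs <;> norm_num
    · split_ifs <;> norm_num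
    simp only [Finset.mem_sdiff, Finset.mem_union, mP, mB, mem_toFinset, Bool.not_eq_true]
    split_ifs with h1 h2 h3 <;> try norm_num
    · refine h3 ?_
      have := hmu u
      rcases h1.1 with h | h | h
      · nlinarith [h.2]
      · exact h.2
      · exact h.2.2
    · refine h2 ⟨?_, h1.2⟩
      tauto
  have c3 : (G.cut p.P.toFinset (Finset.univ \ (p.P.toFinset ∪ p.B.toFinset)) : ℝ) ≤ fC r := by
    rw [cut_eq_sum]
    refine Finset.sum_le_sum fun u _ => Finset.sum_le_sum fun v _ =>
      mul_le_mul_of_nonneg_left ?_ (Nat.cast_nonneg _)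
    refine le_trans ?_ (le_add_of_nonneg_right (by split_ifs <;> norm_num))
    have n1 : (0 : ℝ) ≤ if tP u = true then
      (if (1 + e) * ((1 + e) * mu u) ≤ r ∧ r ≤ (1 + e) * mu v then (1 : ℝ) else 0) else 0 := by
      split_ifs <;> norm_num
    rw [add_assoc]
    refine le_trans ?_ (le_add_of_nonneg_left n1)
    simp only [Finset.mem_sdiff, Finset.mem_univ, true_and, Finset.mem_union, mP, mB]
    by_cases h1 : tP u = true ∧ r ≤ mu u
    swap
    · rw [if_neg (fun h => h1 h.1)]
      refine add_nonneg ?_ ?_ <;> split_ifs <;> norm_num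
    · simp only [h1.1, h1.2, true_and, and_true, if_true]
      by_cases h2 : tP v = false ∧ tB v = false
      · rw [if_pos h2]
        split_ifs <;> norm_num
      · rw [if_neg h2]
        rw [add_zero]
        by_cases h4 : (1 + e) * mu v < r
        · rw [if_pos h4]
          split_ifs <;> norm_num
        · rw [if_neg h4, if_neg]
          refine fun h3 => h3 ?_
          by_cases h6 : tP v = true
          · by_cases h7 : r ≤ mu v
            · exact Or.inl ⟨h6, h7⟩
            · exact Or.inr (Or.inr ⟨h6, not_le.1 h7, not_lt.1 h4⟩)
          · refine Or.inr (Or.inl ⟨?_, not_lt.1 h4⟩)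
            simp only [Bool.not_eq_true] at h6
            simpa [h6] using h2
  have fB0 := iB.nonneg r
  have fA0 := iA.nonneg r
  have fC0 := mul_nonneg hx0 (iC.nonneg r)
  have fB1 := mul_nonneg (one_div_pos.2 hb1).le fB0
  have fA1 := mul_nonneg (one_div_pos.2 hb2).le fA0
  have hpn : p.P.toFinset.card ≤ n := by
    simpa using Finset.card_le_univ p.P.toFinset
  rw [cP]
  -- An empty `P` is harmless, as the bound to be shown is then trivial. Otherwise one of the
  -- constraints fails or the expansion exceeds `kap`, and one term of the bound alone is at least
  -- `|P|`.
  by_cases hz : 1 ≤ p.P.toFinset.card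
  swap
  · have : p.P.toFinset.card = 0 := by omega
    rw [this]; push_cast; linarith
  by_cases hf : Feasible G b1 b2 kap W tP p
  · have h := hcon r hr hf
    have hpos : (0 : ℝ) < (d : ℝ) * p.P.toFinset.card := by
      have : (0 : ℝ) < p.P.toFinset.card := by exact_mod_cast hz
      have : (0 : ℝ) < d := by exact_mod_cast hd
      positivity
    rw [RegularGraph.expansion, lt_div_iff₀ hpos] at h
    have := (hx _ _ hz hpn h).trans (mul_le_mul_of_nonneg_left c3 hx0)
    linarith
  · have hz' : (1 : ℝ) ≤ p.P.toFinset.card := by exact_mod_cast hz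
    simp only [Feasible, hz', true_and, not_and_or, not_le] at hf
    rcases hf with h | h | h | h
    · have : (p.P.toFinset.card : ℝ) ≤ 1 / b1 * fB r := by
        rw [one_div_mul_eq_div, le_div_iff₀' hb1]; linarith
      linarith
    · have : (p.P.toFinset.card : ℝ) ≤ 1 / b2 * fA r := by
        rw [one_div_mul_eq_div, le_div_iff₀' hb2]; linarith
      linarith
    · have := (hx _ _ hz hpn h).trans (mul_le_mul_of_nonneg_left c1 hx0)
      linarith
    · have := (hx _ _ hz hpn h).trans (mul_le_mul_of_nonneg_left c2 hx0)
      linarith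

end Radial

end BufferedCheeger

namespace BufferedCheeger

/-! ### Deterministic properties of the output -/

section OutputProperties

variable {n d : ℕ}

/-- Translates positions in the output list into round numbers; injectivity lets disjointness of the
crude pairs of different rounds pass to different pieces. -/
theorem exists_index {β : Type*} {l : List β} {l' : List ℕ} {g : ℕ → β} (h : l = l'.map g)
    (hn : l'.Nodup) : ∃ τ : Fin l.length → ℕ, Function.Injective τ ∧
      (∀ i, l.get i = g (τ i)) ∧ ∀ t, t ∈ l' ↔ ∃ i, τ i = t := by
  subst h
  refine ⟨fun i => l'.get (i.cast (by simp)), fun i j hij => ?_, fun i => by simp, fun t => ?_⟩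
  · have := List.nodup_iff_injective_get.1 hn hij
    simpa [Fin.ext_iff] using this
  · rw [List.mem_iff_get]
    constructor
    · rintro ⟨i, rfl⟩
      exact ⟨i.cast (by simp), rfl⟩
    · rintro ⟨i, rfl⟩
      exact ⟨i.cast (by simp), rfl⟩

/-- The crude pairs are processed independently of each other, so the result of the fold is
explicit. The default value 0 is never used, since only rounds with a chosen threshold pass the
filter. -/
theorem foldl_refineOutput (G : RegularGraph n d) (mu : Fin n → ℝ) (e b1 b2 kap : ℝ) (W : VSet n)
    (f : ℕ → VSet n × VSet n) (l : List ℕ) (o : Output n) :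
    ((l.map f).foldl (refineOutput G mu e b1 b2 kap W) o).pieces =
      ((l.filter fun t => (chosenThreshold G mu e b1 b2 kap W (f t)).isSome).reverse.map fun t =>
        refinePiece mu e (f t).1 (f t).2 ((chosenThreshold G mu e b1 b2 kap W (f t)).getD 0)) ++
      o.pieces ∧
    (∀ u, ((l.map f).foldl (refineOutput G mu e b1 b2 kap W) o).RP u = true ↔ o.RP u = true ∨
      ∃ t ∈ l, chosenThreshold G mu e b1 b2 kap W (f t) = none ∧ (f t).1 u = true) ∧
    (∀ u, ((l.map f).foldl (refineOutput G mu e b1 b2 kap W) o).RB u = true ↔ o.RB u = true ∨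
      ∃ t ∈ l, (f t).2 u = true ∧ ∀ r, chosenThreshold G mu e b1 b2 kap W (f t) = some r →
        ¬ (refinePiece mu e (f t).1 (f t).2 r).B u = true) := by
  induction l generalizing o with
  | nil => simp
  | cons a l ih =>
    obtain ⟨h1, h2, h3⟩ := ih (refineOutput G mu e b1 b2 kap W o (f a))
    simp only [List.map_cons, List.foldl_cons, h1, h2, h3]
    rcases hc : chosenThreshold G mu e b1 b2 kap W (f a) with _ | r
    · refine ⟨?_, fun u => ?_, fun u => ?_⟩
      · simp [refineOutput, hc]
      · simp [refineOutput, hc, or_assoc]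
      · simp [refineOutput, hc, or_assoc]
    · refine ⟨?_, fun u => ?_, fun u => ?_⟩
      · simp [refineOutput, hc]
      · simp [refineOutput, hc]
      · simp [refineOutput, hc, or_assoc]

theorem cut_comm (G : RegularGraph n d) (S T : Finset (Fin n)) : G.cut S T = G.cut T S := by
  rw [RegularGraph.cut, RegularGraph.cut, Finset.sum_comm]
  simp only [G.symm]

theorem sum_cut_add_cut_le (G : RegularGraph n d) {ι : Type*} (s : Finset ι)
    (A : ι → Finset (Fin n)) (S T U : Finset (Fin n))
    (hA : ∀ i ∈ s, ∀ j ∈ s, i ≠ j → Disjoint (A i) (A j)) (hS : ∀ i ∈ s, Disjoint (A i) S)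
    (hAU : ∀ i ∈ s, A i ⊆ U) (hSU : S ⊆ U) :
    ∑ i ∈ s, G.cut (A i) T + G.cut S T ≤ G.cut U T := by
  classical
  simp only [RegularGraph.cut]
  rw [← Finset.sum_biUnion hA, ← Finset.sum_union]
  · refine Finset.sum_le_sum_of_subset (Finset.union_subset ?_ hSU)
    exact Finset.biUnion_subset.2 hAU
  · exact (Finset.disjoint_biUnion_left _ _ _).2 hS

/-- The vertices which are covered by the samples, but do not belong to a crude part. -/
noncomputable def bufferSet (smp : ℕ → VSet n × VSet n × VSet n) (T : ℕ) : Finset (Fin n) := by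
  classical
  exact Finset.univ.filter fun u => (∃ t < T, ¬ Misses (smp t) u) ∧
    ¬ ∃ t < T, crudePart smp t u = true

theorem mem_bufferSet {smp : ℕ → VSet n × VSet n × VSet n} {T : ℕ} {u : Fin n} :
    u ∈ bufferSet smp T ↔ (∃ t < T, ¬ Misses (smp t) u) ∧
      ¬ ∃ t < T, crudePart smp t u = true := by
  classical
  simp [bufferSet]

/-- The vertices outside the crude buffers and the sets `Y`, `Z`. -/
noncomputable def keptSet (smp : ℕ → VSet n × VSet n × VSet n) (T : ℕ) : VSet n := fun u =>
  (crudeState smp T).Sig u || !(crudeState smp T).Xi u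

theorem keptSet_iff {smp : ℕ → VSet n × VSet n × VSet n} {T : ℕ} {u : Fin n} :
    keptSet smp T u = true ↔ (∃ t < T, crudePart smp t u = true) ∨
      ∀ t < T, Misses (smp t) u := by
  rw [keptSet, Bool.or_eq_true, Bool.not_eq_true', ← Bool.not_eq_true, crudeState_Sig,
    crudeState_Xi]
  simp

theorem not_misses_of_crudePart {smp : ℕ → VSet n × VSet n × VSet n} {t : ℕ} {u : Fin n}
    (h : crudePart smp t u = true) : ¬ Misses (smp t) u := fun hm => by
  have := (crudePart_iff.1 h).1
  simp [hm.1] at this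

theorem not_misses_of_crudeBuf {smp : ℕ → VSet n × VSet n × VSet n} {t : ℕ} {u : Fin n}
    (h : crudeBuf smp t u = true) : ¬ Misses (smp t) u := fun hm => by
  rcases (crudeBuf_iff.1 h).1 with h | h
  · simp [hm.1] at h
  · simp [hm.2.1] at h

/-- The output of the algorithm is good if enough crude pairs are refined and few vertices
are left over. -/
theorem isGood_finalOutput (G : RegularGraph n d) (mu : Fin n → ℝ) {e : ℝ} (he : 0 < e)
    (smp : ℕ → VSet n × VSet n × VSet n) (T k : ℕ) (ε δ b c : ℝ)
    (hcount : (1 - 2 * δ) * (k : ℝ) ≤ (((Finset.range T).filter fun t =>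
      (chosenThreshold G mu e (b * ε) (10 * ε) (c / ε * G.lam k * Real.log k) (keptSet smp T)
        (crudePart smp t, crudeBuf smp t)).isSome).card : ℝ))
    (hleft : ((bufferSet smp T).card : ℝ) ≤ 16 * ε * n) :
    (finalOutput G mu e (b * ε) (10 * ε) (c / ε * G.lam k * Real.log k)
      (crudeState smp T)).IsGood G k ε δ b c := by
  classical
  set kap := c / ε * G.lam k * Real.log k with hkap
  set W := keptSet smp T with hW
  set thr : ℕ → Option ℝ := fun t => chosenThreshold G mu e (b * ε) (10 * ε) kap W
        (crudePart smp t, crudeBuf smp t) with hthr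
  set o := finalOutput G mu e (b * ε) (10 * ε) kap (crudeState smp T) with ho
  set g : ℕ → Piece n := fun t =>
    refinePiece mu e (crudePart smp t) (crudeBuf smp t) ((thr t).getD 0) with hg
  obtain ⟨h1, h2, h3⟩ := foldl_refineOutput G mu e (b * ε) (10 * ε) kap W
    (fun t => (crudePart smp t, crudeBuf smp t)) (List.range T).reverse
    { pieces := [], RP := fun u => !(crudeState smp T).Xi u,
      RB := fun u => !((crudeState smp T).Sig u || (crudeState smp T).Gam u ||
        !(crudeState smp T).Xi u) }
  rw [← crudeState_parts] at h1 h2 h3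
  change o.pieces = _ at h1
  change ∀ u, o.RP u = true ↔ _ at h2
  change ∀ u, o.RB u = true ↔ _ at h3
  rw [List.append_nil, List.filter_reverse, List.reverse_reverse] at h1
  change o.pieces = ((List.range T).filter fun t => (thr t).isSome).map g at h1
  obtain ⟨τ, hinj, hget, hmem⟩ := exists_index h1 (List.nodup_range.filter _)
  have hlen : (o.pieces.length : ℝ) = ((Finset.range T).filter fun t => (thr t).isSome).card := by
    rw [h1, List.length_map, ← List.toFinset_card_of_nodup (List.nodup_range.filter _)]
    congr 2
    ext t
    simp
  simp only [List.mem_filter, List.mem_range] at hmem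
  have hτ : ∀ i, τ i < T ∧ ∃ r, thr (τ i) = some r ∧ g (τ i) =
      refinePiece mu e (crudePart smp (τ i)) (crudeBuf smp (τ i)) r ∧ 0 < r ∧
      Feasible G (b * ε) (10 * ε) kap W (crudePart smp (τ i)) (g (τ i)) ∧
      G.expansion (g (τ i)).P.toFinset (g (τ i)).B.toFinset ≤ kap := fun i => by
    obtain ⟨ha, hb⟩ := (hmem (τ i)).2 ⟨i, rfl⟩
    obtain ⟨r, hr⟩ := Option.isSome_iff_exists.1 hb
    have h4 := bestThreshold_eq_some hr
    have h5 : g (τ i) = refinePiece mu e (crudePart smp (τ i)) (crudeBuf smp (τ i)) r := by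
      simp only [hg, hr, Option.getD_some]
    exact ⟨ha, r, hr, h5, h4.2.1, by rw [h5]; exact h4.1, by rw [h5]; exact h4.2.2⟩
  have hq : 1 < 1 + e := by linarith
  have hq0 : 0 < 1 + e := by linarith
  have gP : ∀ i u, (g (τ i)).P u = true → crudePart smp (τ i) u = true := fun i u h => by
    simp only [hg, refinePiece, Bool.and_eq_true] at h; exact h.1
  have gB : ∀ i u, (g (τ i)).B u = true →
      crudePart smp (τ i) u = true ∨ crudeBuf smp (τ i) u = true := fun i u h => by
    simp only [hg, refinePiece, Bool.and_eq_true, Bool.or_eq_true] at h; tauto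
  have gA' : ∀ i u, (g (τ i)).A' u = true → crudePart smp (τ i) u = true := fun i u h => by
    simp only [hg, refinePiece, Bool.and_eq_true] at h; exact h.1
  have gA : ∀ i u, (g (τ i)).A'' u = true → crudePart smp (τ i) u = true := fun i u h => by
    simp only [hg, refinePiece, Bool.and_eq_true] at h; exact h.1.1
  have gAll : ∀ i u, u ∈ (g (τ i)).P.toFinset ∪ (g (τ i)).B.toFinset ∪ (g (τ i)).A'.toFinset ∪
      (g (τ i)).A''.toFinset → crudePart smp (τ i) u = true ∨
      (crudeBuf smp (τ i) u = true ∧ (g (τ i)).B u = true) := fun i u h => by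
    simp only [Finset.mem_union, mem_toFinset] at h
    rcases h with ((h | h) | h) | h
    · exact Or.inl (gP i u h)
    · rcases gB i u h with h' | h'
      · exact Or.inl h'
      · exact Or.inr ⟨h', h⟩
    · exact Or.inl (gA' i u h)
    · exact Or.inl (gA i u h)
  have hRP : ∀ u, o.RP u = true ↔ (∀ t < T, Misses (smp t) u) ∨
      ∃ t < T, thr t = none ∧ crudePart smp t u = true := fun u => by
    rw [h2, Bool.not_eq_true', ← Bool.not_eq_true, crudeState_Xi]
    simp [hthr]
  have hRB : ∀ u, o.RB u = true ↔
      ((¬ ∃ t < T, crudePart smp t u = true) ∧ (¬ ∃ t < T, crudeBuf smp t u = true) ∧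
        ∃ t < T, ¬ Misses (smp t) u) ∨
      ∃ t < T, crudeBuf smp t u = true ∧ ∀ r, thr t = some r →
        ¬ (refinePiece mu e (crudePart smp t) (crudeBuf smp t) r).B u = true := fun u => by
    rw [h3, Bool.not_eq_true', ← Bool.not_eq_true, Bool.or_eq_true, Bool.or_eq_true,
      Bool.not_eq_true', ← Bool.not_eq_true, crudeState_Xi, crudeState_Sig, crudeState_Gam]
    simp only [List.mem_reverse, List.mem_range, not_or, not_not, and_assoc, hthr]
  have hRPW : ∀ u, o.RP u = true → W u = true := fun u h => by
    rw [hW, keptSet_iff]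
    rcases (hRP u).1 h with h | ⟨t, ht, -, hp⟩
    · exact Or.inr h
    · exact Or.inl ⟨t, ht, hp⟩
  have hRPpart : ∀ u i, o.RP u = true → ¬ crudePart smp (τ i) u = true := fun u i h hp => by
    obtain ⟨hT, r, hr, -⟩ := hτ i
    rcases (hRP u).1 h with h | ⟨t, ht, hn, hp'⟩
    · exact not_misses_of_crudePart hp (h _ hT)
    · rw [crudePart_unique hp' hp, hr] at hn
      cases hn
  unfold Output.IsGood
  simp only [hget]
  refine ⟨by rw [hlen]; exact hcount, fun i j hij => ?_, fun i => ?_, fun i => ?_, fun i => ?_, ?_,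
    fun i => ?_, fun u => ?_, fun i => (hτ i).2.choose_spec.2.2.2.1.2.1,
    fun i => (hτ i).2.choose_spec.2.2.2.2,
    fun i => (hτ i).2.choose_spec.2.2.2.1.2.2.1, ?_, fun i => ?_⟩
  · have hne : τ i ≠ τ j := fun h => hij (hinj h)
    rw [Finset.disjoint_left]
    intro u hi hj
    rcases gAll i u hi with hi | ⟨hi, -⟩ <;> rcases gAll j u hj with hj | ⟨hj, -⟩
    · exact hne (crudePart_unique hi hj)
    · exact crudePart_not_crudeBuf hi hj
    · exact crudePart_not_crudeBuf hj hi
    · exact hne (crudeBuf_unique hi hj)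
  · obtain ⟨-, r, -, hgr, hr, -⟩ := hτ i
    have r1 : r / (1 + e) < r := div_lt_self hr hq
    have r2 : r / (1 + e) / (1 + e) < r / (1 + e) := div_lt_self (div_pos hr hq0) hq
    rw [hgr]
    simp only [Finset.disjoint_left, mem_toFinset, refinePiece, Bool.and_eq_true, Bool.or_eq_true,
      decide_eq_true_eq, Bool.not_eq_true', decide_eq_false_iff_not, not_le]
    have hx : ∀ u, crudePart smp (τ i) u = true → ¬ crudeBuf smp (τ i) u = true :=
      fun u => crudePart_not_crudeBuf
    refine ⟨fun u h h' => ?_, fun u h h' => ?_, fun u h h' => ?_, fun u h h' => ?_,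
      fun u h h' => ?_, fun u h h' => ?_⟩
    · rcases h' with h' | h'
      · exact hx u h.1 h'.1
      · linarith [h.2, h'.2]
    · linarith [h.2, h'.2]
    · linarith [h.2, h'.2]
    · rcases h with h | h
      · exact hx u h'.1 h.1
      · linarith [h.1.2, h'.2]
    · rcases h with h | h
      · exact hx u h'.1.1 h.1
      · linarith [h.1.2, h'.2]
    · linarith [h.2, h'.1.2]
  · rw [Finset.disjoint_left]
    intro u h hi
    rw [mem_toFinset] at h
    rcases gAll i u hi with hi | ⟨hi, -⟩
    · exact hRPpart u i h hi
    · rcases (hRP u).1 h with h | ⟨t, ht, -, hp⟩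
      · exact not_misses_of_crudeBuf hi (h _ (hτ i).1)
      · exact crudePart_not_crudeBuf hp hi
  · rw [Finset.disjoint_left]
    intro u h hi
    rw [mem_toFinset, hRB] at h
    rcases gAll i u hi with hi | ⟨hi, hB⟩
    · rcases h with h | ⟨t, ht, hb, -⟩
      · exact h.1 ⟨_, (hτ i).1, hi⟩
      · exact crudePart_not_crudeBuf hi hb
    · rcases h with h | ⟨t, ht, hb, hn⟩
      · exact h.2.1 ⟨_, (hτ i).1, hi⟩
      · obtain rfl := crudeBuf_unique hb hi
        obtain ⟨-, r, hr, hgr, -⟩ := hτ i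
        rw [hgr] at hB
        exact hn r hr hB
  · rw [Finset.disjoint_left]
    intro u h h'
    rw [mem_toFinset, hRP] at h
    rw [mem_toFinset, hRB] at h'
    rcases h with h | ⟨t, ht, -, hp⟩ <;> rcases h' with h' | ⟨t', ht', hb, -⟩
    · obtain ⟨t, ht, hm⟩ := h'.2.2
      exact hm (h t ht)
    · exact not_misses_of_crudeBuf hb (h t' ht')
    · exact h'.1 ⟨t, ht, hp⟩
    · exact crudePart_not_crudeBuf hp hb
  · obtain ⟨-, r, -, -, -, hf, -⟩ := hτ i
    rw [← Finset.card_pos]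
    exact_mod_cast lt_of_lt_of_le one_pos hf.1
  · simp only [mem_toFinset, Finset.mem_union]
    rw [hRP, hRB]
    by_cases hm : ∀ t < T, Misses (smp t) u
    · exact Or.inl (Or.inl hm)
    push Not at hm
    by_cases hp : ∃ t < T, crudePart smp t u = true
    · obtain ⟨t, ht, hp⟩ := hp
      rcases hr : thr t with _ | r
      · exact Or.inl (Or.inr ⟨t, ht, hr, hp⟩)
      · obtain ⟨i, rfl⟩ := (hmem t).1 ⟨ht, by rw [hr]; rfl⟩
        refine Or.inr (Or.inr ⟨i, ?_⟩)
        obtain ⟨-, r, -, hgr, -⟩ := hτ i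
        rw [hgr]
        -- A refined crude part is used up completely: according to `mu u` the vertex is in `P`, in
        -- the inner band that belongs to `B`, in `A''` or in `A'`.
        simp only [refinePiece, hp, Bool.true_and, Bool.or_eq_true, Bool.and_eq_true,
          Bool.not_eq_true']
        grind
    · by_cases hb : ∃ t < T, crudeBuf smp t u = true
      · obtain ⟨t, ht, hb⟩ := hb
        by_cases hc : ∃ r, thr t = some r ∧
            (refinePiece mu e (crudePart smp t) (crudeBuf smp t) r).B u = true
        · obtain ⟨r, hr, hB⟩ := hc
          obtain ⟨i, rfl⟩ := (hmem t).1 ⟨ht, by rw [hr]; rfl⟩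
          refine Or.inr (Or.inr ⟨i, Or.inl (Or.inl (Or.inr ?_))⟩)
          simp only [hg, hr, Option.getD_some]
          exact hB
        · push Not at hc
          exact Or.inr (Or.inl (Or.inr ⟨t, ht, hb, hc⟩))
      · exact Or.inr (Or.inl (Or.inl ⟨hp, hb, hm⟩))
  · refine le_trans ?_ hleft
    rw [Nat.cast_le]
    refine Finset.card_le_card fun u hu => ?_
    rw [mem_toFinset, hRB] at hu
    rw [mem_bufferSet]
    rcases hu with hu | ⟨t, ht, hb, -⟩
    · exact ⟨hu.2.2, hu.1⟩
    · exact ⟨⟨t, ht, not_misses_of_crudeBuf hb⟩, fun ⟨s, hs, hp⟩ => crudePart_not_crudeBuf hp hb⟩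
  · obtain ⟨hT, r, hr, -, -, hf, -⟩ := hτ i
    have h5 := hf.2.2.2.1
    have h6 := hf.2.2.2.2
    -- The sets `A'` of the other pieces and the leftover `RP` are pairwise disjoint sets of kept
    -- vertices outside the crude part of piece `i`. So the last constraint bounds all of them at
    -- once; the set `A'` of piece `i` itself falls under the preceding constraint, which explains
    -- the factor 2.
    have h7 : ∑ j ∈ Finset.univ.erase i, G.cut (g (τ j)).A'.toFinset
        ((g (τ i)).P.toFinset ∪ (g (τ i)).B.toFinset) +
        G.cut o.RP.toFinset ((g (τ i)).P.toFinset ∪ (g (τ i)).B.toFinset) ≤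
        G.cut (W.toFinset \ VSet.toFinset (crudePart smp (τ i)))
        ((g (τ i)).P.toFinset ∪ (g (τ i)).B.toFinset) := by
      refine sum_cut_add_cut_le G _ _ _ _ _ (fun j _ l _ hjl => ?_) (fun j _ => ?_)
        (fun j hj u hu => ?_) (fun u hu => ?_)
      · rw [Finset.disjoint_left]
        intro u hu hu'
        rw [mem_toFinset] at hu hu'
        exact hjl (hinj (crudePart_unique (gA' _ _ hu) (gA' _ _ hu')))
      · rw [Finset.disjoint_left]
        intro u hu hu'
        rw [mem_toFinset] at hu hu'
        exact hRPpart u j hu' (gA' _ _ hu)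
      · rw [mem_toFinset] at hu
        rw [Finset.mem_sdiff, mem_toFinset, mem_toFinset]
        refine ⟨?_, fun h => (Finset.mem_erase.1 hj).1 (hinj (crudePart_unique (gA' _ _ hu) h))⟩
        rw [hW, keptSet_iff]
        exact Or.inl ⟨_, (hτ j).1, gA' _ _ hu⟩
      · rw [mem_toFinset] at hu
        rw [Finset.mem_sdiff, mem_toFinset, mem_toFinset]
        exact ⟨hRPW u hu, hRPpart u i hu⟩
    rw [← Finset.add_sum_erase _ _ (Finset.mem_univ i)]
    rw [cut_comm] at h6
    have h8 := (Nat.cast_le (α := ℝ)).2 h7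
    push_cast at h8
    have h9 : 2 * c / ε * G.lam k * Real.log k = kap + kap := by rw [hkap]; ring
    rw [h9]
    linarith

end OutputProperties

end BufferedCheeger

namespace BufferedCheeger

/-! ### Eigenvalues of the solver and the energy of the embedding -/

section Spectral

theorem charpoly_eq_of_eigenvectors {n : ℕ} {M : Matrix (Fin n) (Fin n) ℝ} {vals : Fin n → ℝ}
    {V : Fin n → Fin n → ℝ} (ho : ∀ i j, ∑ u, V i u * V j u = if i = j then 1 else 0)
    (hv : ∀ i u, ∑ v, M u v * V i v = vals i * V i u) :
    M.charpoly = (Matrix.diagonal vals).charpoly := by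
  set U : Matrix (Fin n) (Fin n) ℝ := Matrix.of V with hU
  have h1 : U * U.transpose = 1 := by
    ext i j
    rw [Matrix.mul_apply, Matrix.one_apply, ← ho i j]
    rfl
  have h2 : U.transpose * U = 1 := mul_eq_one_comm.1 h1
  have h3 : M * U.transpose = U.transpose * Matrix.diagonal vals := by
    ext u i
    rw [Matrix.mul_diagonal, Matrix.mul_apply, mul_comm]
    exact hv i u
  have h4 : M = U.transpose * Matrix.diagonal vals * U := by
    rw [← h3, mul_assoc, h2, mul_one]
  have h5 := Matrix.charpoly_units_conj (Units.mk U.transpose U h2 h1) (Matrix.diagonal vals)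
  simp only [Matrix.inv_eq_right_inv h2] at h5
  rw [h4, h5]

/-- Eigenvectors are not unique, but the eigenvalues of any correct solver are the roots of the
characteristic polynomial with multiplicity. Sorting determines the list; `i + j + 1 = n` accounts
for the opposite orders. -/
theorem eigenvalues₀_eq_of_eigenvectors {n : ℕ} {M : Matrix (Fin n) (Fin n) ℝ}
    (hM : M.IsHermitian) {vals : Fin n → ℝ} (hmono : Monotone vals) {V : Fin n → Fin n → ℝ}
    (ho : ∀ i j, ∑ u, V i u * V j u = if i = j then 1 else 0)
    (hv : ∀ i u, ∑ v, M u v * V i v = vals i * V i u) (j : Fin (Fintype.card (Fin n)))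
    (i : Fin n) (hij : (i : ℕ) + j + 1 = n) : hM.eigenvalues₀ j = vals i := by
  have h1 := hM.sort_roots_charpoly_eq_eigenvalues₀
  have h2 : (M.charpoly.roots.map (RCLike.re : ℝ → ℝ)) = Finset.univ.val.map vals := by
    have h := Polynomial.roots_multiset_prod_X_sub_C (Finset.univ.val.map vals)
    rw [Multiset.map_map] at h
    rw [charpoly_eq_of_eigenvectors ho hv, Matrix.charpoly_diagonal]
    refine (congrArg _ h).trans ?_
    simp only [RCLike.re_to_real, Multiset.map_id']
  have h3 : List.ofFn hM.eigenvalues₀ = List.ofFn (vals ∘ Fin.rev) := by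
    refine List.Perm.eq_of_sortedGE hM.eigenvalues₀_antitone.sortedGE_ofFn
      (hmono.comp_antitone fun a b h => Fin.rev_le_rev.2 h).sortedGE_ofFn ?_
    rw [← Multiset.coe_eq_coe, ← h1, Multiset.sort_eq, h2, ← Fin.univ_val_map,
      ← Multiset.map_map]
    congr 1
    have := congrArg Finset.val (Finset.map_univ_equiv (Fin.revPerm (n := n)))
    rw [Finset.map_val] at this
    exact this.symm
  have hj : (j : ℕ) < (List.ofFn hM.eigenvalues₀).length := by
    rw [List.length_ofFn]; exact j.2
  have h4 := List.getElem_of_eq h3 hj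
  rw [List.getElem_ofFn, List.getElem_ofFn] at h4
  rw [Fin.eta] at h4
  rw [h4, Function.comp_apply]
  congr 1
  ext
  simp only [Fin.val_rev]
  omega

variable {n d k : ℕ}

theorem solverMatrix_symm (G : RegularGraph n d) (u v : Fin n) :
    (fun u v : Fin n => ((if u = v then 1 else 0) - (G.mult u v : ℝ) / d : ℝ)) u v =
      (fun u v : Fin n => ((if u = v then 1 else 0) - (G.mult u v : ℝ) / d : ℝ)) v u := by
  simp only [G.symm u v, eq_comm]

theorem solverEigenvalue_eq_lam {S : EigenSolver} (hS : IsCorrectSolver S) (G : RegularGraph n d)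
    (hk : 0 < k) (hkn : k ≤ n) : solverEigenvalue S G hk hkn = G.lam k := by
  rw [RegularGraph.lam, dif_pos ⟨hk, hkn⟩]
  have hM := solverMatrix_symm G
  refine (eigenvalues₀_eq_of_eigenvectors _ (hS.mono n _ hM) (hS.orthonormal n _ hM)
    (fun i u => ?_) _ _ ?_).symm
  · rw [← hS.eigen n _ hM i u]
    refine Finset.sum_congr rfl fun v _ => ?_
    simp [RegularGraph.laplacian, Matrix.one_apply, div_eq_inv_mul]
  · simp only
    omega

/-- The vectors of a spectral embedding with eigenvalues at most `lam`. -/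
structure IsEmbedding (G : RegularGraph n d) (bar : Fin n → Fin k → ℝ) (lam : ℝ) : Prop where
  orthonormal : ∀ i j, ∑ u, bar u i * bar u j = if i = j then 1 else 0
  energy_le : ∑ u, ∑ v, (G.mult u v : ℝ) * sqDist (bar u) (bar v) ≤ 2 * d * k * lam
  lam_nonneg : 0 ≤ lam

/-- The Dirichlet form of a unit eigenvector. The sum runs over ordered pairs, so each edge counts
twice; this gives the factor 2. -/
theorem energy_eq (G : RegularGraph n d) (hd : 0 < d) {x : Fin n → ℝ} {l : ℝ}
    (h1 : ∑ u, x u * x u = 1)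
    (hx : ∀ u, ∑ v, ((if u = v then 1 else 0) - (G.mult u v : ℝ) / d) * x v = l * x u) :
    ∑ u, ∑ v, (G.mult u v : ℝ) * ((x u - x v) * (x u - x v)) = 2 * d * l := by
  have hd' : (d : ℝ) ≠ 0 := by positivity
  have hsum : ∀ u, ∑ v, (G.mult u v : ℝ) = d := fun u => by exact_mod_cast G.regular u
  have e1 : ∑ u, ∑ v, (G.mult u v : ℝ) * (x u * x u) = d := by
    simp only [← Finset.sum_mul, hsum, ← Finset.mul_sum, h1, mul_one]
  have e2 : ∑ u, ∑ v, (G.mult u v : ℝ) * (x v * x v) = d := by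
    rw [Finset.sum_comm, ← e1]
    simp only [G.symm]
  have e3 : ∑ u, ∑ v, (G.mult u v : ℝ) * (x u * x v) = d * (1 - l) := by
    have : ∀ u, ∑ v, (G.mult u v : ℝ) * (x u * x v) = d * (1 - l) * (x u * x u) := fun u => by
      have h := hx u
      simp only [sub_mul, Finset.sum_sub_distrib, ite_mul, one_mul, zero_mul, Finset.sum_ite_eq,
        Finset.mem_univ, if_true, div_mul_eq_mul_div, ← Finset.sum_div] at h
      have h' : ∑ v, (G.mult u v : ℝ) * x v = d * (1 - l) * x u := by
        field_simp at h
        linarith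
      calc _ = x u * ∑ v, (G.mult u v : ℝ) * x v := by
            rw [Finset.mul_sum]; exact Finset.sum_congr rfl fun v _ => by ring
        _ = _ := by rw [h']; ring
    simp only [this, ← Finset.mul_sum, h1, mul_one]
  calc _ = ∑ u, ∑ v, (G.mult u v : ℝ) * (x u * x u) + ∑ u, ∑ v, (G.mult u v : ℝ) * (x v * x v) -
        2 * ∑ u, ∑ v, (G.mult u v : ℝ) * (x u * x v) := by
        simp only [Finset.mul_sum, ← Finset.sum_add_distrib, ← Finset.sum_sub_distrib]
        exact Finset.sum_congr rfl fun u _ => Finset.sum_congr rfl fun v _ => by ring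
    _ = _ := by rw [e1, e2, e3]; ring

theorem isEmbedding_embedding {S : EigenSolver} (hS : IsCorrectSolver S) (G : RegularGraph n d)
    (hd : 0 < d) (hk : 0 < k) (hkn : k ≤ n) : IsEmbedding G (embedding S G hkn) (G.lam k) := by
  have hM := solverMatrix_symm G
  set Mx := fun u v : Fin n => ((if u = v then 1 else 0) - (G.mult u v : ℝ) / d : ℝ) with hMx
  have ho : ∀ i j : Fin k, ∑ u, embedding S G hkn u i * embedding S G hkn u j =
      if i = j then 1 else 0 := fun i j => by
    have := hS.orthonormal n _ hM (i.castLE hkn) (j.castLE hkn)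
    simpa [embedding] using this
  have hen : ∀ i : Fin k, ∑ u, ∑ v, (G.mult u v : ℝ) *
      ((embedding S G hkn u i - embedding S G hkn v i) *
        (embedding S G hkn u i - embedding S G hkn v i)) =
      2 * d * (S n Mx).1 (i.castLE hkn) := fun i =>
    energy_eq G hd (by simpa using ho i i) fun u => hS.eigen n _ hM (i.castLE hkn) u
  have hlam := solverEigenvalue_eq_lam hS G hk hkn
  refine ⟨ho, ?_, ?_⟩
  · calc _ = ∑ i : Fin k, 2 * d * (S n Mx).1 (i.castLE hkn) := by
          rw [← Finset.sum_congr rfl fun i _ => hen i]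
          simp only [sqDist, Finset.mul_sum]
          symm
          rw [Finset.sum_comm]
          exact Finset.sum_congr rfl fun u _ => Finset.sum_comm
      _ ≤ ∑ i : Fin k, 2 * d * G.lam k := by
          refine Finset.sum_le_sum fun i _ => ?_
          rw [← hlam]
          refine mul_le_mul_of_nonneg_left (hS.mono n _ hM ?_) (by positivity)
          rw [Fin.le_def]
          simp only [Fin.val_castLE]
          omega
      _ = _ := by simp; ring
  -- The last coordinate belongs to `λ_k`, whose nonnegativity follows from that of the energy.
  · have h := hen ⟨k - 1, by omega⟩
    have h0 : 0 ≤ 2 * (d : ℝ) * G.lam k := by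
      rw [← hlam]
      change 0 ≤ 2 * (d : ℝ) * (S n Mx).1 ((⟨k - 1, by omega⟩ : Fin k).castLE hkn)
      rw [← h]
      exact Finset.sum_nonneg fun u _ => Finset.sum_nonneg fun v _ =>
        mul_nonneg (Nat.cast_nonneg _) (mul_self_nonneg _)
    have : (0 : ℝ) < 2 * d := by positivity
    exact nonneg_of_mul_nonneg_right h0 this

end Spectral

/-! ### Lengths, directions and balls in the spectral embedding -/

section Geometry

variable {n d k : ℕ} {bar : Fin n → Fin k → ℝ}

theorem sqLength_nonneg (bar : Fin n → Fin k → ℝ) (u : Fin n) : 0 ≤ sqLength bar u :=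
  Finset.sum_nonneg fun _ _ => mul_self_nonneg _

theorem normalized_eq_zero {u : Fin n} (h : sqLength bar u = 0) : normalized bar u = 0 := by
  funext i
  simp [normalized, h]

theorem normalized_unit {u : Fin n} (h : sqLength bar u ≠ 0) :
    ∑ i, normalized bar u i * normalized bar u i = 1 := by
  have h0 := sqLength_nonneg bar u
  have : ∀ i, normalized bar u i * normalized bar u i = bar u i * bar u i / sqLength bar u :=
    fun i => by
      rw [normalized, div_mul_div_comm, Real.mul_self_sqrt h0]
  simp only [this, ← Finset.sum_div]
  exact div_self h

theorem normalized_unit_or_zero (u : Fin n) :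
    (∑ i, normalized bar u i * normalized bar u i = 1) ∨ normalized bar u = 0 := by
  by_cases h : sqLength bar u = 0
  · exact Or.inr (normalized_eq_zero h)
  · exact Or.inl (normalized_unit h)

theorem bar_eq_zero {u : Fin n} (h : sqLength bar u = 0) (i : Fin k) : bar u i = 0 := by
  have := (Finset.sum_eq_zero_iff_of_nonneg fun i _ => mul_self_nonneg (bar u i)).1 h i
    (Finset.mem_univ i)
  exact mul_self_eq_zero.1 this

theorem bar_eq_mul (u : Fin n) (i : Fin k) :
    bar u i = Real.sqrt (sqLength bar u) * normalized bar u i := by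
  by_cases h : sqLength bar u = 0
  · rw [bar_eq_zero h, h]; simp
  · have : Real.sqrt (sqLength bar u) ≠ 0 :=
      (Real.sqrt_pos.2 (lt_of_le_of_ne (sqLength_nonneg bar u) (Ne.symm h))).ne'
    rw [normalized, mul_div_cancel₀ _ this]

/-- In terms of the lengths `a`, `b` and the cosine `c`, the difference of the two sides is `2 (1 +
c) (a - b)² + 2 (1 - c) b² + 4 (1 - c) a b`. If `v̄ = 0`, the squared distance of the directions is
1 and the claim is `a² ≤ 4 a²`. -/
theorem sqLength_mul_sqDist_le (u v : Fin n) :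
    sqLength bar u * sqDist (normalized bar u) (normalized bar v) ≤
      4 * sqDist (bar u) (bar v) := by
  by_cases hu : sqLength bar u = 0
  · rw [hu, zero_mul]
    exact mul_nonneg (by norm_num) (sqDist_nonneg _ _)
  have h1 := normalized_unit hu
  set a := Real.sqrt (sqLength bar u) with ha
  set b := Real.sqrt (sqLength bar v) with hb
  have ha0 : 0 ≤ a := Real.sqrt_nonneg _
  have hb0 : 0 ≤ b := Real.sqrt_nonneg _
  have haa : sqLength bar u = a * a := (Real.mul_self_sqrt (sqLength_nonneg bar u)).symm
  have hbb : sqLength bar v = b * b := (Real.mul_self_sqrt (sqLength_nonneg bar v)).symm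
  set c := ∑ i, normalized bar u i * normalized bar v i with hc
  have h3 : ∑ i, bar u i * bar v i = a * b * c := by
    rw [hc, Finset.mul_sum]
    exact Finset.sum_congr rfl fun i _ => by rw [bar_eq_mul (bar := bar) u i, bar_eq_mul (bar := bar) v i]; ring
  have h4 : ∑ i, bar u i * bar u i = a * a := haa
  have h5 : ∑ i, bar v i * bar v i = b * b := hbb
  rw [sqDist_eq, sqDist_eq, h1, h3, h4, h5, ← hc, haa]
  by_cases hv : sqLength bar v = 0
  · have hc0 : c = 0 := by rw [hc, normalized_eq_zero hv]; simp
    have hb' : b = 0 := by rw [hb, hv, Real.sqrt_zero]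
    rw [hc0, hb', normalized_eq_zero hv]
    simp
    nlinarith [mul_self_nonneg a]
  · have h2 := normalized_unit hv
    have hp := sqDist_nonneg (normalized bar u) (normalized bar v)
    rw [sqDist_eq, h1, h2, ← hc] at hp
    have hm : 0 ≤ ∑ i, (normalized bar u i + normalized bar v i) *
        (normalized bar u i + normalized bar v i) :=
      Finset.sum_nonneg fun _ _ => mul_self_nonneg _
    have hm' : ∑ i, (normalized bar u i + normalized bar v i) *
        (normalized bar u i + normalized bar v i) = 1 + 1 + 2 * c := by
      rw [hc, Finset.mul_sum]
      nth_rewrite 1 [← h1]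
      rw [← h2, ← Finset.sum_add_distrib, ← Finset.sum_add_distrib]
      exact Finset.sum_congr rfl fun _ _ => by ring
    rw [h2]
    have hc1 : c ≤ 1 := by linarith
    have hc2 : -1 ≤ c := by linarith
    have p1 := mul_nonneg (by linarith : 0 ≤ 1 + c) (mul_self_nonneg (a - b))
    have p2 := mul_nonneg (by linarith : 0 ≤ 1 - c) (mul_self_nonneg b)
    have p3 := mul_nonneg (by linarith : 0 ≤ 1 - c) (mul_nonneg ha0 hb0)
    linear_combination 2 * p1 + 2 * p2 + 4 * p3

/-- In each coordinate the difference of the two sides is a square divided by `e`. The right-hand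
side is the function `D` of the radial step: it bounds the length of the set of thresholds that cut
an edge across the band. -/
theorem sqLength_sub_le {e : ℝ} (he : 0 < e) (u v : Fin n) :
    sqLength bar u - (1 + e) * sqLength bar v ≤ (1 + 1 / e) * sqDist (bar u) (bar v) := by
  rw [sqLength, sqLength, sqDist, Finset.mul_sum, Finset.mul_sum, ← Finset.sum_sub_distrib]
  refine Finset.sum_le_sum fun i _ => ?_
  have h : (1 + 1 / e) * ((bar u i - bar v i) * (bar u i - bar v i)) -
      (bar u i * bar u i - (1 + e) * (bar v i * bar v i)) =
      1 / e * ((bar u i - bar v i - e * bar v i) * (bar u i - bar v i - e * bar v i)) := by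
    field_simp
    ring
  have : 0 ≤ 1 / e * ((bar u i - bar v i - e * bar v i) * (bar u i - bar v i - e * bar v i)) :=
    mul_nonneg (one_div_pos.2 he).le (mul_self_nonneg _)
  linarith

theorem sum_sqLength (ho : ∀ i j, ∑ u, bar u i * bar u j = if i = j then 1 else 0) :
    ∑ u, sqLength bar u = k := by
  simp only [sqLength]
  rw [Finset.sum_comm]
  simp [ho]

/-- Isotropy of the embedding: the sum is the squared length of a combination of orthonormal
eigenvectors. -/
theorem sum_inner_sq (ho : ∀ i j, ∑ u, bar u i * bar u j = if i = j then 1 else 0)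
    (w : Fin k → ℝ) : ∑ u, (∑ i, bar u i * w i) * (∑ i, bar u i * w i) = ∑ i, w i * w i := by
  calc _ = ∑ u, ∑ i, ∑ j, (bar u i * bar u j) * (w i * w j) := by
        refine Finset.sum_congr rfl fun u _ => ?_
        rw [Finset.sum_mul_sum]
        exact Finset.sum_congr rfl fun i _ => Finset.sum_congr rfl fun j _ => by ring
    _ = ∑ i, ∑ j, (∑ u, bar u i * bar u j) * (w i * w j) := by
        rw [Finset.sum_comm]
        refine Finset.sum_congr rfl fun i _ => ?_
        rw [Finset.sum_comm]
        exact Finset.sum_congr rfl fun j _ => by rw [Finset.sum_mul]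
    _ = _ := by simp [ho]

/-- The measure of a small ball around a direction is hardly more than `1`. -/
theorem sum_ball_le (ho : ∀ i j, ∑ u, bar u i * bar u j = if i = j then 1 else 0) {dl : ℝ}
    (h0 : 0 < dl) (h1 : dl ≤ 1) {u : Fin n} (hu : sqLength bar u ≠ 0) :
    (∑ v, if sqDist (normalized bar u) (normalized bar v) ≤ dl / 6 then sqLength bar v else 0) ≤
      1 + dl / 2 := by
  have hu1 := normalized_unit hu
  -- In the ball the cosine is at least `1 - dl / 12`, so its square is at least `1 - dl / 6`.
  -- Summing over `v`, isotropy gives total 1 on the right, and `(1 - dl / 6) (1 + dl / 2) ≥ 1`.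
  have key : ∀ v, (1 - dl / 6) *
      (if sqDist (normalized bar u) (normalized bar v) ≤ dl / 6 then sqLength bar v else 0) ≤
      (∑ i, bar v i * normalized bar u i) * (∑ i, bar v i * normalized bar u i) := fun v => by
    split_ifs with h
    swap
    · rw [mul_zero]; exact mul_self_nonneg _
    by_cases hv : sqLength bar v = 0
    · rw [hv, mul_zero]; exact mul_self_nonneg _
    have hv1 := normalized_unit hv
    rw [sqDist_eq, hu1, hv1] at h
    set c := ∑ i, normalized bar u i * normalized bar v i with hc
    have h3 : ∑ i, bar v i * normalized bar u i = Real.sqrt (sqLength bar v) * c := by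
      rw [hc, Finset.mul_sum]
      exact Finset.sum_congr rfl fun i _ => by rw [bar_eq_mul (bar := bar) v i]; ring
    rw [h3]
    have h4 := Real.mul_self_sqrt (sqLength_nonneg bar v)
    have h5 : Real.sqrt (sqLength bar v) * c * (Real.sqrt (sqLength bar v) * c) =
        c * c * sqLength bar v := by
      linear_combination c * c * h4
    rw [h5]
    refine mul_le_mul_of_nonneg_right ?_ (sqLength_nonneg bar v)
    nlinarith
  have h2 := Finset.sum_le_sum fun v (_ : v ∈ Finset.univ) => key v
  rw [sum_inner_sq ho, hu1, ← Finset.mul_sum] at h2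
  have h3 : 1 - dl / 6 > 0 := by linarith
  by_contra hc
  push Not at hc
  have := mul_lt_mul_of_pos_left hc h3
  nlinarith

end Geometry

end BufferedCheeger

namespace BufferedCheeger

/-! ### Counting the refined parts -/

section Counting

variable {n d : ℕ}

theorem sum_ite_le_of_unique {s : Finset ℕ} {p : ℕ → Prop} [DecidablePred p] {q : Prop}
    [Decidable q] {c : ℝ} (hc : 0 ≤ c) (hu : ∀ i ∈ s, ∀ j ∈ s, p i → p j → i = j)
    (hq : ∀ i ∈ s, p i → q) : (∑ t ∈ s, if p t then c else 0) ≤ if q then c else 0 := by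
  by_cases h : ∃ i ∈ s, p i
  · obtain ⟨i, hi, hp⟩ := h
    rw [if_pos (hq i hi hp), Finset.sum_eq_single_of_mem i hi, if_pos hp]
    intro j hj hji
    exact if_neg fun hp' => hji (hu j hj i hi hp' hp)
  · push Not at h
    rw [Finset.sum_eq_zero fun i hi => if_neg (h i hi)]
    split_ifs
    exacts [hc, le_rfl]

open Classical in
/-- A bound for the sum of the costs of the crude pairs. -/
noncomputable def totalCost (G : RegularGraph n d) (mu : Fin n → ℝ) (e : ℝ)
    (D : Fin n → Fin n → ℝ) (smp : ℕ → VSet n × VSet n × VSet n) (T : ℕ) : ℝ :=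
  ∑ u, ∑ v, (G.mult u v : ℝ) * ((2 + e) * D u v + (if FirstSep smp T u v then mu u else 0) +
    (if FirstSep smp T v u then (1 + e) * mu u else 0))

/-- The crude parts and buffers are disjoint, so an ordered pair of vertices is charged each kind of
cost in at most one round, and the last two kinds only after a first separation. -/
theorem sum_partCost_le (G : RegularGraph n d) {mu : Fin n → ℝ} (hmu : ∀ u, 0 ≤ mu u) {e : ℝ}
    (he : 0 < e) {D : Fin n → Fin n → ℝ} (hD : ∀ u v, 0 ≤ D u v)
    (smp : ℕ → VSet n × VSet n × VSet n) (T : ℕ) :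
    ∑ t ∈ Finset.range T, partCost G mu e D (keptSet smp T) (crudePart smp t) (crudeBuf smp t) ≤
      totalCost G mu e D smp T := by
  classical
  unfold partCost totalCost
  rw [Finset.sum_comm]
  refine Finset.sum_le_sum fun u _ => ?_
  rw [Finset.sum_comm]
  refine Finset.sum_le_sum fun v _ => ?_
  rw [← Finset.mul_sum]
  refine mul_le_mul_of_nonneg_left ?_ (Nat.cast_nonneg _)
  rw [Finset.sum_add_distrib, Finset.sum_add_distrib]
  refine add_le_add (add_le_add ?_ ?_) ?_
  · refine (sum_ite_le_of_unique (q := True) (mul_nonneg (by linarith) (hD u v))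
      (fun i _ j _ hi hj => crudePart_unique hi hj) fun _ _ _ => trivial).trans ?_
    rw [if_pos trivial]
  · refine sum_ite_le_of_unique (hmu u)
      (fun i _ j _ hi hj => crudePart_unique hi.1 hj.1) fun t ht h => ?_
    exact firstSep_of_crudePart (Finset.mem_range.1 ht) h.1 (by simp [h.2.1]) (by simp [h.2.2])
  · refine sum_ite_le_of_unique (mul_nonneg (by linarith) (hmu u))
      (fun i _ j _ hi hj => ?_) fun t ht h => ?_
    · rcases hi.1 with hi | hi <;> rcases hj.1 with hj | hj
      · exact crudePart_unique hi hj
      · exact absurd hj (crudePart_not_crudeBuf hi)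
      · exact absurd hi (crudePart_not_crudeBuf hj)
      · exact crudeBuf_unique hi hj
    · exact firstSep_of_crude (Finset.mem_range.1 ht) h.1 (by simp [h.2.2])
        (keptSet_iff.1 h.2.1)

theorem partCost_nonneg (G : RegularGraph n d) {mu : Fin n → ℝ} (hmu : ∀ u, 0 ≤ mu u) {e : ℝ}
    (he : 0 < e) {D : Fin n → Fin n → ℝ} (hD : ∀ u v, 0 ≤ D u v) (W tP tB : VSet n) :
    0 ≤ partCost G mu e D W tP tB := by
  refine Finset.sum_nonneg fun u _ => Finset.sum_nonneg fun v _ =>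
    mul_nonneg (Nat.cast_nonneg _) (add_nonneg (add_nonneg ?_ ?_) ?_)
  · split_ifs
    exacts [mul_nonneg (by linarith) (hD u v), le_rfl]
  · split_ifs
    exacts [hmu u, le_rfl]
  · split_ifs
    exacts [mul_nonneg (by linarith) (hmu u), le_rfl]

open Classical in
/-- Most crude pairs are refined if the crude parts cover most of the measure, and the buffers
and the costs are small. -/
theorem le_card_refined (G : RegularGraph n d) (hd : 0 < d) {mu : Fin n → ℝ}
    (hmu : ∀ u, 0 ≤ mu u) {k : ℕ} (hk : ∑ u, mu u = k) {e ε dl : ℝ} (he : 0 < e) (heε : e ≤ ε)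
    (hedl : e ≤ dl) (hdl : dl ≤ 1 / 100) {D : Fin n → Fin n → ℝ} (hD0 : ∀ u v, 0 ≤ D u v)
    (hDs : ∀ u v, D u v = D v u) (hD : ∀ u v, mu u - (1 + e) * mu v ≤ D u v)
    (smp : ℕ → VSet n × VSet n × VSet n) (T : ℕ)
    (hpart : ∀ t < T, (∑ u, if crudePart smp t u = true then mu u else 0) ≤ 1 + dl)
    (hQ : (∑ u, if u ∈ bufferSet smp T then mu u else 0) ≤ 16 * e * k)
    (hN : (∑ u, if ∀ t < T, Misses (smp t) u then mu u else 0) ≤ 4 * dl * k)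
    {M : ℝ} (hM : 0 ≤ M) (hF : totalCost G mu e D smp T ≤ 8 * (M * k)) {kap x : ℝ}
    (hx0 : 0 ≤ x)
    (hx : ∀ p c : ℕ, 1 ≤ p → p ≤ n → kap * ((d : ℝ) * p) < c → (p : ℝ) ≤ x * c)
    (hxM : x * (8 / dl * M) ≤ 1 / 2) :
    (1 - 23 * dl) * (k : ℝ) ≤ (((Finset.range T).filter fun t =>
      (chosenThreshold G mu e (100 / dl * ε) (10 * ε) kap (keptSet smp T)
        (crudePart smp t, crudeBuf smp t)).isSome).card : ℝ) := by
  have hdl0 : 0 < dl := he.trans_le hedl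
  have hε : 0 < ε := he.trans_le heε
  set m : ℕ → ℝ := fun t => ∑ u, if crudePart smp t u = true then mu u else 0 with hm
  set b : ℕ → ℝ := fun t => ∑ u, if crudeBuf smp t u = true then mu u else 0 with hb
  set F : ℕ → ℝ := fun t => partCost G mu e D (keptSet smp T) (crudePart smp t) (crudeBuf smp t)
    with hFdef
  have hm0 : ∀ t, 0 ≤ m t := fun t => Finset.sum_nonneg fun u _ => by
    split_ifs
    exacts [hmu u, le_rfl]
  have hb0 : ∀ t, 0 ≤ b t := fun t => Finset.sum_nonneg fun u _ => by
    split_ifs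
    exacts [hmu u, le_rfl]
  have hF0 : ∀ t, 0 ≤ F t := fun t => partCost_nonneg G hmu he hD0 _ _ _
  have sF : ∑ t ∈ Finset.range T, F t ≤ 8 * (M * k) :=
    (sum_partCost_le G hmu he hD0 smp T).trans hF
  have sb : ∑ t ∈ Finset.range T, b t ≤ 16 * e * k := by
    refine le_trans ?_ hQ
    rw [Finset.sum_comm]
    refine Finset.sum_le_sum fun u _ => sum_ite_le_of_unique (hmu u)
      (fun i _ j _ hi hj => crudeBuf_unique hi hj) fun t ht h => ?_
    exact mem_bufferSet.2 ⟨⟨t, Finset.mem_range.1 ht, not_misses_of_crudeBuf h⟩,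
      fun ⟨s, hs, hp⟩ => crudePart_not_crudeBuf hp h⟩
  -- The loss consists of `16 e k` for the vertices first met by a buffer and `4 dl k` for those
  -- never met.
  have sm : (1 - 20 * dl) * k ≤ ∑ t ∈ Finset.range T, m t := by
    have h1 : ∑ u, mu u ≤ (∑ u, if u ∈ bufferSet smp T then mu u else 0) +
        (∑ u, if ∀ t < T, Misses (smp t) u then mu u else 0) + ∑ t ∈ Finset.range T, m t := by
      rw [Finset.sum_comm, ← Finset.sum_add_distrib, ← Finset.sum_add_distrib]
      refine Finset.sum_le_sum fun u _ => ?_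
      have n1 : 0 ≤ if u ∈ bufferSet smp T then mu u else 0 := by
        split_ifs
        exacts [hmu u, le_rfl]
      have n2 : 0 ≤ if ∀ t < T, Misses (smp t) u then mu u else 0 := by
        split_ifs
        exacts [hmu u, le_rfl]
      have n3 : ∀ t ∈ Finset.range T, 0 ≤ if crudePart smp t u = true then mu u else 0 :=
        fun t _ => by
          split_ifs
          exacts [hmu u, le_rfl]
      by_cases hmiss : ∀ t < T, Misses (smp t) u
      · rw [if_pos hmiss]
        have := Finset.sum_nonneg n3
        linarith
      by_cases hp : ∃ t < T, crudePart smp t u = true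
      · obtain ⟨t, ht, hp⟩ := hp
        have := Finset.single_le_sum n3 (Finset.mem_range.2 ht)
        rw [if_pos hp] at this
        linarith
      · have : u ∈ bufferSet smp T := mem_bufferSet.2 ⟨by push Not at hmiss; exact hmiss, hp⟩
        rw [if_pos this]
        have := Finset.sum_nonneg n3
        linarith
    have hk0 : (0 : ℝ) ≤ k := Nat.cast_nonneg k
    have h2 : e * k ≤ dl * k := mul_le_mul_of_nonneg_right hedl hk0
    rw [hk] at h1
    linarith
  set s := (Finset.range T).filter fun t =>
      (chosenThreshold G mu e (100 / dl * ε) (10 * ε) kap (keptSet smp T)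
        (crudePart smp t, crudeBuf smp t)).isSome with hs
  -- A part that is not refined must have a heavy buffer or a large cost. Otherwise the three terms
  -- in `exists_threshold` are at most 1/5, 1/5 and 1/2 of its measure, and a threshold exists. The
  -- two alternatives are scaled so that each accounts for measure at most `dl k` in total.
  have hbad : ∀ t ∈ (Finset.range T).filter fun t =>
      ¬ (chosenThreshold G mu e (100 / dl * ε) (10 * ε) kap (keptSet smp T)
        (crudePart smp t, crudeBuf smp t)).isSome,
      m t ≤ dl / (16 * e) * b t ∨ 8 / dl * M * m t < F t := by
    intro t ht
    rw [Finset.mem_filter] at ht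
    by_contra hc
    push Not at hc
    obtain ⟨hc1, hc2⟩ := hc
    have hmp : 0 < m t := lt_of_le_of_lt (mul_nonneg (by positivity) (hb0 t)) hc1
    have hbm : b t ≤ 16 * e / dl * m t := by
      rw [div_mul_eq_mul_div, div_lt_iff₀ (by positivity)] at hc1
      rw [div_mul_eq_mul_div, le_div_iff₀ hdl0]
      linarith
    obtain ⟨r, hr, hr0, hf, hkap⟩ := exists_threshold G hd hmu (b1 := 100 / dl * ε)
      (b2 := 10 * ε) he (by positivity) (by positivity) hx0 hx hD0 hDs hD (keptSet smp T)
      (crudePart smp t) (crudeBuf smp t) (by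
        have t1 : 1 / (100 / dl * ε) * (e * m t + (1 + e) * b t) ≤ 1 / 5 * m t := by
          rw [one_div_mul_eq_div, div_le_iff₀ (by positivity)]
          have e1 : 1 / 5 * m t * (100 / dl * ε) = 20 * ε / dl * m t := by ring
          rw [e1]
          have e2 : (1 + e) * b t ≤ (1 + 1 / 100) * (16 * e / dl * m t) := by
            refine mul_le_mul (by linarith) hbm (hb0 t) (by norm_num)
          have e3 : e * m t ≤ e / dl * m t := by
            refine mul_le_mul_of_nonneg_right ?_ hmp.le
            rw [le_div_iff₀ hdl0]
            nlinarith
          have e4 : e / dl * m t ≤ ε / dl * m t := by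
            refine mul_le_mul_of_nonneg_right ?_ hmp.le
            gcongr
          have e5 : 16 * e / dl * m t = 16 * (e / dl * m t) := by ring
          have e6 : 20 * ε / dl * m t = 20 * (ε / dl * m t) := by ring
          have e7 : 0 ≤ ε / dl * m t := by positivity
          rw [e5] at e2
          rw [e6]
          linarith
        have t2 : 1 / (10 * ε) * ((1 + e) * e * m t) ≤ 1 / 5 * m t := by
          rw [one_div_mul_eq_div, div_le_iff₀ (by positivity)]
          have : (1 + e) * e * m t ≤ 2 * ε * m t := by
            refine mul_le_mul_of_nonneg_right ?_ hmp.le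
            nlinarith
          linarith
        have t3 : x * F t ≤ 1 / 2 * m t := by
          calc x * F t ≤ x * (8 / dl * M * m t) := mul_le_mul_of_nonneg_left hc2 hx0
            _ = x * (8 / dl * M) * m t := by ring
            _ ≤ _ := mul_le_mul_of_nonneg_right hxM hmp.le
        change 1 / (100 / dl * ε) * (e * m t + (1 + e) * b t) +
          1 / (10 * ε) * ((1 + e) * e * m t) + x * F t < m t
        linarith)
    obtain ⟨r', hr'⟩ := exists_bestThreshold
      (feas := fun r => Feasible G (100 / dl * ε) (10 * ε) kap (keptSet smp T) (crudePart smp t)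
        (refinePiece mu e (crudePart smp t) (crudeBuf smp t) r))
      (phi := fun r => G.expansion (refinePiece mu e (crudePart smp t) (crudeBuf smp t) r).P.toFinset
        (refinePiece mu e (crudePart smp t) (crudeBuf smp t) r).B.toFinset) hr hf hr0 hkap
    refine ht.2 ?_
    rw [chosenThreshold, hr']
    rfl
  -- The multiplier `y` is the reciprocal of `8 / dl * M`. If `M = 0`, then all costs vanish, the
  -- second alternative never occurs, and `y = 0` serves.
  obtain ⟨y, hy0, hyF, hym⟩ : ∃ y : ℝ, 0 ≤ y ∧ y * (8 * (M * k)) ≤ dl * k ∧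
      ∀ t ∈ Finset.range T, 8 / dl * M * m t < F t → m t ≤ y * F t := by
    have hk0 : (0 : ℝ) ≤ k := Nat.cast_nonneg k
    rcases hM.eq_or_lt with h0 | hpos
    · refine ⟨0, le_rfl, by rw [zero_mul]; positivity, fun t ht h => ?_⟩
      have h1 := Finset.single_le_sum (fun t _ => hF0 t) ht
      rw [← h0] at sF h
      simp only [mul_zero, zero_mul] at sF h
      linarith
    · refine ⟨dl / (8 * M), by positivity, le_of_eq (by field_simp), fun t ht h => ?_⟩
      rw [div_mul_eq_mul_div, le_div_iff₀ (by positivity)]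
      rw [div_mul_eq_mul_div, div_mul_eq_mul_div, div_lt_iff₀ hdl0] at h
      linarith
  have h1 : ∑ t ∈ Finset.range T, m t ≤ (1 + dl) * s.card + 2 * dl * k := by
    rw [← Finset.sum_filter_add_sum_filter_not (Finset.range T) fun t =>
      (chosenThreshold G mu e (100 / dl * ε) (10 * ε) kap (keptSet smp T)
        (crudePart smp t, crudeBuf smp t)).isSome]
    have g1 : ∑ t ∈ s, m t ≤ (1 + dl) * s.card := by
      rw [mul_comm, ← nsmul_eq_mul]
      exact Finset.sum_le_card_nsmul _ _ _ fun t ht =>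
        hpart t (Finset.mem_range.1 (Finset.mem_filter.1 ht).1)
    have g2 := Finset.sum_le_sum fun t ht =>
      show m t ≤ dl / (16 * e) * b t + y * F t from by
        have hn1 : 0 ≤ dl / (16 * e) * b t := mul_nonneg (by positivity) (hb0 t)
        have hn2 : 0 ≤ y * F t := mul_nonneg hy0 (hF0 t)
        rcases hbad t ht with h | h
        · linarith
        · linarith [hym t (Finset.mem_filter.1 ht).1 h]
    have g3 := g2.trans (Finset.sum_le_sum_of_subset_of_nonneg (Finset.filter_subset _ _)
      fun t _ _ => add_nonneg (mul_nonneg (by positivity) (hb0 t)) (mul_nonneg hy0 (hF0 t)))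
    rw [Finset.sum_add_distrib, ← Finset.mul_sum, ← Finset.mul_sum] at g3
    have g4 : dl / (16 * e) * ∑ t ∈ Finset.range T, b t ≤ dl * k := by
      refine (mul_le_mul_of_nonneg_left sb (by positivity)).trans (le_of_eq ?_)
      field_simp
    have g5 := (mul_le_mul_of_nonneg_left sF hy0).trans hyF
    linarith
  have hk0 : (0 : ℝ) ≤ k := Nat.cast_nonneg k
  have h2 : (1 - 22 * dl) * k ≤ (1 + dl) * s.card := by linarith
  have h3 : (1 + dl) * ((1 - 23 * dl) * k) ≤ (1 - 22 * dl) * k := by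
    nlinarith [mul_nonneg (mul_nonneg hdl0.le hdl0.le) hk0]
  exact le_of_mul_le_mul_left (h3.trans h2) (by linarith)

end Counting

end BufferedCheeger

namespace BufferedCheeger

/-! ### The good event -/

section GoodEvent

open MeasureTheory

variable {n d k : ℕ}

section Measurability

variable {psi : Fin n → Fin k → ℝ} {mu : Fin n → ℝ} {dl e : ℝ}

theorem measurableSet_drawnRound (p : VSet n × VSet n × VSet n → Prop) (s : ℕ) :
    MeasurableSet {ω | p (drawnRound psi mu dl e ω s)} :=
  IsSepData.measurable_drawnRound s (Set.toFinite {x | p x}).measurableSet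

theorem measurableSet_first (p q : VSet n × VSet n × VSet n → Prop) (T : ℕ) :
    MeasurableSet {ω | ∃ s < T, (∀ j < s, p (drawnRound psi mu dl e ω j)) ∧
      q (drawnRound psi mu dl e ω s)} := by
  have : {ω | ∃ s < T, (∀ j < s, p (drawnRound psi mu dl e ω j)) ∧
      q (drawnRound psi mu dl e ω s)} = ⋃ s ∈ Finset.range T,
      ((⋂ j ∈ Finset.range s, {ω | p (drawnRound psi mu dl e ω j)}) ∩
        {ω | q (drawnRound psi mu dl e ω s)}) := by
    ext ω
    simp only [Set.mem_ofPred_eq, Set.mem_iUnion, Finset.mem_range, Set.mem_inter_iff,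
      Set.mem_iInter, exists_prop]
  rw [this]
  exact Finset.measurableSet_biUnion _ fun s _ => (Finset.measurableSet_biInter _ fun j _ =>
    measurableSet_drawnRound p j).inter (measurableSet_drawnRound q s)

theorem measurableSet_never (u : Fin n) (T : ℕ) :
    MeasurableSet {ω | ∀ j < T, Misses (drawnRound psi mu dl e ω j) u} := by
  have : {ω | ∀ j < T, Misses (drawnRound psi mu dl e ω j) u} =
      ⋂ j ∈ Finset.range T, {ω | Misses (drawnRound psi mu dl e ω j) u} := by
    ext ω
    simp
  rw [this]
  exact Finset.measurableSet_biInter _ fun j _ => measurableSet_drawnRound (fun s => Misses s u) j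

theorem measurableSet_firstBuffer (u : Fin n) (T : ℕ) :
    MeasurableSet {ω | FirstBuffer (drawnRound psi mu dl e ω) T u} :=
  measurableSet_first (fun s => Misses s u) (fun s => s.2.1 u = true ∨ s.2.2 u = true) T

theorem measurableSet_firstSep (u v : Fin n) (T : ℕ) :
    MeasurableSet {ω | FirstSep (drawnRound psi mu dl e ω) T u v} :=
  measurableSet_first (fun s => Misses s u) (fun s => SepFrom s u v ∨ SepFrom s v u) T

end Measurability

variable {G : RegularGraph n d} {bar : Fin n → Fin k → ℝ} {lam dl e : ℝ}

theorem IsEmbedding.isSepData (h : IsEmbedding G bar lam) (hk : 1 ≤ k) (he : 0 < e)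
    (hed : e ≤ dl) (hdl : dl ≤ 1 / 100) : IsSepData (normalized bar) (sqLength bar) dl e where
  one_le := hk
  e_pos := he
  e_le := hed
  dl_le := hdl
  mu_nonneg := sqLength_nonneg bar
  total_pos := by
    rw [sum_sqLength h.orthonormal]
    exact_mod_cast hk
  unit_or_zero := normalized_unit_or_zero

/-- A kept sample has a centre: the ball around it has measure at most `1 + dl / 2`, and the rest of
the sample at most `cap`, which is `dl / 2` because the total measure is `k`. A discarded sample is
empty. -/
theorem IsEmbedding.sum_sample_le (h : IsEmbedding G bar lam) (hk : 1 ≤ k) (he : 0 < e)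
    (hed : e ≤ dl) (hdl : dl ≤ 1 / 100) (g : Fin k → ℝ) :
    (∑ u, if (drawn (normalized bar) (sqLength bar) dl e g).1 u = true then sqLength bar u else 0) ≤
      1 + dl := by
  classical
  have hdl0 : 0 < dl := he.trans_le hed
  have hS := h.isSepData hk he hed hdl
  have ht := hS.one_le_threshold
  simp only [drawn, sampleOf, decide_eq_true_eq]
  by_cases hkept : Kept (normalized bar) (sqLength bar) (sepThreshold dl k) (sepRadius dl)
      (dl / (2 * k) * ∑ u, sqLength bar u) g
  swap
  · simp only [hkept, false_and, if_false, Finset.sum_const_zero]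
    linarith
  simp only [hkept, true_and]
  obtain ⟨c, hc, hfar⟩ := hkept
  have hc0 : sqLength bar c ≠ 0 := fun h0 => by
    have : proj (normalized bar) g c = 0 := by
      simp [proj, normalized_eq_zero h0]
    linarith
  have hball := sum_ball_le h.orthonormal hdl0 (hdl.trans (by norm_num)) hc0
  have hcap : dl / (2 * k) * ∑ u, sqLength bar u = dl / 2 := by
    rw [sum_sqLength h.orthonormal]
    have : (0 : ℝ) < k := by exact_mod_cast hk
    field_simp
  rw [hcap, farMeasure] at hfar
  have : (∑ u, if sepThreshold dl k ≤ proj (normalized bar) g u then sqLength bar u else 0) ≤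
      (∑ v, if sqDist (normalized bar c) (normalized bar v) ≤ dl / 6 then sqLength bar v else 0) +
      ∑ v, if sepThreshold dl k ≤ proj (normalized bar) g v ∧ sepRadius dl <
        Real.sqrt (∑ i, (normalized bar c i - normalized bar v i) *
          (normalized bar c i - normalized bar v i)) then sqLength bar v else 0 := by
    rw [← Finset.sum_add_distrib]
    refine Finset.sum_le_sum fun v _ => ?_
    have h0 := sqLength_nonneg bar v
    by_cases h1 : sqDist (normalized bar c) (normalized bar v) ≤ dl / 6
    · rw [if_pos h1]
      split_ifs <;> linarith
    · have h2 : sepRadius dl < Real.sqrt (∑ i, (normalized bar c i - normalized bar v i) *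
          (normalized bar c i - normalized bar v i)) :=
        Real.sqrt_lt_sqrt (by positivity) (not_le.1 h1)
      simp only [h1, h2, and_true, if_false, zero_add, le_refl]
  linarith

/-- The weight `μ(u)` turns angular distances into distances of the embedded vectors at the price of
a factor 4. It is the same in both orders, because `totalCost` charges `μ(u)` also when `v` is the
vertex whose first meeting counts. -/
theorem IsEmbedding.mul_measure_firstSep_le (h : IsEmbedding G bar lam) (hk : 1 ≤ k) (he : 0 < e)
    (hed : e ≤ dl) (hdl : dl ≤ 1 / 100) (u v : Fin n) :
    ENNReal.ofReal (sqLength bar u) * gaussTable {ω | FirstSep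
      (drawnRound (normalized bar) (sqLength bar) dl e ω) (sepRounds dl k) u v} ≤
      ENNReal.ofReal (320 * sepThreshold dl k ^ 2 / e * sqDist (bar u) (bar v)) ∧
    ENNReal.ofReal (sqLength bar u) * gaussTable {ω | FirstSep
      (drawnRound (normalized bar) (sqLength bar) dl e ω) (sepRounds dl k) v u} ≤
      ENNReal.ofReal (320 * sepThreshold dl k ^ 2 / e * sqDist (bar u) (bar v)) := by
  have hS := h.isSepData hk he hed hdl
  have ht := hS.one_le_threshold
  set K := sepThreshold dl k ^ 2 / e with hK
  have hK1 : 1 ≤ K := by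
    rw [hK, le_div_iff₀ he]
    nlinarith
  have hD := sqDist_nonneg (bar u) (bar v)
  have h1 := sqLength_mul_sqDist_le (bar := bar) u v
  have h0 := sqLength_nonneg bar u
  have e1 : 320 * sepThreshold dl k ^ 2 / e * sqDist (bar u) (bar v) =
      320 * K * sqDist (bar u) (bar v) := by rw [hK]; ring
  have e2 : 80 * sepThreshold dl k ^ 2 / e * sqDist (normalized bar u) (normalized bar v) =
      80 * K * sqDist (normalized bar u) (normalized bar v) := by rw [hK]; ring
  have main : sqLength bar u * (80 * K * sqDist (normalized bar u) (normalized bar v)) ≤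
      320 * K * sqDist (bar u) (bar v) := by
    have := mul_le_mul_of_nonneg_left h1 (by linarith : 0 ≤ 80 * K)
    linarith
  constructor
  · by_cases hu : sqLength bar u = 0
    · rw [hu]; simp
    refine (mul_le_mul_right (hS.measure_firstSep_le (normalized_unit hu) v) _).trans ?_
    rw [← ENNReal.ofReal_mul h0, e1, e2]
    exact ENNReal.ofReal_le_ofReal main
  · by_cases hv : sqLength bar v = 0
    -- If `v̄ = 0`, there is no lower bound for the probability of meeting `v`, but the squared
    -- distance equals `μ(u)`, so the trivial bound 1 suffices.
    · refine (mul_le_mul_right prob_le_one _).trans ?_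
      rw [mul_one, e1]
      refine ENNReal.ofReal_le_ofReal ?_
      have : sqDist (bar u) (bar v) = sqLength bar u :=
        Finset.sum_congr rfl fun i _ => by rw [bar_eq_zero hv, sub_zero]
      rw [this]
      nlinarith
    refine (mul_le_mul_right (hS.measure_firstSep_le (normalized_unit hv) u) _).trans ?_
    rw [sqDist_comm, ← ENNReal.ofReal_mul h0, e1, e2]
    exact ENNReal.ofReal_le_ofReal main

open Classical in
-- The expected radial and angular costs of an edge are together at most `1000 t² / e` times its
-- energy, and the total energy is at most `2 d k λ`.
theorem IsEmbedding.hasIntLe_totalCost (h : IsEmbedding G bar lam) (hk : 1 ≤ k) (he : 0 < e)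
    (hed : e ≤ dl) (hdl : dl ≤ 1 / 100) :
    HasIntLe gaussTable (fun ω => totalCost G (sqLength bar) e
      (fun u v => (1 + 1 / e) * sqDist (bar u) (bar v))
      (drawnRound (normalized bar) (sqLength bar) dl e ω) (sepRounds dl k))
      (2000 * sepThreshold dl k ^ 2 * d * lam / e * k) := by
  have hS := h.isSepData hk he hed hdl
  have ht := hS.one_le_threshold
  set t := sepThreshold dl k with htdef
  set K := t ^ 2 / e with hK
  have hK0 : 0 ≤ K := by positivity
  have hKe : 1 / e ≤ K := by
    rw [hK]
    gcongr
    nlinarith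
  have he1 : e ≤ 1 / 100 := hed.trans hdl
  have h1e : 1 ≤ 1 / e := by
    rw [le_div_iff₀ he]
    linarith
  have e1 : ∀ x : ℝ, 320 * t ^ 2 / e * x = 320 * K * x := fun x => by rw [hK]; ring
  refine (HasIntLe.sum _ fun u => HasIntLe.sum _ fun v => HasIntLe.const_mul
    (((HasIntLe.const (c := (2 + e) * ((1 + 1 / e) * sqDist (bar u) (bar v))) ?_).add
      (HasIntLe.ite_event (measurableSet_firstSep u v _) (sqLength_nonneg bar u)
        (L := 320 * t ^ 2 / e * sqDist (bar u) (bar v)) ?_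
        (h.mul_measure_firstSep_le hk he hed hdl u v).1)).add
      (HasIntLe.ite_event (measurableSet_firstSep v u _)
        (mul_nonneg (by linarith) (sqLength_nonneg bar u))
        (L := (1 + e) * (320 * t ^ 2 / e * sqDist (bar u) (bar v))) ?_ ?_))
    (Nat.cast_nonneg (G.mult u v))).mono ?_
  · have := sqDist_nonneg (bar u) (bar v)
    positivity
  · have := sqDist_nonneg (bar u) (bar v)
    positivity
  · have := sqDist_nonneg (bar u) (bar v)
    positivity
  · rw [ENNReal.ofReal_mul (by linarith : 0 ≤ 1 + e), ENNReal.ofReal_mul (by linarith : 0 ≤ 1 + e),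
      mul_assoc]
    exact mul_le_mul_right (h.mul_measure_firstSep_le hk he hed hdl u v).2 _
  · calc _ ≤ ∑ u, ∑ v, 1000 * K * ((G.mult u v : ℝ) * sqDist (bar u) (bar v)) := by
          refine Finset.sum_le_sum fun u _ => Finset.sum_le_sum fun v _ => ?_
          have hD := sqDist_nonneg (bar u) (bar v)
          have : (2 + e) * ((1 + 1 / e) * sqDist (bar u) (bar v)) +
              320 * t ^ 2 / e * sqDist (bar u) (bar v) +
              (1 + e) * (320 * t ^ 2 / e * sqDist (bar u) (bar v)) ≤
              1000 * K * sqDist (bar u) (bar v) := by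
            rw [e1]
            have : (2 + e) * (1 + 1 / e) + 320 * K + (1 + e) * (320 * K) ≤ 1000 * K := by
              have a1 : (2 + e) * (1 + 1 / e) ≤ 3 * (2 * K) :=
                mul_le_mul (by linarith) (by linarith) (by linarith) (by norm_num)
              have a2 : (1 + e) * (320 * K) ≤ (1 + 1 / 100) * (320 * K) :=
                mul_le_mul_of_nonneg_right (by linarith) (by linarith)
              linarith
            have := mul_le_mul_of_nonneg_right this hD
            linarith
          calc _ ≤ (G.mult u v : ℝ) * (1000 * K * sqDist (bar u) (bar v)) :=
                mul_le_mul_of_nonneg_left this (Nat.cast_nonneg _)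
            _ = _ := by ring
      _ = 1000 * K * ∑ u, ∑ v, (G.mult u v : ℝ) * sqDist (bar u) (bar v) := by
          simp only [Finset.mul_sum]
      _ ≤ 1000 * K * (2 * d * k * lam) :=
          mul_le_mul_of_nonneg_left h.energy_le (by positivity)
      _ = _ := by rw [hK]; ring

open Classical in
/-- With probability at least `1/4` the leftover is small and the costs are small. -/
theorem IsEmbedding.exists_event (h : IsEmbedding G bar lam) (hk : 1 ≤ k) (he : 0 < e)
    (hed : e ≤ dl) (hdl : dl ≤ 1 / 100) :
    ∃ E : Set (ℕ × ℕ → ℝ), MeasurableSet E ∧ 1 / 4 ≤ gaussTable.real E ∧ ∀ ω ∈ E,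
      ((bufferSet (drawnRound (normalized bar) (sqLength bar) dl e ω)
        (sepRounds dl k)).card : ℝ) ≤ 16 * e * n ∧
      (∑ u, if u ∈ bufferSet (drawnRound (normalized bar) (sqLength bar) dl e ω) (sepRounds dl k)
        then sqLength bar u else 0) ≤ 16 * e * k ∧
      (∑ u, if ∀ t < sepRounds dl k,
        Misses (drawnRound (normalized bar) (sqLength bar) dl e ω t) u
        then sqLength bar u else 0) ≤ 4 * dl * k ∧
      totalCost G (sqLength bar) e (fun u v => (1 + 1 / e) * sqDist (bar u) (bar v))
        (drawnRound (normalized bar) (sqLength bar) dl e ω) (sepRounds dl k) ≤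
        8 * (2000 * sepThreshold dl k ^ 2 * d * lam / e * k) := by
  have hS := h.isSepData hk he hed hdl
  have hdl0 : 0 < dl := he.trans_le hed
  set T := sepRounds dl k with hT
  set smp := drawnRound (normalized bar) (sqLength bar) dl e with hsmp
  have i1 : HasIntLe gaussTable (fun ω => ∑ u : Fin n, if FirstBuffer (smp ω) T u then (1 : ℝ) else 0)
      (2 * e * n) := by
    refine (HasIntLe.sum _ fun u => HasIntLe.ite_event (measurableSet_firstBuffer u T) zero_le_one
      (L := 2 * e) (by positivity) ?_).mono (le_of_eq ?_)
    · rw [ENNReal.ofReal_one, one_mul]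
      exact hS.measure_firstBuffer_le u
    · rw [Finset.sum_const, Finset.card_univ, Fintype.card_fin, nsmul_eq_mul]
      ring
  have i2 : HasIntLe gaussTable (fun ω => ∑ u, if FirstBuffer (smp ω) T u then sqLength bar u else 0)
      (2 * e * k) := by
    refine (HasIntLe.sum _ fun u => HasIntLe.ite_event (measurableSet_firstBuffer u T)
      (sqLength_nonneg bar u) (L := sqLength bar u * (2 * e))
      (mul_nonneg (sqLength_nonneg bar u) (by positivity)) ?_).mono (le_of_eq ?_)
    · rw [ENNReal.ofReal_mul (sqLength_nonneg bar u)]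
      exact mul_le_mul_right (hS.measure_firstBuffer_le u) _
    · rw [← Finset.sum_mul, sum_sqLength h.orthonormal]
      ring
  have i3 : HasIntLe gaussTable (fun ω => ∑ u, if ∀ t < T, Misses (smp ω t) u
      then sqLength bar u else 0) (dl * k) := by
    refine (HasIntLe.sum _ fun u => HasIntLe.ite_event (measurableSet_never u T)
      (sqLength_nonneg bar u) (L := sqLength bar u * dl)
      (mul_nonneg (sqLength_nonneg bar u) hdl0.le) ?_).mono (le_of_eq ?_)
    · rw [ENNReal.ofReal_mul (sqLength_nonneg bar u)]
      by_cases hu : sqLength bar u = 0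
      · rw [hu]; simp
      · exact mul_le_mul_right (hS.measure_never_le (normalized_unit hu)) _
    · rw [← Finset.sum_mul, sum_sqLength h.orthonormal]
      ring
  have i4 := h.hasIntLe_totalCost hk he hed hdl
  have m1 := i1.measure_lt_le (c := 8) (by norm_num)
  have m2 := i2.measure_lt_le (c := 8) (by norm_num)
  have m3 := i3.measure_lt_le (c := 4) (by norm_num)
  have m4 := i4.measure_lt_le (c := 8) (by norm_num)
  set A1 := {ω | 8 * (2 * e * n) < ∑ u : Fin n, if FirstBuffer (smp ω) T u then (1 : ℝ) else 0}
  set A2 := {ω | 8 * (2 * e * k) < ∑ u, if FirstBuffer (smp ω) T u then sqLength bar u else 0}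
  set A3 := {ω | 4 * (dl * k) < ∑ u, if ∀ t < T, Misses (smp ω t) u then sqLength bar u else 0}
  set A4 := {ω | 8 * (2000 * sepThreshold dl k ^ 2 * d * lam / e * k) <
    totalCost G (sqLength bar) e (fun u v => (1 + 1 / e) * sqDist (bar u) (bar v)) (smp ω) T}
  have hA : MeasurableSet (A1 ∪ A2 ∪ A3 ∪ A4) :=
    (((measurableSet_lt measurable_const i1.measurable).union
      (measurableSet_lt measurable_const i2.measurable)).union
      (measurableSet_lt measurable_const i3.measurable)).union
      (measurableSet_lt measurable_const i4.measurable)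
  -- Markov's inequality is used with factor 4 for the unmet measure and 8 for the other three
  -- quantities; this leaves probability at least 3/8.
  have hbad : gaussTable (A1 ∪ A2 ∪ A3 ∪ A4) ≤ ENNReal.ofReal (5 / 8) := by
    calc _ ≤ gaussTable A1 + gaussTable A2 + gaussTable A3 + gaussTable A4 :=
          (measure_union_le _ _).trans (add_le_add_left ((measure_union_le _ _).trans
            (add_le_add_left (measure_union_le _ _) _)) _)
      _ ≤ ENNReal.ofReal (1 / 8) + ENNReal.ofReal (1 / 8) + ENNReal.ofReal (1 / 4) +
          ENNReal.ofReal (1 / 8) := add_le_add (add_le_add (add_le_add m1 m2) m3) m4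
      _ = _ := by
          rw [← ENNReal.ofReal_add (by norm_num) (by norm_num),
            ← ENNReal.ofReal_add (by norm_num) (by norm_num),
            ← ENNReal.ofReal_add (by norm_num) (by norm_num)]
          norm_num
  refine ⟨(A1 ∪ A2 ∪ A3 ∪ A4)ᶜ, hA.compl, ?_, fun ω hω => ?_⟩
  · rw [probReal_compl_eq_one_sub hA]
    have : gaussTable.real (A1 ∪ A2 ∪ A3 ∪ A4) ≤ 5 / 8 :=
      ENNReal.toReal_le_of_le_ofReal (by norm_num) hbad
    linarith
  · simp only [Set.mem_compl_iff, Set.mem_union, not_or] at hω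
    obtain ⟨⟨⟨w1, w2⟩, w3⟩, w4⟩ := hω
    simp only [A1, Set.mem_ofPred_eq, not_lt] at w1
    simp only [A2, Set.mem_ofPred_eq, not_lt] at w2
    simp only [A3, Set.mem_ofPred_eq, not_lt] at w3
    simp only [A4, Set.mem_ofPred_eq, not_lt] at w4
    have hsub : ∀ u, u ∈ bufferSet (smp ω) T → FirstBuffer (smp ω) T u := fun u hu =>
      firstBuffer_of_not_crudePart (mem_bufferSet.1 hu).1 (mem_bufferSet.1 hu).2
    refine ⟨?_, ?_, by linarith, w4⟩
    · rw [card_eq_sum]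
      refine le_trans (Finset.sum_le_sum fun u _ => ?_) (w1.trans (le_of_eq (by ring)))
      split_ifs with a b <;> first | exact absurd (hsub u a) b | norm_num
    · refine le_trans (Finset.sum_le_sum fun u _ => ?_) (w2.trans (le_of_eq (by ring)))
      have := sqLength_nonneg bar u
      split_ifs with a b <;> first | exact absurd (hsub u a) b | linarith

end GoodEvent

end BufferedCheeger

namespace BufferedCheeger

/-! ### Constants and conclusion -/

section Final

/-- The factor of `log k` in the bound for the square of the separator threshold, up to
`96 / dl`. -/
noncomputable def logFactor (dl : ℝ) : ℝ := 1 + Real.log (4 / dl) / Real.log 2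

theorem one_le_logFactor {dl : ℝ} (h0 : 0 < dl) (h1 : dl ≤ 1) : 1 ≤ logFactor dl := by
  have h2 : 0 ≤ Real.log (4 / dl) := Real.log_nonneg (by rw [le_div_iff₀ h0]; linarith)
  have h3 : 0 < Real.log 2 := Real.log_pos (by norm_num)
  unfold logFactor
  have : 0 ≤ Real.log (4 / dl) / Real.log 2 := by positivity
  linarith

/-- Since `log k ≥ log 2`, the constant `log (4 / dl)` is itself a bounded multiple of `log k`. This
is where `k = 1` has to be excluded. -/
theorem sepThreshold_sq_le {dl : ℝ} (h0 : 0 < dl) (h1 : dl ≤ 1) {k : ℕ} (hk : 2 ≤ k) :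
    sepThreshold dl k ^ 2 ≤ 96 / dl * (Real.log k * logFactor dl) := by
  rw [sepThreshold_sq h0 h1 (by omega)]
  refine mul_le_mul_of_nonneg_left ?_ (by positivity)
  have hk' : (2 : ℝ) ≤ k := by exact_mod_cast hk
  have h3 : 0 < Real.log 2 := Real.log_pos (by norm_num)
  have h4 : Real.log 2 ≤ Real.log k := Real.log_le_log (by norm_num) hk'
  have h2 : 0 ≤ Real.log (4 / dl) := Real.log_nonneg (by rw [le_div_iff₀ h0]; linarith)
  have e1 : 4 * (k : ℝ) / dl = k * (4 / dl) := by ring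
  rw [e1, Real.log_mul (by positivity) (by positivity), logFactor, mul_add, mul_one]
  refine add_le_add le_rfl ?_
  rw [mul_div_assoc', le_div_iff₀ h3]
  nlinarith

/-- The constant in the bounds for the numbers of edges. -/
noncomputable def edgeConstant (dl : ℝ) : ℝ := 3200000 * logFactor dl / dl ^ 3

theorem edgeConstant_pos {dl : ℝ} (h0 : 0 < dl) (h1 : dl ≤ 1) : 0 < edgeConstant dl := by
  have := one_le_logFactor h0 h1
  unfold edgeConstant
  positivity

/-- The reciprocal of the bound for the edge counts, which is chosen as `n` if there must not be
any edges. -/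
theorem exists_multiplier {dl ε e lam : ℝ} (h0 : 0 < dl) (h1 : dl ≤ 1) (hε : 0 < ε) (hε1 : ε ≤ 1)
    (he : e = min ε dl) (hlam : 0 ≤ lam) {n d k : ℕ} (hd : 0 < d) (hk : 2 ≤ k) :
    ∃ x : ℝ, 0 ≤ x ∧ (∀ p c : ℕ, 1 ≤ p → p ≤ n →
      edgeConstant dl / ε * lam * Real.log k * ((d : ℝ) * p) < c → (p : ℝ) ≤ x * c) ∧
      x * (8 / dl * (2000 * sepThreshold dl k ^ 2 * d * lam / e)) ≤ 1 / 2 := by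
  have hd' : (0 : ℝ) < d := by exact_mod_cast hd
  have hk' : (2 : ℝ) ≤ k := by exact_mod_cast hk
  have hlog : 0 < Real.log k := Real.log_pos (by linarith)
  have hC := edgeConstant_pos h0 h1
  have he0 : 0 < e := by rw [he]; exact lt_min hε h0
  rcases hlam.eq_or_lt with hl | hl
  -- If `λ_k = 0`, the constraints allow no edge at all. A violation then has at least one edge, and
  -- `p ≤ n` does the rest.
  · refine ⟨n, Nat.cast_nonneg n, fun p c _ hpn hc => ?_, ?_⟩
    · rw [← hl] at hc
      simp only [mul_zero, zero_mul] at hc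
      have : 1 ≤ c := by exact_mod_cast hc
      exact_mod_cast hpn.trans (Nat.le_mul_of_pos_right n this)
    · rw [← hl]
      norm_num
  · set kap := edgeConstant dl / ε * lam * Real.log k with hkap
    have hkap0 : 0 < kap := by positivity
    refine ⟨1 / (kap * d), by positivity, fun p c _ _ hc => ?_, ?_⟩
    · rw [one_div_mul_eq_div, le_div_iff₀ (by positivity)]
      linarith
    · have hK := one_le_logFactor h0 h1
      have ht := sepThreshold_sq_le h0 h1 hk
      -- Replacing `e` by `ε * dl` brings out the factor `1 / ε` of the theorem, at the cost of the
      -- third power of `dl` in the constant.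
      have hεe : ε * dl ≤ e := by
        rw [he]
        refine le_min ?_ ?_ <;> nlinarith
      rw [one_div_mul_eq_div, div_le_iff₀ (by positivity)]
      have e1 : 1 / 2 * (kap * d) = (1600000 * logFactor dl * Real.log k / dl ^ 3) *
          (d * lam / ε) := by
        rw [hkap, edgeConstant]
        ring
      calc 8 / dl * (2000 * sepThreshold dl k ^ 2 * d * lam / e)
          ≤ 8 / dl * (2000 * (96 / dl * (Real.log k * logFactor dl)) * d * lam / (ε * dl)) := by
            gcongr
        _ = (1536000 * logFactor dl * Real.log k / dl ^ 3) * (d * lam / ε) := by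
            field_simp
            ring
        _ ≤ _ := by
            rw [e1]
            gcongr
            norm_num

variable {n d k : ℕ}

theorem isGood_eval {S : EigenSolver} (hS : IsCorrectSolver S) (G : RegularGraph n d) (hd : 0 < d)
    (hk : 1 < k) (hkn : k ≤ n) {ε δ : ℝ} (hδ0 : 0 < δ) (hδ : δ < 1 / 80) (hε0 : 0 < ε)
    (hε : ε < 1 / 80) :
    ∃ E : Set (ℕ × ℕ → ℝ), MeasurableSet E ∧ 1 / 4 ≤ gaussTable.real E ∧ ∀ ω ∈ E,
      ((partitionAlgorithm G.mult d k (Nat.zero_lt_of_lt hk) hkn ε δ (100 / (δ / 50))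
        (edgeConstant (δ / 50))).eval S ω).IsGood G k ε δ (100 / (δ / 50))
        (edgeConstant (δ / 50)) := by
  classical
  have hk0 : 0 < k := Nat.zero_lt_of_lt hk
  set dl := δ / 50 with hdl
  set e := min ε dl with he
  have hdl0 : 0 < dl := by positivity
  have hdl1 : dl ≤ 1 / 100 := by rw [hdl]; linarith
  have he0 : 0 < e := lt_min hε0 hdl0
  have heε : e ≤ ε := min_le_left _ _
  have hed : e ≤ dl := min_le_right _ _
  have hemb := isEmbedding_embedding hS G hd hk0 hkn
  set bar := embedding S G hkn with hbar
  obtain ⟨E, hE, hP, hgood⟩ := hemb.exists_event hk0 he0 hed hdl1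
  refine ⟨E, hE, hP, fun ω hω => ?_⟩
  obtain ⟨g1, g2, g3, g4⟩ := hgood ω hω
  obtain ⟨x, hx0, hx, hxM⟩ := exists_multiplier (n := n) (k := k) hdl0 (by linarith) hε0
    (by linarith) he hemb.lam_nonneg hd hk
  rw [eval_partitionAlgorithm, solverEigenvalue_eq_lam hS G hk0 hkn]
  -- The samples `roundSample` of the program and `drawnRound` of the probabilistic part agree by
  -- definition. The count needed is weaker than the one obtained, as `23 * dl = 23 δ / 50` is less
  -- than `2 δ`.
  refine isGood_finalOutput G _ he0 _ _ k ε δ _ _ (le_trans ?_ (le_card_refined G hd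
    (sqLength_nonneg bar) (sum_sqLength hemb.orthonormal) he0 heε hed hdl1
    (D := fun u v => (1 + 1 / e) * sqDist (bar u) (bar v))
    (fun u v => mul_nonneg (by positivity) (sqDist_nonneg _ _))
    (fun u v => by rw [sqDist_comm]) (sqLength_sub_le he0) (roundSample bar dl e ω)
    (sepRounds dl k) (fun t _ => ?_) g2 g3
    (M := 2000 * sepThreshold dl k ^ 2 * d * G.lam k / e)
    (div_nonneg (mul_nonneg (by positivity) hemb.lam_nonneg) he0.le) g4 hx0 hx hxM)) ?_
  · refine mul_le_mul_of_nonneg_right ?_ (Nat.cast_nonneg k)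
    rw [hdl]
    linarith
  · refine le_trans (Finset.sum_le_sum fun u _ => ?_) (hemb.sum_sample_le hk0 he0 hed hdl1
      (tableRow k t ω))
    by_cases hu : crudePart (roundSample bar dl e ω) t u = true
    · have hX : (drawn (normalized bar) (sqLength bar) dl e (tableRow k t ω)).1 u = true :=
        (crudePart_iff.1 hu).1
      rw [if_pos hu, if_pos hX]
    · rw [if_neg hu]
      split_ifs
      exacts [sqLength_nonneg bar u, le_rfl]
  · refine g1.trans ?_
    gcongr

theorem exists_steps_le {δ : ℝ} (hδ0 : 0 < δ) (hδ : δ ≤ 50) :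
    ∃ c : ℕ, ∀ (n d k : ℕ) (hk : 0 < k) (hkn : k ≤ n) (_ : 2 ≤ n) (w : Fin n → Fin n → ℕ)
      (ε C1 C2 : ℝ) (S : EigenSolver) (ω : ℕ × ℕ → ℝ),
      (partitionAlgorithm w d k hk hkn ε δ C1 C2).steps S ω ≤ c * n ^ c := by
  obtain ⟨c, hc⟩ := exists_sepRounds_le (dl := δ / 50) (by positivity) (by linarith)
  -- One number serves as coefficient and as exponent: it dominates both `2500 * (c + 1)` and `4 +
  -- c`.
  refine ⟨2500 * (c + 1) + (4 + c), fun n d k hk hkn hn w ε C1 C2 S ω => ?_⟩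
  refine (steps_partitionAlgorithm_le ..).trans ?_
  have h1 : sepRounds (δ / 50) k + 1 ≤ (c + 1) * n ^ c := by
    have h2 : c * k ^ c ≤ c * n ^ c := Nat.mul_le_mul_left _ (Nat.pow_le_pow_left hkn c)
    have h3 : 1 ≤ n ^ c := Nat.one_le_pow _ _ (by omega)
    have := hc k hk
    nlinarith
  calc 2500 * n ^ 4 * (sepRounds (δ / 50) k + 1) ≤ 2500 * n ^ 4 * ((c + 1) * n ^ c) :=
        Nat.mul_le_mul_left _ h1
    _ = 2500 * (c + 1) * n ^ (4 + c) := by rw [pow_add]; ring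
    _ ≤ _ := Nat.mul_le_mul (by omega) (Nat.pow_le_pow_right (by omega) (by omega))

end Final

end BufferedCheeger

theorem theorem4p1 :
    ∃ C' C'' : ℝ → ℝ, ∀ δ : ℝ, 0 < δ → δ < 1 / 80 →
      ∃ c : ℕ, ∀ (n d k : ℕ) (hk : 1 < k) (hkn : k ≤ n), 0 < d →
        ∀ (G : BufferedCheeger.RegularGraph n d) (ε : ℝ), 0 < ε → ε < 1 / 80 →
        ∀ S : BufferedCheeger.Prog.EigenSolver, BufferedCheeger.Prog.IsCorrectSolver S →
          (∀ ω : ℕ × ℕ → ℝ,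
            (BufferedCheeger.partitionAlgorithm G.mult d k (Nat.zero_lt_of_lt hk) hkn
              ε δ (C' δ) (C'' δ)).steps S ω ≤ c * n ^ c) ∧
          ∃ E : Set (ℕ × ℕ → ℝ), MeasurableSet E ∧
            1 / 4 ≤ BufferedCheeger.gaussTable.real E ∧
            ∀ ω ∈ E,
              ((BufferedCheeger.partitionAlgorithm G.mult d k (Nat.zero_lt_of_lt hk) hkn
                ε δ (C' δ) (C'' δ)).eval S ω).IsGood G k ε δ (C' δ) (C'' δ) := by
  refine ⟨fun δ => 100 / (δ / 50), fun δ => BufferedCheeger.edgeConstant (δ / 50),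
    fun δ hδ0 hδ => ?_⟩
  obtain ⟨c, hc⟩ := BufferedCheeger.exists_steps_le hδ0 (by linarith)
  exact ⟨c, fun n d k hk hkn hd G ε hε0 hε S hS =>
    ⟨fun ω => hc n d k _ hkn (by omega) G.mult ε _ _ S ω,
      BufferedCheeger.isGood_eval hS G hd hk hkn hδ0 hδ hε0 hε⟩⟩
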